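/- Let $N\ge 2$, let $h$ be a formal parameter, let $c\in\mathbb{C}$ with $c\neq -N/2$, and let $G=(g_{ij})$ be a nonsingular complex $N\times N$ matrix with $G^t=G$ (case $\mathfrak{g}_N=\mathfrak{o}_N$) or $G^t=-G$ (case $\mathfrak{g}_N=\mathfrak{sp}_N$). Let $P$ be the permutation operator on $\mathbb{C}^N\otimes\mathbb{C}^N$, put $R(u)=1-\frac{h}{u}P$ and $\overline R(u)=g(u/h)R(u)$, where $g(u)\in 1+u^{-1}\mathbb{C}[[u^{-1}]]$ is the unique series with $g(u+N)=g(u)(1-u^{-2})$, and let $\overline R^{\,t}$ be obtained from $\overline R$ by transposing one tensor factor. Negative powers of a linear expression are expanded in negative powers of its leftmost variable. The double Yangian $\mathrm{DY}_c=\mathrm{DY}_c(\mathfrak{gl}_N)$ at the level $c$ is the $\mathbb{C}[[h]]$-algebra generated by $t_{ij}^{(\pm r)}$, $1\le i,j\le N$, $r\ge 1$, subject to the relations $$R(u-v)T_1(u)T_2(v)=T_2(v)T_1(u)R(u-v),\qquad R(u-v)T^+_1(u)T^+_2(v)=T^+_2(v)T^+_1(u)R(u-v),$$ $$\overline R(u-v+hc/2)\,T_1(u)T_2^+(v)=T_2^+(v)T_1(u)\,\overline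 R(u-v-hc/2),$$ in which common powers of $h$ are cancelled (so that $\mathrm{DY}_c$ has no $h$-torsion); here $T(u)=1+h\sum_{r\ge1}t^{(r)}u^{-r}$, $T^+(u)=1-h\sum_{r\ge1}t^{(-r)}u^{r-1}$ and $t^{(\pm r)}=(t_{ij}^{(\pm r)})_{i,j}$. Put $$S^+(u)=T^+(u)\,G\,T^{+}(-u)^t=G-h\sum_{r\ge1}s^{(-r)}u^{r-1},\qquad S(u)=T(u+hc)\,G\,T(-u)^t=G+h\sum_{r\ge1}s^{(r)}u^{-r},$$ let $\mathrm A_c(\mathfrak{g}_N)\subset\mathrm{DY}_c$ be the subalgebra generated by all matrix entries $s_{ij}^{(\pm r)}$, let $I_p$ be the left ideal of $\mathrm{DY}_c$ generated by all $t_{ij}^{(r)}$ with $r\ge p$, and let $\widetilde{\mathrm A}_c(\mathfrak{g}_N)$ be the $h$-adic completion of $\varprojlim_p \mathrm A_c(\mathfrak{g}_N)/(\mathrm A_c(\mathfrak{g}_N)\cap I_p)$, that is, the closure of $\mathrm A_c(\mathfrak{g}_N)$ in the completion of $\mathrm{DY}_c$ with respect to the left ideals $I_p+h^n\mathrm{DY}_c$,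 $p,n\ge 0$. For $u_-=(u_1,\dots,u_N)=(u,u-h,\dots,u-(N-1)h)$ define the ordered products $$S^+_{[N]}(u_-)=\prod_{i=1}^{N}\Big(S^+_i(u_i)\,\overline R^{\,t}_{i\,i+1}(-u_i-u_{i+1})\cdots\overline R^{\,t}_{iN}(-u_i-u_N)\Big),$$ $$S_{[N]}(u_-+hc/2)=\prod_{i=1}^{N}\Big(S_i(u_i+hc/2)\,\overline R^{\,t}_{i\,i+1}(-u_i-u_{i+1}-2hc)\cdots\overline R^{\,t}_{iN}(-u_i-u_N-2hc)\Big)$$ (factors ordered by increasing $i$; subscripts indicate the copies of $\operatorname{End}\mathbb{C}^N$; everything is expanded in powers of $u$), and let $A^{(N)}=\frac1{N!}\sum_{\sigma\in\mathfrak S_N}\operatorname{sgn}\sigma\cdot\sigma$ act on $(\mathbb{C}^N)^{\otimes N}$. Then $$\mathbb{A}(u)=\operatorname{tr}_{1,\dots,N}\,A^{(N)}\,S^+_{[N]}(u_-)\,S_{[N]}(u_-+hc/2)^{-1}$$ is a well-defined series in $u^{\pm1}$ with coefficients in $\widetilde{\mathrm A}_c(\mathfrak{g}_N)$, and all its coefficients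 belong to the center of the algebra $\widetilde{\mathrm A}_c(\mathfrak{g}_N)$. -/

import Mathlib

noncomputable section
namespace TwistedYangian
open PowerSeries Kronecker

/-- The ground ring `ℂ[[h]]`. -/
def K : Type := PowerSeries ℂ

instance : CommRing K := inferInstanceAs (CommRing (PowerSeries ℂ))

instance : IsDomain K := inferInstanceAs (IsDomain (PowerSeries ℂ))

instance : Algebra ℂ K := inferInstanceAs (Algebra ℂ (PowerSeries ℂ))

/-- The formal parameter `h`. -/
def h : K := (PowerSeries.X : PowerSeries ℂ)

lemma h_ne_zero : h ≠ 0 := PowerSeries.X_ne_zero (R := ℂ)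

/-- The expansion of `(α u + s)⁻¹` in negative powers of `u`, as a power series in `u⁻¹`. -/
def invLin {B : Type*} [CommRing B] [Algebra ℂ B] (α : ℂ) (s : B) : PowerSeries B :=
  PowerSeries.mk fun m => match m with
    | 0 => 0
    | m + 1 => α⁻¹ • (-(α⁻¹ • s)) ^ m

/-- The substitution `∑ r, a r * y ^ r` of a power series `y` without constant term. -/
def evalInv {B A : Type*} [CommRing B] [AddCommMonoid A] [Module B A]
    (a : ℕ → A) (y : PowerSeries B) : PowerSeries A :=
  PowerSeries.mk fun m => ∑ r ∈ Finset.range (m + 1), PowerSeries.coeff m (y ^ r) • a r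

lemma invLin_eq (N : ℂ) : invLin (B := ℂ) 1 N = X * PowerSeries.mk (fun m => (-N) ^ m) := by
  ext m
  cases m with
  | zero => simp [invLin]
  | succ m => simp [invLin, coeff_succ_X_mul]

lemma coeff_invLin_pow_self (N : ℂ) (r : ℕ) : coeff r ((invLin (B := ℂ) 1 N) ^ r) = 1 := by
  rw [invLin_eq, mul_pow]
  have := coeff_X_pow_mul ((PowerSeries.mk (fun m => (-N) ^ m)) ^ r) r 0
  rw [zero_add] at this
  rw [this, coeff_zero_eq_constantCoeff, map_pow]
  simp [← coeff_zero_eq_constantCoeff_apply]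

lemma coeff_invLin_pow_succ (N : ℂ) (r : ℕ) :
    coeff (r + 1) ((invLin (B := ℂ) 1 N) ^ r) = - (r * N) := by
  rw [invLin_eq, mul_pow]
  have := coeff_X_pow_mul ((PowerSeries.mk (fun m => (-N) ^ m)) ^ r) r 1
  rw [add_comm] at this
  rw [this, coeff_one_pow]
  simp [← coeff_zero_eq_constantCoeff_apply]

lemma g_rec (N : ℕ) (g : PowerSeries ℂ) :
    (evalInv (fun r => coeff r g) (invLin 1 (N : ℂ)) = g * (1 - X ^ 2)) ↔
    ∀ m : ℕ, ((m : ℂ) + 1) * N * coeff (m + 1) g = coeff m g +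
      ∑ r ∈ Finset.range (m + 1), coeff (m + 2) ((invLin (B := ℂ) 1 N) ^ r) * coeff r g := by
  have key : ∀ m, coeff m (evalInv (fun r => coeff r g) (invLin 1 (N : ℂ)))
      = ∑ r ∈ Finset.range (m + 1), coeff m ((invLin (B := ℂ) 1 N) ^ r) * coeff r g := by
    intro m; simp [evalInv]
  have h2 : ∀ m, coeff (m + 2) (evalInv (fun r => coeff r g) (invLin 1 (N : ℂ)))
      = (∑ r ∈ Finset.range (m + 1), coeff (m + 2) ((invLin (B := ℂ) 1 N) ^ r) * coeff r g)
        - ((m : ℂ) + 1) * N * coeff (m + 1) g + coeff (m + 2) g := by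
    intro m
    rw [key, Finset.sum_range_succ, Finset.sum_range_succ, coeff_invLin_pow_self,
      coeff_invLin_pow_succ]
    push_cast; ring
  have h3 : ∀ m, coeff (m + 2) (g * (1 - X ^ 2)) = coeff (m + 2) g - coeff m g := by
    intro m
    rw [mul_sub, mul_one, map_sub, coeff_mul_X_pow]
  constructor
  · intro H m
    have := congrArg (coeff (m + 2)) H
    rw [h2, h3] at this
    linear_combination -this
  · intro H
    ext m
    match m with
    | 0 => rw [key]; simp
    | 1 =>
      rw [key, Finset.sum_range_succ, Finset.sum_range_one, coeff_invLin_pow_self]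
      have : coeff 1 (g * X ^ 2) = 0 := by
        rw [coeff_mul_X_pow']; simp
      rw [mul_sub, map_sub, this]
      simp [coeff_one]
    | m + 2 =>
      rw [h2, h3]
      linear_combination -H m

theorem existsUnique_g (N : ℕ) [NeZero N] : ∃! g : PowerSeries ℂ,
    constantCoeff g = 1 ∧
      evalInv (fun r => coeff r g) (invLin 1 (N : ℂ)) = g * (1 - X ^ 2) := by
  have hN : (N : ℂ) ≠ 0 := NeZero.ne _
  let f : ℕ → ℂ := fun n => Nat.strongRec (motive := fun _ => ℂ) (fun n ih => match n, ih with
    | 0, _ => 1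
    | m + 1, ih => (((m : ℂ) + 1) * N)⁻¹ * (ih m (Nat.lt_succ_self m) +
        ∑ r : Fin (m + 1), coeff (m + 2) ((invLin (B := ℂ) 1 N) ^ (r : ℕ)) * ih r r.2)) n
  have f0 : f 0 = 1 := by
    simp only [f]; rw [Nat.strongRec_eq]
  have fs : ∀ m, f (m + 1) = (((m : ℂ) + 1) * N)⁻¹ * (f m +
        ∑ r : Fin (m + 1), coeff (m + 2) ((invLin (B := ℂ) 1 N) ^ (r : ℕ)) * f r) := by
    intro m
    simp only [f]; rw [Nat.strongRec_eq]
  refine ⟨PowerSeries.mk f, ⟨?_, ?_⟩, ?_⟩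
  · simp [← coeff_zero_eq_constantCoeff_apply, f0]
  · rw [g_rec]
    intro m
    have : ((m : ℂ) + 1) ≠ 0 := Nat.cast_add_one_ne_zero m
    simp only [coeff_mk]
    rw [fs, Finset.sum_range, mul_inv_cancel_left₀ (mul_ne_zero this hN)]
  · rintro g ⟨g0, hg⟩
    rw [g_rec] at hg
    ext n
    rw [coeff_mk]
    induction n using Nat.strongRecOn with
    | ind n ih =>
      cases n with
      | zero => rw [f0, coeff_zero_eq_constantCoeff_apply, g0]
      | succ m =>
        have : ((m : ℂ) + 1) ≠ 0 := Nat.cast_add_one_ne_zero m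
        rw [fs, eq_inv_mul_iff_mul_eq₀ (mul_ne_zero this hN), hg, ih m (by omega), Finset.sum_range]
        congr 1
        refine Finset.sum_congr rfl fun r _ => ?_
        rw [ih r (by omega)]

/-- The unique series `g(u) ∈ 1 + u⁻¹ℂ[[u⁻¹]]` with `g(u + N) = g(u)(1 - u⁻²)`, written as a
power series in `u⁻¹`. -/
def gSeries (N : ℕ) [NeZero N] : PowerSeries ℂ := (existsUnique_g N).choose


section RMatrix

variable {N : ℕ}

/-- The permutation operator `P = ∑ e_ij ⊗ e_ji` on `ℂ^N ⊗ ℂ^N`. -/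
def permMat (B : Type*) [CommRing B] : Matrix (Fin N × Fin N) (Fin N × Fin N) B :=
  Matrix.of fun a b => if a.1 = b.2 ∧ a.2 = b.1 then 1 else 0

/-- The normalized Yang `R`-matrix `g(x/h) (1 - (h/x) P)`, where `y` is the expansion of `x⁻¹`. -/
def Rbar [NeZero N] {B : Type*} [CommRing B] [Algebra K B] (y : PowerSeries B) :
    Matrix (Fin N × Fin N) (Fin N × Fin N) (PowerSeries B) :=
  evalInv (fun r => algebraMap K B (algebraMap ℂ K (coeff r (gSeries N))))
      (C (algebraMap K B h) * y) •
    (1 - (C (algebraMap K B h) * y) • permMat (PowerSeries B))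

/-- Transposition of the first tensor factor of `End ℂ^N ⊗ End ℂ^N`. -/
def partialTranspose {B : Type*} (M : Matrix (Fin N × Fin N) (Fin N × Fin N) B) :
    Matrix (Fin N × Fin N) (Fin N × Fin N) B :=
  Matrix.of fun a b => M (b.1, a.2) (a.1, b.2)

end RMatrix

section DoubleYangian

/-- The generators of the double Yangian: `pos i j r` stands for `t_ij^{(r+1)}` and
`neg i j r` for `t_ij^{(-r-1)}`. -/
inductive Gen (N : ℕ) : Type
  | pos (i j : Fin N) (r : ℕ) : Gen N
  | neg (i j : Fin N) (r : ℕ) : Gen N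

variable {N : ℕ} {A : Type*} [Ring A] [Algebra K A]

/-- `T(u) = 1 + h ∑_{r ≥ 1} t^{(r)} u^{-r}`, as a power series in `u⁻¹`. -/
def Tmat (t : Gen N → A) : Matrix (Fin N) (Fin N) (PowerSeries A) :=
  Matrix.of fun i j => PowerSeries.mk fun r => match r with
    | 0 => if i = j then 1 else 0
    | r + 1 => h • t (.pos i j r)

/-- `T⁺(u) = 1 - h ∑_{r ≥ 1} t^{(-r)} u^{r-1}`, as a power series in `u`. -/
def Tplus (t : Gen N → A) : Matrix (Fin N) (Fin N) (PowerSeries A) :=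
  Matrix.of fun i j => PowerSeries.mk fun r =>
    (if i = j ∧ r = 0 then 1 else 0) - h • t (.neg i j r)

/-- Power series in two commuting variables `a`, `b` that commute with the coefficients: `a` is the
variable of the outer, `b` the variable of the inner power series. -/
abbrev Bi (A : Type*) := PowerSeries (PowerSeries A)

/-- The variable `a`. -/
abbrev va : Bi K := X

/-- The variable `b`. -/
abbrev vb : Bi K := C X

/-- `f ↦ f(a)`, on the first tensor factor. -/
def site1 (M : Matrix (Fin N) (Fin N) (PowerSeries A)) :
    Matrix (Fin N × Fin N) (Fin N × Fin N) (Bi A) :=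
  M.map (PowerSeries.map (C (R := A))) ⊗ₖ 1

/-- `f ↦ f(b)`, on the second tensor factor. -/
def site2 (M : Matrix (Fin N) (Fin N) (PowerSeries A)) :
    Matrix (Fin N × Fin N) (Fin N × Fin N) (Bi A) :=
  1 ⊗ₖ M.map (C (R := PowerSeries A))

/-- Scalar series, regarded as series with coefficients in `A`. -/
def scal (A : Type*) [Ring A] [Algebra K A] : Bi K →+* Bi A :=
  PowerSeries.map (PowerSeries.map (algebraMap K A))

/-- The difference of the two sides of `R(u-v) T₁(u) T₂(v) = T₂(v) T₁(u) R(u-v)`, multiplied by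
`(u - v) u⁻¹ v⁻¹`; here `a = u⁻¹` and `b = v⁻¹`. -/
def relT (t : Gen N → A) : Matrix (Fin N × Fin N) (Fin N × Fin N) (Bi A) :=
  let R : Matrix (Fin N × Fin N) (Fin N × Fin N) (Bi K) :=
    (vb - va) • 1 - (va * vb * C (C h)) • permMat (Bi K)
  R.map (scal A) * site1 (Tmat t) * site2 (Tmat t) -
    site2 (Tmat t) * site1 (Tmat t) * R.map (scal A)

/-- The difference of the two sides of `R(u-v) T⁺₁(u) T⁺₂(v) = T⁺₂(v) T⁺₁(u) R(u-v)`, multiplied by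
`u - v`; here `a = u` and `b = v`. -/
def relTplus (t : Gen N → A) : Matrix (Fin N × Fin N) (Fin N × Fin N) (Bi A) :=
  let R : Matrix (Fin N × Fin N) (Fin N × Fin N) (Bi K) :=
    (va - vb) • 1 - C (C h) • permMat (Bi K)
  R.map (scal A) * site1 (Tplus t) * site2 (Tplus t) -
    site2 (Tplus t) * site1 (Tplus t) * R.map (scal A)

/-- The difference of the two sides of
`R̄(u-v+hc/2) T₁(u) T⁺₂(v) = T⁺₂(v) T₁(u) R̄(u-v-hc/2)`; here `a = u⁻¹` and `b = v`, and the
`R`-matrices are expanded in negative powers of `u`. -/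
def relMixed [NeZero N] (c : ℂ) (t : Gen N → A) :
    Matrix (Fin N × Fin N) (Fin N × Fin N) (Bi A) :=
  (Rbar (invLin 1 (-X + C ((c / 2) • h) : PowerSeries K))).map (scal A) * site1 (Tmat t) * site2 (Tplus t) -
    site2 (Tplus t) * site1 (Tmat t) * (Rbar (invLin 1 (-X - C ((c / 2) • h) : PowerSeries K))).map (scal A)

end DoubleYangian

section Quotient

variable (N : ℕ) [NeZero N] (c : ℂ)

/-- The free algebra on the generators of the double Yangian. -/
abbrev FreeYang : Type := FreeAlgebra K (Gen N)

/-- The two-sided ideal generated by all coefficients of the matrix entries of the `RTT`-relations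
at the level `c`. -/
def rttIdeal : TwoSidedIdeal (FreeYang N) :=
  TwoSidedIdeal.span {x | ∃ (M : Matrix (Fin N × Fin N) (Fin N × Fin N) (Bi (FreeYang N)))
    (a b : Fin N × Fin N) (m n : ℕ),
    (M = relT (FreeAlgebra.ι K) ∨ M = relTplus (FreeAlgebra.ι K) ∨
      M = relMixed c (FreeAlgebra.ι K)) ∧
    x = coeff n (coeff m (M a b))}

/-- The ideal of relations of the double Yangian. All coefficients of the `RTT`-relations are
divisible by `h ^ 2`, and the powers of `h` are cancelled: `x` is a relation as soon as some
`h ^ k x` belongs to the ideal generated by the `RTT`-relations. -/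
def relIdeal : Ideal (FreeYang N) where
  carrier := {x | ∃ k : ℕ, h ^ k • x ∈ rttIdeal N c}
  zero_mem' := ⟨0, by simp⟩
  add_mem' := by
    rintro x y ⟨k, hk⟩ ⟨l, hl⟩
    refine ⟨k + l, ?_⟩
    have h1 := (rttIdeal N c).mul_mem_left (algebraMap K _ (h ^ l)) _ hk
    have h2 := (rttIdeal N c).mul_mem_left (algebraMap K _ (h ^ k)) _ hl
    have := (rttIdeal N c).add_mem h1 h2
    rw [← Algebra.smul_def, ← Algebra.smul_def, smul_smul, smul_smul] at this
    rw [smul_add, pow_add]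
    rwa [mul_comm (h ^ l)] at this
  smul_mem' := by
    rintro a x ⟨k, hk⟩
    refine ⟨k, ?_⟩
    have := (rttIdeal N c).mul_mem_left a _ hk
    rwa [mul_smul_comm] at this

instance : (relIdeal N c).IsTwoSided where
  mul_mem_of_left := by
    rintro a b ⟨k, hk⟩
    refine ⟨k, ?_⟩
    have := (rttIdeal N c).mul_mem_right _ b hk
    rwa [smul_mul_assoc] at this

/-- The double Yangian `DY_c(gl_N)` at the level `c`. -/
def DY : Type := FreeYang N ⧸ relIdeal N c

instance : Ring (DY N c) := inferInstanceAs (Ring (FreeYang N ⧸ relIdeal N c))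

instance : Algebra K (DY N c) := inferInstanceAs (Algebra K (FreeYang N ⧸ relIdeal N c))

variable {N c}

/-- The quotient map from the free algebra. -/
def toDY : FreeYang N →ₐ[K] DY N c := Ideal.Quotient.mkₐ K (relIdeal N c)

/-- The generators `t_ij^{(±r)}` of `DY_c(gl_N)`. -/
def tGen (x : Gen N) : DY N c := toDY (FreeAlgebra.ι K x)

lemma toDY_surjective : Function.Surjective (toDY (N := N) (c := c)) :=
  Ideal.Quotient.mkₐ_surjective K _

lemma toDY_eq_zero (x : FreeYang N) : toDY (c := c) x = 0 ↔ x ∈ relIdeal N c :=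
  Ideal.Quotient.eq_zero_iff_mem

lemma h_smul_eq_zero {x : DY N c} (hx : h • x = 0) : x = 0 := by
  obtain ⟨x, rfl⟩ := toDY_surjective x
  rw [← map_smul, toDY_eq_zero] at hx
  rw [toDY_eq_zero]
  obtain ⟨k, hk⟩ := hx
  exact ⟨k + 1, by rwa [smul_smul, ← pow_succ] at hk⟩

end Quotient

set_option linter.unusedSectionVars false

section Topology

variable (N : ℕ) [NeZero N] (c : ℂ)

/-- The left ideal `I_p` of `DY_c(gl_N)` generated by all `t_ij^{(r)}` with `r ≥ p`. -/
def leftIdeal (p : ℕ) : Ideal (DY N c) :=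
  Ideal.span {x | ∃ (i j : Fin N) (r : ℕ), p ≤ r + 1 ∧ x = tGen (.pos i j r)}

/-- The left ideal `I_p + h ^ n DY_c(gl_N)`. -/
def nbhd (p n : ℕ) : Ideal (DY N c) :=
  leftIdeal N c p ⊔ Ideal.span {algebraMap K (DY N c) (h ^ n)}

variable {N c}

lemma leftIdeal_anti {p q : ℕ} (hpq : p ≤ q) : leftIdeal N c q ≤ leftIdeal N c p :=
  Ideal.span_mono fun _ ⟨i, j, r, hr, hx⟩ => ⟨i, j, r, hpq.trans hr, hx⟩

lemma gen_mem_leftIdeal {p r : ℕ} (hr : p ≤ r + 1) (i j : Fin N) :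
    tGen (.pos i j r) ∈ leftIdeal N c p :=
  Ideal.subset_span ⟨i, j, r, hr, rfl⟩

lemma leftIdeal_le_nbhd (p n : ℕ) : leftIdeal N c p ≤ nbhd N c p n := le_sup_left

lemma smul_mem_nbhd (p n : ℕ) (x : DY N c) {k : K} (hk : h ^ n ∣ k) : k • x ∈ nbhd N c p n := by
  obtain ⟨k, rfl⟩ := hk
  have : (algebraMap K (DY N c) (h ^ n)) ∈ nbhd N c p n :=
    (le_sup_right : _ ≤ nbhd N c p n) (Ideal.mem_span_singleton_self _)
  have := (nbhd N c p n).mul_mem_left (k • x) this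
  rwa [← Algebra.commutes, ← Algebra.smul_def, smul_smul] at this

lemma mem_nbhd {p n : ℕ} {x : DY N c} (hx : x ∈ nbhd N c p n) :
    ∃ y ∈ leftIdeal N c p, ∃ z : DY N c, x = y + h ^ n • z := by
  obtain ⟨y, hy, z, hz, rfl⟩ := Submodule.mem_sup.1 hx
  obtain ⟨w, rfl⟩ := Ideal.mem_span_singleton'.1 hz
  exact ⟨y, hy, w, by rw [← Algebra.commutes, ← Algebra.smul_def]⟩

lemma smul_mem_ideal (I : Ideal (DY N c)) (k : K) {x : DY N c} (hx : x ∈ I) : k • x ∈ I := by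
  rw [Algebra.smul_def]; exact I.mul_mem_left _ hx

lemma h_smul_mem_nbhd {p n : ℕ} {x : DY N c} (hx : x ∈ nbhd N c p n) :
    h • x ∈ nbhd N c p (n + 1) := by
  obtain ⟨y, hy, z, rfl⟩ := mem_nbhd hx
  rw [smul_add, smul_smul, ← pow_succ']
  exact add_mem (leftIdeal_le_nbhd _ _ (smul_mem_ideal _ _ hy)) (smul_mem_nbhd _ _ _ dvd_rfl)

lemma nbhd_anti {p q n m : ℕ} (hpq : p ≤ q) (hnm : n ≤ m) : nbhd N c q m ≤ nbhd N c p n := by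
  intro x hx
  obtain ⟨y, hy, z, rfl⟩ := mem_nbhd hx
  exact add_mem (leftIdeal_le_nbhd _ _ (leftIdeal_anti hpq hy))
    (smul_mem_nbhd _ _ _ (pow_dvd_pow _ hnm))

/-! The relations in the quotient. -/

section naturality

variable {A A' : Type*} [Ring A] [Algebra K A] [Ring A'] [Algebra K A'] (φ : A →ₐ[K] A')

/-- Change of coefficients in two variables. -/
def biMap : Bi A →+* Bi A' := PowerSeries.map (PowerSeries.map (φ : A →+* A'))

lemma coeff_biMap (m n : ℕ) (f : Bi A) : coeff n (coeff m (biMap φ f)) = φ (coeff n (coeff m f)) := by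
  simp [biMap]

lemma biMap_scal (f : Bi K) : biMap φ (scal A f) = scal A' f := by
  ext m n; simp [biMap, scal]

lemma map_site1 (M : Matrix (Fin N) (Fin N) (PowerSeries A)) :
    (site1 M).map (biMap φ) = site1 (M.map (PowerSeries.map (φ : A →+* A'))) := by
  ext a b m n
  simp only [site1, Matrix.map_apply, Matrix.kroneckerMap_apply, map_mul, Matrix.one_apply]
  congr 3
  · ext m n; simp [biMap, coeff_C]
  · split_ifs <;> simp

lemma map_site2 (M : Matrix (Fin N) (Fin N) (PowerSeries A)) :
    (site2 M).map (biMap φ) = site2 (M.map (PowerSeries.map (φ : A →+* A'))) := by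
  ext a b m n
  simp only [site2, Matrix.map_apply, Matrix.kroneckerMap_apply, map_mul, Matrix.one_apply]
  congr 3
  · split_ifs <;> simp
  · simp [biMap]

lemma map_Tmat (t : Gen N → A) :
    (Tmat t).map (PowerSeries.map (φ : A →+* A')) = Tmat (fun x => φ (t x)) := by
  ext i j m
  cases m <;> simp [Tmat]

lemma map_Tplus (t : Gen N → A) :
    (Tplus t).map (PowerSeries.map (φ : A →+* A')) = Tplus (fun x => φ (t x)) := by
  ext i j m
  simp [Tplus, apply_ite φ]

lemma map_scalMat (R : Matrix (Fin N × Fin N) (Fin N × Fin N) (Bi K)) :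
    (R.map (scal A)).map (biMap φ) = R.map (scal A') := by
  ext a b : 2
  simp [biMap_scal]

lemma map_relT (t : Gen N → A) : (relT t).map (biMap φ) = relT (fun x => φ (t x)) := by
  simp only [relT, Matrix.map_sub _ (map_sub (biMap φ)), Matrix.map_mul, map_site1, map_site2,
    map_scalMat, map_Tmat]

lemma map_relMixed (t : Gen N → A) :
    (relMixed c t).map (biMap φ) = relMixed c (fun x => φ (t x)) := by
  simp only [relMixed, Matrix.map_sub _ (map_sub (biMap φ)), Matrix.map_mul, map_site1, map_site2,
    map_scalMat, map_Tmat, map_Tplus]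

end naturality

lemma relT_eq_zero : relT (tGen (N := N) (c := c)) = 0 := by
  have := map_relT (toDY (N := N) (c := c)) (FreeAlgebra.ι K)
  rw [show (fun x => toDY (c := c) (FreeAlgebra.ι K x)) = tGen (N := N) (c := c) from rfl] at this
  rw [← this]
  ext a b m n
  rw [Matrix.map_apply, coeff_biMap, Matrix.zero_apply, map_zero, map_zero, toDY_eq_zero]
  refine ⟨0, ?_⟩
  rw [pow_zero, one_smul]
  exact TwoSidedIdeal.subset_span ⟨_, a, b, m, n, Or.inl rfl, rfl⟩

lemma relMixed_eq_zero : relMixed c (tGen (N := N) (c := c)) = 0 := by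
  have := map_relMixed (c := c) (toDY (N := N) (c := c)) (FreeAlgebra.ι K)
  rw [show (fun x => toDY (c := c) (FreeAlgebra.ι K x)) = tGen (N := N) (c := c) from rfl] at this
  rw [← this]
  ext a b m n
  rw [Matrix.map_apply, coeff_biMap, Matrix.zero_apply, map_zero, map_zero, toDY_eq_zero]
  refine ⟨0, ?_⟩
  rw [pow_zero, one_smul]
  exact TwoSidedIdeal.subset_span ⟨_, a, b, m, n, Or.inr (Or.inr rfl), rfl⟩

section sites

variable {A : Type*} [Ring A] [Algebra K A]

lemma site1_mul_site2 (M M' : Matrix (Fin N) (Fin N) (PowerSeries A)) (a b : Fin N × Fin N) (m n : ℕ) :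
    coeff n (coeff m ((site1 M * site2 M') a b)) =
      coeff m (M a.1 b.1) * coeff n (M' a.2 b.2) := by
  have : (site1 M * site2 M') a b = PowerSeries.map C (M a.1 b.1) * C (M' a.2 b.2) := by
    rw [Matrix.mul_apply, Fintype.sum_prod_type]
    simp [site1, site2, Matrix.one_apply]
  rw [this, coeff_mul_C, coeff_map, coeff_C_mul]

lemma site2_mul_site1 (M M' : Matrix (Fin N) (Fin N) (PowerSeries A)) (a b : Fin N × Fin N) (m n : ℕ) :
    coeff n (coeff m ((site2 M' * site1 M) a b)) =
      coeff n (M' a.2 b.2) * coeff m (M a.1 b.1) := by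
  have : (site2 M' * site1 M) a b = C (M' a.2 b.2) * PowerSeries.map C (M a.1 b.1) := by
    rw [Matrix.mul_apply, Fintype.sum_prod_type]
    simp [site1, site2, Matrix.one_apply]
  rw [this, coeff_C_mul, coeff_map, coeff_mul_C]

end sites

lemma h_smul_injective : Function.Injective (fun x : DY N c => h • x) := by
  intro x y hxy
  rw [← sub_eq_zero]
  apply h_smul_eq_zero
  rw [smul_sub, sub_eq_zero]
  exact hxy

lemma permMat_map_mul {A : Type*} [Ring A] [Algebra K A] (f g : Bi K)
    (Z : Matrix (Fin N × Fin N) (Fin N × Fin N) (Bi A)) (a b : Fin N × Fin N) :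
    ((f • 1 - g • permMat (Bi K) : Matrix (Fin N × Fin N) (Fin N × Fin N) (Bi K)).map (scal A) * Z) a b =
      scal A f * Z a b - scal A g * Z (a.2, a.1) b := by
  obtain ⟨i, k⟩ := a
  rw [Matrix.mul_apply]
  simp only [Matrix.map_apply, Matrix.sub_apply, Matrix.smul_apply, map_sub, sub_mul,
    Finset.sum_sub_distrib, smul_eq_mul, map_mul]
  congr 1
  · rw [Finset.sum_eq_single (i, k)]
    · simp
    · intro x _ hx; simp [Matrix.one_apply_ne hx.symm]
    · simp
  · rw [Finset.sum_eq_single (k, i)]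
    · simp [permMat]
    · rintro ⟨x, y⟩ _ hx
      have : ¬ (i = y ∧ k = x) := by rintro ⟨rfl, rfl⟩; exact hx rfl
      simp [permMat, this]
    · simp

lemma mul_permMat_map {A : Type*} [Ring A] [Algebra K A] (f g : Bi K)
    (Z : Matrix (Fin N × Fin N) (Fin N × Fin N) (Bi A)) (a b : Fin N × Fin N) :
    (Z * (f • 1 - g • permMat (Bi K) : Matrix (Fin N × Fin N) (Fin N × Fin N) (Bi K)).map (scal A)) a b =
      Z a b * scal A f - Z a (b.2, b.1) * scal A g := by
  obtain ⟨i, k⟩ := b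
  rw [Matrix.mul_apply]
  simp only [Matrix.map_apply, Matrix.sub_apply, Matrix.smul_apply, map_sub, mul_sub,
    Finset.sum_sub_distrib, smul_eq_mul, map_mul]
  congr 1
  · rw [Finset.sum_eq_single (i, k)]
    · simp
    · intro x _ hx; simp [Matrix.one_apply_ne hx]
    · simp
  · rw [Finset.sum_eq_single (k, i)]
    · simp [permMat]
    · rintro ⟨x, y⟩ _ hx
      have : ¬ (x = k ∧ y = i) := by rintro ⟨rfl, rfl⟩; exact hx rfl
      simp [permMat, this]
    · simp

lemma scal_comm {A : Type*} [Ring A] [Algebra K A] (f : Bi K) (x : Bi A) :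
    x * scal A f = scal A f * x := by
  ext m n
  simp only [coeff_mul, map_sum, scal, coeff_map]
  rw [← Finset.Nat.sum_antidiagonal_swap]
  refine Finset.sum_congr rfl fun p _ => ?_
  rw [← Finset.Nat.sum_antidiagonal_swap]
  refine Finset.sum_congr rfl fun q _ => ?_
  simp [Algebra.commutes]

lemma coeff_scal_va {A : Type*} [Ring A] [Algebra K A] (x : Bi A) (m n : ℕ) :
    coeff n (coeff (m + 1) (scal A va * x)) = coeff n (coeff m x) := by
  simp [scal, va, coeff_succ_X_mul]

lemma coeff_scal_vb {A : Type*} [Ring A] [Algebra K A] (x : Bi A) (m n : ℕ) :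
    coeff (n + 1) (coeff m (scal A vb * x)) = coeff n (coeff m x) := by
  simp [scal, vb, coeff_succ_X_mul]

lemma coeff_scal_vb_zero {A : Type*} [Ring A] [Algebra K A] (x : Bi A) (m : ℕ) :
    coeff 0 (coeff m (scal A vb * x)) = 0 := by
  simp [scal, vb]

lemma coeff_scal_h {A : Type*} [Ring A] [Algebra K A] (x : Bi A) (m n : ℕ) :
    coeff n (coeff m (scal A (C (C h)) * x)) = h • coeff n (coeff m x) := by
  simp [scal, Algebra.smul_def]

/-- The commutation relations of the Yangian, before the powers of `h` are cancelled. -/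
lemma T_comm (i j k l : Fin N) (m n : ℕ) :
    let T := Tmat (tGen (N := N) (c := c))
    coeff (m + 1) (T i j) * coeff n (T k l) - coeff m (T i j) * coeff (n + 1) (T k l)
      - h • (coeff m (T k j) * coeff n (T i l)) =
    coeff n (T k l) * coeff (m + 1) (T i j) - coeff (n + 1) (T k l) * coeff m (T i j)
      - h • (coeff n (T k j) * coeff m (T i l)) := by
  intro T
  have key : relT (tGen (N := N) (c := c)) (i, k) (j, l) = 0 := by rw [relT_eq_zero]; rfl
  unfold relT at key
  rw [Matrix.sub_apply, Matrix.mul_assoc, permMat_map_mul, mul_permMat_map,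
    scal_comm (vb - va), scal_comm (va * vb * _)] at key
  have := congrArg (fun f => coeff (n + 1) (coeff (m + 1) f)) key
  simp only [map_sub, map_mul, sub_mul, mul_assoc, coeff_scal_va, coeff_scal_vb,
    coeff_scal_h, site1_mul_site2, site2_mul_site1, map_zero] at this
  rw [← sub_eq_zero]
  exact this

lemma comm_one (i j k l : Fin N) (m : ℕ) :
    (tGen (.pos i j m) * tGen (.pos k l 0) - tGen (.pos k l 0) * tGen (.pos i j m) : DY N c) =
      (if k = j then tGen (.pos i l m) else 0) - (if i = l then tGen (.pos k j m) else 0) := by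
  have h1 := T_comm (c := c) i j k l (m + 1) 0
  apply h_smul_injective
  apply h_smul_injective
  simp only [Tmat, Matrix.of_apply, coeff_mk, zero_add] at h1
  simp only [mul_ite, ite_mul, mul_one, one_mul, mul_zero, zero_mul, smul_mul_assoc, mul_smul_comm] at h1
  simp only [smul_sub]
  rw [← sub_eq_zero, ← neg_eq_zero] at h1
  refine sub_eq_zero.1 (Eq.trans ?_ h1)
  split_ifs <;> (try simp only [smul_zero]) <;> abel

lemma comm_succ (i j k l : Fin N) (m n : ℕ) :
    (tGen (.pos i j m) * tGen (.pos k l (n + 1)) - tGen (.pos k l (n + 1)) * tGen (.pos i j m)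
      : DY N c) =
      tGen (.pos i j (m + 1)) * tGen (.pos k l n) - tGen (.pos k l n) * tGen (.pos i j (m + 1))
      - h • (tGen (.pos k j m) * tGen (.pos i l n)) + h • (tGen (.pos k j n) * tGen (.pos i l m))
      := by
  have h1 := T_comm (c := c) i j k l (m + 1) (n + 1)
  apply h_smul_injective
  apply h_smul_injective
  simp only [Tmat, Matrix.of_apply, coeff_mk, smul_mul_assoc, mul_smul_comm] at h1
  simp only [smul_sub, smul_add]
  rw [← sub_eq_zero, ← neg_eq_zero] at h1
  refine sub_eq_zero.1 (Eq.trans ?_ h1)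
  abel

lemma pos_mul_pos_mem (p : ℕ) (k l : Fin N) (n : ℕ) : ∀ (i j : Fin N) (m : ℕ), p ≤ m + 1 →
    (tGen (.pos i j m) * tGen (.pos k l n) : DY N c) ∈ leftIdeal N c p := by
  induction n generalizing k l with
  | zero =>
    intro i j m hm
    rw [← sub_add_cancel (tGen (.pos i j m) * tGen (.pos k l 0))
      (tGen (.pos k l 0) * tGen (.pos i j m)), comm_one]
    refine add_mem (sub_mem ?_ ?_) (Ideal.mul_mem_left _ _ (gen_mem_leftIdeal hm i j))
    · split_ifs
      exacts [gen_mem_leftIdeal hm _ _, zero_mem _]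
    · split_ifs
      exacts [gen_mem_leftIdeal hm _ _, zero_mem _]
  | succ n ih =>
    intro i j m hm
    rw [← sub_add_cancel (tGen (.pos i j m) * tGen (.pos k l (n + 1)))
      (tGen (.pos k l (n + 1)) * tGen (.pos i j m)), comm_succ]
    refine add_mem (add_mem (sub_mem (sub_mem ?_ ?_) ?_) ?_)
      (Ideal.mul_mem_left _ _ (gen_mem_leftIdeal hm i j))
    · exact ih _ _ _ _ _ (by omega)
    · exact Ideal.mul_mem_left _ _ (gen_mem_leftIdeal (by omega) _ _)
    · exact smul_mem_ideal _ _ (ih _ _ _ _ _ hm)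
    · exact smul_mem_ideal _ _ (Ideal.mul_mem_left _ _ (gen_mem_leftIdeal hm _ _))

/-! Divisibility by `h` of the coefficients of the `R`-matrix. -/

/-- Series in `a`, `b` whose coefficient of `a ^ m b ^ n` is divisible by `h ^ (m - n)`. -/
def homog : Subring (Bi K) where
  carrier := {f | ∀ m n, h ^ (m - n) ∣ coeff n (coeff m f)}
  zero_mem' := fun m n => by simp
  one_mem' := fun m n => by
    rcases m with _ | m
    · simp
    · simp [coeff_one]
  add_mem' := fun {f g} hf hg m n => by
    rw [map_add, map_add]; exact dvd_add (hf m n) (hg m n)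
  neg_mem' := fun {f} hf m n => by
    rw [map_neg, map_neg]; exact (dvd_neg).2 (hf m n)
  mul_mem' := fun {f g} hf hg m n => by
    rw [coeff_mul, map_sum]
    refine Finset.dvd_sum fun p hp => ?_
    rw [coeff_mul]
    refine Finset.dvd_sum fun q hq => ?_
    have hp := Finset.HasAntidiagonal.mem_antidiagonal.1 hp
    have hq := Finset.HasAntidiagonal.mem_antidiagonal.1 hq
    refine dvd_trans ?_ (mul_dvd_mul (hf p.1 q.1) (hg p.2 q.2))
    rw [← pow_add]
    exact pow_dvd_pow _ (by omega)

lemma C_dvd_of_coeff {B : Type*} [CommRing B] {d : B} {f : PowerSeries B}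
    (hf : ∀ m, d ∣ coeff m f) : C d ∣ f := by
  choose g hg using hf
  refine ⟨PowerSeries.mk g, ?_⟩
  ext m
  rw [coeff_C_mul, coeff_mk, hg]

lemma dvd_coeff_of_C {B : Type*} [CommRing B] {d : B} {f : PowerSeries B}
    (hf : C d ∣ f) (m : ℕ) : d ∣ coeff m f := by
  obtain ⟨g, rfl⟩ := hf
  rw [coeff_C_mul]
  exact dvd_mul_right _ _

/-- The scalar `h` in the ring of series in two variables. -/
abbrev hBi : Bi K := C (C h)

lemma linear_pow_dvd (s : K) (hs : h ∣ s) (m n : ℕ) :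
    h ^ (m - n) ∣ coeff n ((X - C s : PowerSeries K) ^ m) := by
  induction m generalizing n with
  | zero => simp
  | succ m ih =>
    rw [pow_succ', sub_mul, map_sub, coeff_C_mul]
    refine dvd_sub ?_ ?_
    · cases n with
      | zero => simp
      | succ n => rw [coeff_succ_X_mul, Nat.succ_sub_succ]; exact ih n
    · refine dvd_trans ?_ (mul_dvd_mul hs (ih n))
      rw [← pow_succ']
      exact pow_dvd_pow _ (by omega)

lemma coeff_invLin_one (s : PowerSeries K) (m : ℕ) :
    coeff (m + 1) (invLin 1 s) = (-s) ^ m := by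
  simp [invLin]

lemma coeff_zero_invLin_one (s : PowerSeries K) :
    coeff 0 (invLin 1 s) = 0 := by
  simp [invLin]

lemma invLin_mem_homog (s : K) (hs : h ∣ s) :
    hBi * invLin 1 (-X + C s : PowerSeries K) ∈ homog := by
  intro m n
  rw [coeff_C_mul, coeff_C_mul]
  cases m with
  | zero => simp
  | succ m =>
    rw [coeff_invLin_one, neg_add, neg_neg, ← sub_eq_add_neg]
    refine dvd_trans ?_ (mul_dvd_mul_left h (linear_pow_dvd s hs m n))
    rw [← pow_succ']
    exact pow_dvd_pow _ (by omega)

section evalInv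

variable (γ : ℕ → ℂ)

lemma evalInv_mem_homog {z : Bi K} (hz : z ∈ homog) :
    evalInv (fun r => algebraMap K (PowerSeries K) (algebraMap ℂ K (γ r))) z ∈ homog := by
  intro m n
  simp only [evalInv, coeff_mk, map_sum]
  refine Finset.dvd_sum fun r _ => ?_
  rw [smul_eq_mul, show algebraMap K (PowerSeries K) (algebraMap ℂ K (γ r)) = C (algebraMap ℂ K (γ r)) from rfl, coeff_mul_C]
  exact dvd_mul_of_dvd_left (pow_mem hz r m n) _

lemma evalInv_sub_one (h0 : γ 0 = 1) {z : Bi K} (hz : hBi ∣ z) :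
    hBi ∣ evalInv (fun r => algebraMap K (PowerSeries K) (algebraMap ℂ K (γ r))) z - 1 := by
  refine C_dvd_of_coeff fun m => ?_
  simp only [evalInv, map_sub, coeff_mk]
  rw [Finset.sum_range_succ']
  simp only [pow_zero, h0, map_one, smul_eq_mul, mul_one, add_sub_cancel_right]
  refine Finset.dvd_sum fun r _ => dvd_mul_of_dvd_left ?_ _
  exact dvd_coeff_of_C (dvd_pow hz (Nat.succ_ne_zero r)) m

lemma evalInv_sub {z w : Bi K} (hz : hBi ^ 2 ∣ z - w) :
    hBi ^ 2 ∣ evalInv (fun r => algebraMap K (PowerSeries K) (algebraMap ℂ K (γ r))) z -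
      evalInv (fun r => algebraMap K (PowerSeries K) (algebraMap ℂ K (γ r))) w := by
  rw [hBi, ← map_pow] at hz ⊢
  refine C_dvd_of_coeff fun m => ?_
  simp only [evalInv, map_sub, coeff_mk]
  rw [← Finset.sum_sub_distrib]
  refine Finset.dvd_sum fun r _ => ?_
  rw [smul_eq_mul, smul_eq_mul, ← sub_mul, ← map_sub]
  exact dvd_mul_of_dvd_left (dvd_coeff_of_C (hz.trans (sub_dvd_pow_sub_pow z w r)) m) _

end evalInv

lemma coeff_gSeries_zero : coeff 0 (gSeries N) = 1 := by
  rw [coeff_zero_eq_constantCoeff_apply]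
  exact (existsUnique_g N).choose_spec.1.1

lemma Rbar_apply (y : Bi K) (a b : Fin N × Fin N) :
    Rbar y a b =
      evalInv (fun r => algebraMap K (PowerSeries K) (algebraMap ℂ K (coeff r (gSeries N))))
        (hBi * y) *
      ((1 : Matrix (Fin N × Fin N) (Fin N × Fin N) (Bi K)) a b -
        (hBi * y) * permMat (Bi K) a b) := by
  simp only [Rbar, Matrix.smul_apply, Matrix.sub_apply, smul_eq_mul]
  rfl

lemma permMat_mem_homog (a b : Fin N × Fin N) : permMat (Bi K) a b ∈ homog := by
  simp only [permMat, Matrix.of_apply]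
  split_ifs
  exacts [one_mem _, zero_mem _]

lemma one_mem_homog (a b : Fin N × Fin N) :
    (1 : Matrix (Fin N × Fin N) (Fin N × Fin N) (Bi K)) a b ∈ homog := by
  rw [Matrix.one_apply]
  split_ifs
  exacts [one_mem _, zero_mem _]

lemma Rbar_mem_homog (s : K) (hs : h ∣ s) (a b : Fin N × Fin N) :
    Rbar (invLin 1 (-X + C s : PowerSeries K)) a b ∈ homog := by
  rw [Rbar_apply]
  have := invLin_mem_homog s hs
  exact mul_mem (evalInv_mem_homog _ this)
    (sub_mem (one_mem_homog a b) (mul_mem this (permMat_mem_homog a b)))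

lemma Rbar_sub_one_dvd (y : Bi K) (a b : Fin N × Fin N) :
    hBi ∣ Rbar y a b - (1 : Matrix (Fin N × Fin N) (Fin N × Fin N) (Bi K)) a b := by
  rw [Rbar_apply]
  obtain ⟨e, he⟩ := evalInv_sub_one (fun r => coeff r (gSeries N)) coeff_gSeries_zero
    (dvd_mul_right hBi y)
  rw [sub_eq_iff_eq_add] at he
  rw [he]
  refine ⟨e * (1 : Matrix (Fin N × Fin N) (Fin N × Fin N) (Bi K)) a b
    - (hBi * e + 1) * y * permMat (Bi K) a b, ?_⟩
  ring

lemma Rbar_sub_dvd (s : K) (hs : h ∣ s) (a b : Fin N × Fin N) :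
    hBi ^ 2 ∣ Rbar (invLin 1 (-X + C (-s) : PowerSeries K)) a b -
      Rbar (invLin 1 (-X + C s : PowerSeries K)) a b := by
  have hy : hBi ∣ invLin 1 (-X + C (-s) : PowerSeries K) - invLin 1 (-X + C s : PowerSeries K) := by
    refine C_dvd_of_coeff fun m => ?_
    rw [map_sub]
    cases m with
    | zero => simp [coeff_zero_invLin_one]
    | succ m =>
      rw [coeff_invLin_one, coeff_invLin_one]
      refine dvd_trans ?_ (sub_dvd_pow_sub_pow _ _ m)
      obtain ⟨w, rfl⟩ := hs
      refine ⟨C (2 * w), ?_⟩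
      simp only [map_neg, map_mul, map_ofNat]
      ring
  set y := invLin 1 (-X + C (-s) : PowerSeries K)
  set y' := invLin 1 (-X + C s : PowerSeries K)
  have hz : hBi ^ 2 ∣ hBi * y - hBi * y' := by
    rw [← mul_sub, pow_two]; exact mul_dvd_mul_left _ hy
  have he := evalInv_sub (fun r => coeff r (gSeries N)) hz
  rw [Rbar_apply, Rbar_apply]
  set e := evalInv (fun r => algebraMap K (PowerSeries K) (algebraMap ℂ K (coeff r (gSeries N)))) (hBi * y)
  set e' := evalInv (fun r => algebraMap K (PowerSeries K) (algebraMap ℂ K (coeff r (gSeries N)))) (hBi * y')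
  set o := (1 : Matrix (Fin N × Fin N) (Fin N × Fin N) (Bi K)) a b
  set q := (permMat (Bi K) : Matrix (Fin N × Fin N) (Fin N × Fin N) (Bi K)) a b
  have : e * (o - hBi * y * q) - e' * (o - hBi * y' * q) =
      (e - e') * (o - hBi * y * q) - (hBi * y - hBi * y') * (e' * q) := by ring
  rw [this]
  exact dvd_sub (dvd_mul_of_dvd_left he _) (dvd_mul_of_dvd_left hz _)

/-- Scalar series whose coefficients of `a ^ m b ^ n` tend to `0` `h`-adically as `m → ∞`. -/
def IsSmall (f : Bi K) : Prop :=
  ∀ k n, ∃ q, ∀ m ≥ q, ∀ n' ≤ n, h ^ k ∣ coeff n' (coeff m f)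

lemma isSmall_of_homog {f : Bi K} (j : ℕ) (hf : hBi ^ j * f ∈ homog) : IsSmall f := by
  intro k n
  refine ⟨k + n + j, fun m hm n' hn' => ?_⟩
  have h1 := hf m n'
  rw [hBi, ← map_pow, ← map_pow, coeff_C_mul, coeff_C_mul] at h1
  have h2 : h ^ j * h ^ k ∣ h ^ j * coeff n' (coeff m f) :=
    dvd_trans (by rw [← pow_add]; exact pow_dvd_pow _ (by omega)) h1
  exact (mul_dvd_mul_iff_left (pow_ne_zero _ h_ne_zero)).1 h2

/-- Series in `a`, `b` whose coefficients of `a ^ m b ^ n` belong to `B` for large `m`. -/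
def eventuallyIn (B : Ideal (DY N c)) : AddSubgroup (Bi (DY N c)) where
  carrier := {f | ∀ n, ∃ q, ∀ m ≥ q, ∀ n' ≤ n, coeff n' (coeff m f) ∈ B}
  zero_mem' := fun n => ⟨0, fun m _ n' _ => by simp⟩
  add_mem' := fun {f g} hf hg n => by
    obtain ⟨q, hq⟩ := hf n
    obtain ⟨r, hr⟩ := hg n
    refine ⟨max q r, fun m hm n' hn' => ?_⟩
    rw [map_add, map_add]
    exact add_mem (hq m (le_of_max_le_left hm) n' hn') (hr m (le_of_max_le_right hm) n' hn')
  neg_mem' := fun {f} hf n => by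
    obtain ⟨q, hq⟩ := hf n
    refine ⟨q, fun m hm n' hn' => ?_⟩
    rw [map_neg, map_neg]
    exact neg_mem (hq m hm n' hn')

lemma coeff_scal_mul (f : Bi K) (x : Bi (DY N c)) (m n : ℕ) :
    coeff n (coeff m (scal _ f * x)) = ∑ p ∈ Finset.HasAntidiagonal.antidiagonal m, ∑ q ∈ Finset.HasAntidiagonal.antidiagonal n,
      coeff q.1 (coeff p.1 f) • coeff q.2 (coeff p.2 x) := by
  simp only [coeff_mul, map_sum, scal, coeff_map, Algebra.smul_def]

lemma small_mul_mem {p k : ℕ} {f : Bi K} (hf : IsSmall f) {x : Bi (DY N c)}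
    (hx : x ∈ eventuallyIn (nbhd N c p k)) : scal _ f * x ∈ eventuallyIn (nbhd N c p k) := by
  intro n
  obtain ⟨q, hq⟩ := hf k n
  obtain ⟨r, hr⟩ := hx n
  refine ⟨q + r, fun m hm n' hn' => ?_⟩
  rw [coeff_scal_mul]
  refine sum_mem fun s hs => sum_mem fun t ht => ?_
  have hs := Finset.HasAntidiagonal.mem_antidiagonal.1 hs
  have ht := Finset.HasAntidiagonal.mem_antidiagonal.1 ht
  rcases le_or_gt q s.1 with h1 | h1
  · exact smul_mem_nbhd _ _ _ (hq _ h1 _ (by omega))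
  · exact smul_mem_ideal _ _ (hr _ (by omega) _ (by omega))

lemma small_mul_const_mem {p k : ℕ} {f : Bi K} (hf : IsSmall f) (g : PowerSeries (DY N c)) :
    scal _ f * C g ∈ eventuallyIn (nbhd N c p k) := by
  intro n
  obtain ⟨q, hq⟩ := hf k n
  refine ⟨q, fun m hm n' hn' => ?_⟩
  rw [coeff_scal_mul]
  refine sum_mem fun s hs => sum_mem fun t ht => ?_
  have hs := Finset.HasAntidiagonal.mem_antidiagonal.1 hs
  have ht := Finset.HasAntidiagonal.mem_antidiagonal.1 ht
  by_cases h0 : s.2 = 0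
  · exact smul_mem_nbhd _ _ _ (hq _ (by omega) _ (by omega))
  · rw [coeff_C, if_neg h0, map_zero, smul_zero]; exact zero_mem _

lemma const_mul_mem {B : Ideal (DY N c)} (g : PowerSeries (DY N c)) {x : Bi (DY N c)}
    (hx : x ∈ eventuallyIn B) : C g * x ∈ eventuallyIn B := by
  intro n
  obtain ⟨r, hr⟩ := hx n
  refine ⟨r, fun m hm n' hn' => ?_⟩
  rw [coeff_C_mul, coeff_mul]
  refine sum_mem fun t ht => ?_
  have ht := Finset.HasAntidiagonal.mem_antidiagonal.1 ht
  exact B.mul_mem_left _ (hr m hm _ (by omega))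

lemma hBi_mul_mem {p k : ℕ} {x : Bi (DY N c)} (hx : x ∈ eventuallyIn (nbhd N c p k)) :
    scal _ hBi * x ∈ eventuallyIn (nbhd N c p (k + 1)) := by
  intro n
  obtain ⟨r, hr⟩ := hx n
  refine ⟨r, fun m hm n' hn' => ?_⟩
  rw [coeff_scal_h]
  exact h_smul_mem_nbhd (hr m hm n' hn')

lemma hBi_mul_eq_zero {x : Bi (DY N c)} (hx : scal _ hBi * x = 0) : x = 0 := by
  ext m n
  have := congrArg (fun f => coeff n (coeff m f)) hx
  simp only [coeff_scal_h, map_zero] at this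
  exact h_smul_eq_zero this

section mixed

variable (N c)

/-- `∑_{r ≥ 1} t^{(r)} u^{-r}`. -/
def tauMat : Matrix (Fin N) (Fin N) (PowerSeries (DY N c)) :=
  Matrix.of fun i j => PowerSeries.mk fun r => match r with
    | 0 => 0
    | r + 1 => tGen (.pos i j r)

/-- `∑_{r ≥ 1} t^{(-r)} u^{r-1}`. -/
def tauPlus : Matrix (Fin N) (Fin N) (PowerSeries (DY N c)) :=
  Matrix.of fun i j => PowerSeries.mk fun r => tGen (.neg i j r)

/-- Multiplication by `h` of matrices. -/
abbrev hM : Matrix (Fin N × Fin N) (Fin N × Fin N) (Bi (DY N c)) :=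
  Matrix.scalar _ (scal (DY N c) hBi)

lemma hM_mul (M : Matrix (Fin N × Fin N) (Fin N × Fin N) (Bi (DY N c))) (a b : Fin N × Fin N) :
    (hM N c * M) a b = scal _ hBi * M a b := by
  simp [hM, Matrix.scalar_apply, Matrix.diagonal_mul]

lemma mul_hM (M : Matrix (Fin N × Fin N) (Fin N × Fin N) (Bi (DY N c))) :
    M * hM N c = hM N c * M := by
  ext a b : 1
  rw [hM_mul, ← scal_comm]
  simp [hM, Matrix.scalar_apply, Matrix.mul_diagonal]

lemma hM_mul_eq_zero {M : Matrix (Fin N × Fin N) (Fin N × Fin N) (Bi (DY N c))}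
    (h0 : hM N c * M = 0) : M = 0 := by
  ext a b : 1
  have := congrFun (congrFun h0 a) b
  rw [hM_mul] at this
  exact hBi_mul_eq_zero this

lemma site1_Tmat : site1 (Tmat (tGen (N := N) (c := c))) = 1 + hM N c * site1 (tauMat N c) := by
  ext a b m n
  rw [Matrix.add_apply, hM_mul, map_add, map_add, coeff_scal_h]
  obtain ⟨i, k⟩ := a
  obtain ⟨j, l⟩ := b
  simp only [site1, Tmat, tauMat, Matrix.kroneckerMap_apply, Matrix.map_apply, Matrix.of_apply,
    Matrix.one_apply, Prod.mk.injEq]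
  by_cases hkl : k = l
  · cases m with
    | zero => by_cases hij : i = j <;> simp [hkl, hij]
    | succ m => by_cases hij : i = j <;> simp [hkl, hij, coeff_one, coeff_C]
  · simp [hkl]

lemma site2_Tplus : site2 (Tplus (tGen (N := N) (c := c))) = 1 - hM N c * site2 (tauPlus N c) := by
  ext a b m n
  rw [Matrix.sub_apply, hM_mul, map_sub, map_sub, coeff_scal_h]
  obtain ⟨i, k⟩ := a
  obtain ⟨j, l⟩ := b
  simp only [site2, Tplus, tauPlus, Matrix.kroneckerMap_apply, Matrix.map_apply, Matrix.of_apply,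
    Matrix.one_apply, Prod.mk.injEq]
  by_cases hij : i = j
  · cases m with
    | zero => by_cases hkl : k = l <;> simp [hkl, hij, coeff_one]
    | succ m => by_cases hkl : k = l <;> simp [hkl, hij, coeff_one]
  · simp [hij]

lemma mixed_mem (p k : ℕ) (a b : Fin N × Fin N) :
    (site1 (tauMat N c) * site2 (tauPlus N c) - site2 (tauPlus N c) * site1 (tauMat N c)) a b ∈
      eventuallyIn (nbhd N c p k) := by
  set s : K := (c / 2) • h with hs_def
  have hs : h ∣ s := by rw [hs_def, Algebra.smul_def]; exact dvd_mul_left _ _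
  have hs' : h ∣ -s := (dvd_neg).2 hs
  have rel := relMixed_eq_zero (N := N) (c := c)
  unfold relMixed at rel
  rw [sub_eq_add_neg (-X) (C ((c / 2) • h)), ← map_neg C, ← hs_def] at rel
  set Rp : Matrix (Fin N × Fin N) (Fin N × Fin N) (Bi K) :=
    Rbar (invLin 1 (-X + C s : PowerSeries K)) with hRp
  set Rm : Matrix (Fin N × Fin N) (Fin N × Fin N) (Bi K) :=
    Rbar (invLin 1 (-X + C (-s) : PowerSeries K)) with hRm
  choose ρ hρ using fun x y => Rbar_sub_one_dvd (N := N) (invLin 1 (-X + C s : PowerSeries K)) x y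
  choose ρ' hρ' using
    fun x y => Rbar_sub_one_dvd (N := N) (invLin 1 (-X + C (-s) : PowerSeries K)) x y
  choose κ hκ using fun x y => Rbar_sub_dvd (N := N) s hs x y
  have sρ : ∀ x y, IsSmall (ρ x y) := fun x y => isSmall_of_homog 1 (by
    rw [pow_one, ← hρ]; exact sub_mem (Rbar_mem_homog s hs x y) (one_mem_homog x y))
  have sρ' : ∀ x y, IsSmall (ρ' x y) := fun x y => isSmall_of_homog 1 (by
    rw [pow_one, ← hρ']; exact sub_mem (Rbar_mem_homog (-s) hs' x y) (one_mem_homog x y))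
  have sκ : ∀ x y, IsSmall (κ x y) := fun x y => isSmall_of_homog 2 (by
    rw [← hκ]; exact sub_mem (Rbar_mem_homog (-s) hs' x y) (Rbar_mem_homog s hs x y))
  set r : Matrix (Fin N × Fin N) (Fin N × Fin N) (Bi (DY N c)) :=
    (Matrix.of ρ).map (scal _) with hr
  set r' : Matrix (Fin N × Fin N) (Fin N × Fin N) (Bi (DY N c)) :=
    (Matrix.of ρ').map (scal _) with hr'
  set q : Matrix (Fin N × Fin N) (Fin N × Fin N) (Bi (DY N c)) :=
    (Matrix.of κ).map (scal _) with hq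
  set A := site1 (tauMat N c) with hA
  set B := site2 (tauPlus N c) with hB
  set H := hM N c with hH
  have one_map : (1 : Matrix (Fin N × Fin N) (Fin N × Fin N) (Bi K)).map (scal (DY N c)) = 1 :=
    Matrix.map_one _ (map_zero _) (map_one _)
  have e1 : Rp.map (scal (DY N c)) = 1 + H * r := by
    rw [← one_map]
    ext x y : 1
    rw [Matrix.add_apply, hH, hM_mul, hr, Matrix.map_apply, Matrix.map_apply, Matrix.map_apply,
      Matrix.of_apply, ← map_mul, ← hρ, ← map_add, hRp]
    congr 1; ring
  have e2 : Rm.map (scal (DY N c)) = 1 + H * r' := by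
    rw [← one_map]
    ext x y : 1
    rw [Matrix.add_apply, hH, hM_mul, hr', Matrix.map_apply, Matrix.map_apply, Matrix.map_apply,
      Matrix.of_apply, ← map_mul, ← hρ', ← map_add, hRm]
    congr 1; ring
  have e3 : H * (r' - r) = H * (H * q) := by
    have : Rm.map (scal (DY N c)) - Rp.map (scal (DY N c)) = H * (H * q) := by
      ext x y : 1
      rw [Matrix.sub_apply, hH, hM_mul, hM_mul, hq, Matrix.map_apply, Matrix.map_apply,
        Matrix.map_apply, Matrix.of_apply, ← map_mul, ← map_mul, ← mul_assoc, ← pow_two, ← hκ,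
        ← map_sub]
    rw [← this, e1, e2]; noncomm_ring
  have cH : ∀ M, M * H = H * M := mul_hM N c
  rw [e1, e2, site1_Tmat, site2_Tplus] at rel
  set Q := A * B - B * A with hQ
  set V := A - B - H * (B * A) with hV
  have e4 : H * (H * (Q + H * (r * Q) + q - r * V + V * r')) = 0 := by
    rw [← neg_eq_zero, ← rel]
    have w : (1 - H * B) * (1 + H * A) = 1 + H * V := by
      rw [hV]
      have : H * B * (H * A) = H * (H * (B * A)) := by
        rw [mul_assoc, ← mul_assoc B, cH B, mul_assoc]
      simp only [sub_mul, mul_add, mul_sub, one_mul, mul_one, this]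
      abel
    have w' : (1 + H * A) * (1 - H * B) = 1 + H * V - H * (H * Q) := by
      rw [hV, hQ]
      have : H * A * (H * B) = H * (H * (A * B)) := by
        rw [mul_assoc, ← mul_assoc A, cH A, mul_assoc]
      simp only [add_mul, mul_sub, one_mul, mul_one, this]
      abel
    rw [mul_assoc, w, w']
    have x1 : H * r * (H * V) = H * (H * (r * V)) := by
      rw [mul_assoc, ← mul_assoc r, cH r, mul_assoc]
    have x2 : H * V * (H * r') = H * (H * (V * r')) := by
      rw [mul_assoc, ← mul_assoc V, cH V, mul_assoc]
    have x3 : H * r * (H * (H * Q)) = H * (H * (H * (r * Q))) := by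
      rw [mul_assoc, ← mul_assoc r, cH r, mul_assoc, ← mul_assoc r, cH r, mul_assoc]
    have e3' : H * r' = H * r + H * (H * q) := by
      rw [← e3]; noncomm_ring
    simp only [add_mul, mul_add, mul_sub, one_mul, mul_one, x1, x2, x3]
    rw [e3']
    abel
  have e5 : Q = (r * V - V * r' - q) - H * (r * Q) := by
    have := hM_mul_eq_zero N c (hM_mul_eq_zero N c e4)
    rw [← sub_eq_zero, ← this]
    abel
  have A_mem : ∀ k x y, A x y ∈ eventuallyIn (nbhd N c p k) := by
    intro k x y n
    refine ⟨p + 1, fun m hm n' _ => ?_⟩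
    obtain ⟨m, rfl⟩ : ∃ m', m = m' + 1 := ⟨m - 1, by omega⟩
    rw [hA, site1, Matrix.kroneckerMap_apply, Matrix.one_apply, Matrix.map_apply, mul_ite, mul_one,
      mul_zero]
    split_ifs
    · rw [coeff_map, tauMat, Matrix.of_apply, coeff_mk, coeff_C]
      split_ifs
      · exact leftIdeal_le_nbhd _ _ (gen_mem_leftIdeal (by omega) _ _)
      · exact zero_mem _
    · rw [map_zero, map_zero]; exact zero_mem _
  have B_const : ∀ x y, ∃ g, B x y = C g := by
    intro x y
    rw [hB, site2, Matrix.kroneckerMap_apply, Matrix.one_apply, Matrix.map_apply, ite_mul, one_mul,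
      zero_mul]
    split_ifs
    · exact ⟨_, rfl⟩
    · exact ⟨0, (map_zero _).symm⟩
  have BA_mem : ∀ k x y, (B * A) x y ∈ eventuallyIn (nbhd N c p k) := by
    intro k x y
    rw [Matrix.mul_apply]
    refine sum_mem fun z _ => ?_
    obtain ⟨g, hg⟩ := B_const x z
    rw [hg]
    exact const_mul_mem g (A_mem k z y)
  have small_V : ∀ k (f : Bi K), IsSmall f → ∀ x y,
      scal _ f * V x y ∈ eventuallyIn (nbhd N c p k) := by
    intro k f hf x y
    rw [hV, Matrix.sub_apply, Matrix.sub_apply, mul_sub, mul_sub]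
    refine sub_mem (sub_mem (small_mul_mem hf (A_mem k x y)) ?_) (small_mul_mem hf ?_)
    · obtain ⟨g, hg⟩ := B_const x y
      rw [hg]
      exact small_mul_const_mem hf g
    · rw [hH, hM_mul]
      cases k with
      | zero =>
        exact fun n => ⟨0, fun m _ n' _ => by
          rw [← one_smul K (coeff n' _)]; exact smul_mem_nbhd _ _ _ (by simp)⟩
      | succ k => exact hBi_mul_mem (BA_mem k x y)
  have W_mem : ∀ k x y, (r * V - V * r' - q) x y ∈ eventuallyIn (nbhd N c p k) := by
    intro k x y
    rw [Matrix.sub_apply, Matrix.sub_apply, Matrix.mul_apply, Matrix.mul_apply]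
    refine sub_mem (sub_mem (sum_mem fun z _ => small_V k _ (sρ _ _) _ _)
      (sum_mem fun z _ => ?_)) ?_
    · rw [hr', Matrix.map_apply, scal_comm]
      exact small_V k _ (sρ' _ _) _ _
    · have := small_mul_const_mem (p := p) (k := k) (sκ x y) (1 : PowerSeries (DY N c))
      rwa [map_one, mul_one] at this
  induction k generalizing a b with
  | zero =>
    exact fun n => ⟨0, fun m _ n' _ => by
      rw [← one_smul K (coeff n' _)]; exact smul_mem_nbhd _ _ _ (by simp)⟩
  | succ k ih =>
    rw [e5, Matrix.sub_apply, hH, hM_mul]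
    refine sub_mem (W_mem _ _ _) (hBi_mul_mem ?_)
    rw [Matrix.mul_apply]
    exact sum_mem fun z _ => small_mul_mem (sρ _ _) (ih z b)

end mixed

lemma pos_mul_neg_mem (p n : ℕ) (k l : Fin N) (r : ℕ) : ∃ q, ∀ (i j : Fin N) (s : ℕ), q ≤ s →
    (tGen (.pos i j s) * tGen (.neg k l r) : DY N c) ∈ nbhd N c p n := by
  choose q hq using fun (x : Fin N × Fin N) => mixed_mem N c p n (x.1, k) (x.2, l) r
  refine ⟨p + ∑ x, q x, fun i j s hs => ?_⟩
  have h1 : q (i, j) ≤ ∑ x, q x :=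
    Finset.single_le_sum (f := q) (fun _ _ => Nat.zero_le _) (Finset.mem_univ (i, j))
  have h2 := hq (i, j) (s + 1) (by omega) r le_rfl
  rw [Matrix.sub_apply, map_sub, map_sub, site1_mul_site2, site2_mul_site1] at h2
  simp only [tauMat, tauPlus, Matrix.of_apply, coeff_mk] at h2
  have h3 : (tGen (.neg k l r) * tGen (.pos i j s) : DY N c) ∈ nbhd N c p n :=
    leftIdeal_le_nbhd _ _ (Ideal.mul_mem_left _ _ (gen_mem_leftIdeal (by omega) i j))
  simpa using add_mem h2 h3

lemma span_mul_mem {q : ℕ} {x : DY N c} {B : Ideal (DY N c)}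
    (hx : ∀ (i j : Fin N) (s : ℕ), q ≤ s + 1 → tGen (.pos i j s) * x ∈ B) :
    ∀ y ∈ leftIdeal N c q, y * x ∈ B := by
  intro y hy
  induction hy using Submodule.span_induction with
  | mem y hy =>
    obtain ⟨i, j, s, hs, rfl⟩ := hy
    exact hx i j s hs
  | zero => rw [zero_mul]; exact zero_mem _
  | add y z _ _ hy hz => rw [add_mul]; exact add_mem hy hz
  | smul a y _ hy => rw [smul_eq_mul, mul_assoc]; exact B.mul_mem_left a hy

lemma exists_leftIdeal_mul (x : DY N c) : ∀ p n : ℕ, ∃ q, ∀ y ∈ leftIdeal N c q,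
    y * x ∈ nbhd N c p n := by
  obtain ⟨x, rfl⟩ := toDY_surjective x
  induction x using FreeAlgebra.induction with
  | grade0 k =>
    intro p n
    refine ⟨p, fun y hy => ?_⟩
    rw [AlgHom.commutes, ← Algebra.commutes, ← Algebra.smul_def]
    exact smul_mem_ideal _ _ (leftIdeal_le_nbhd _ _ hy)
  | grade1 x =>
    intro p n
    cases x with
    | pos k l r =>
      exact ⟨p, span_mul_mem fun i j s hs =>
        leftIdeal_le_nbhd _ _ (pos_mul_pos_mem p k l r i j s hs)⟩
    | neg k l r =>
      obtain ⟨q, hq⟩ := pos_mul_neg_mem (c := c) p n k l r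
      exact ⟨q + 1, span_mul_mem fun i j s hs => hq i j s (by omega)⟩
  | mul x y hx hy =>
    intro p n
    obtain ⟨q, hq⟩ := hy p n
    obtain ⟨q', hq'⟩ := hx q n
    refine ⟨q', fun z hz => ?_⟩
    obtain ⟨w, hw, v, hv⟩ := mem_nbhd (hq' z hz)
    rw [map_mul, ← mul_assoc, hv, add_mul, smul_mul_assoc]
    exact add_mem (hq w hw) (smul_mem_nbhd _ _ _ dvd_rfl)
  | add x y hx hy =>
    intro p n
    obtain ⟨q, hq⟩ := hx p n
    obtain ⟨q', hq'⟩ := hy p n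
    refine ⟨max q q', fun z hz => ?_⟩
    rw [map_add, mul_add]
    exact add_mem (hq z (leftIdeal_anti (le_max_left _ _) hz))
      (hq' z (leftIdeal_anti (le_max_right _ _) hz))

variable (N c)

/-- The left ideals `I_p + h ^ n DY_c(gl_N)` are a basis of neighbourhoods of zero of a ring
topology on the double Yangian. -/
theorem nbhd_basis :
    RingSubgroupsBasis fun i : ℕ × ℕ => (nbhd N c i.1 i.2).toAddSubgroup where
  inter := fun i j => ⟨(max i.1 j.1, max i.2 j.2), le_inf
    (fun _ hx => nbhd_anti (le_max_left _ _) (le_max_left _ _) hx)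
    (fun _ hx => nbhd_anti (le_max_right _ _) (le_max_right _ _) hx)⟩
  mul := fun i => ⟨i, by
    rintro _ ⟨x, _, y, hy, rfl⟩
    exact Ideal.mul_mem_left _ x hy⟩
  leftMul := fun x i => ⟨i, fun _ hy => Ideal.mul_mem_left _ x hy⟩
  rightMul := fun x i => by
    obtain ⟨q, hq⟩ := exists_leftIdeal_mul x i.1 i.2
    refine ⟨(q, i.2), fun y hy => ?_⟩
    obtain ⟨w, hw, v, rfl⟩ := mem_nbhd hy
    change (w + h ^ i.2 • v) * x ∈ nbhd N c i.1 i.2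
    rw [add_mul, smul_mul_assoc]
    exact add_mem (hq w hw) (smul_mem_nbhd _ _ _ dvd_rfl)

/-- The topology of `DY_c(gl_N)` with the basis `I_p + h ^ n DY_c(gl_N)` of neighbourhoods of
zero. -/
instance : TopologicalSpace (DY N c) := (nbhd_basis N c).topology

instance : IsTopologicalRing (DY N c) :=
  (nbhd_basis N c).toRingFilterBasis.isTopologicalRing

instance : UniformSpace (DY N c) := IsTopologicalAddGroup.rightUniformSpace (DY N c)

instance : IsUniformAddGroup (DY N c) := isUniformAddGroup_of_addCommGroup

instance : UniformContinuousConstSMul K (DY N c) where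
  uniformContinuous_const_smul k := by
    have : (fun x : DY N c => k • x) = AddMonoidHom.mulLeft (algebraMap K (DY N c) k) := by
      ext x; rw [Algebra.smul_def]; rfl
    rw [this]
    refine uniformContinuous_addMonoidHom_of_continuous ?_
    change Continuous fun x : DY N c => algebraMap K (DY N c) k * x
    fun_prop

/-- The completed double Yangian: the completion of `DY_c(gl_N)` with respect to the left ideals
`I_p + h ^ n DY_c(gl_N)`, i.e. the inverse limit of the quotients by these left ideals. As the
quotients `DY_c(gl_N) / I_p` have no `h`-torsion, this is the `h`-adic completion of the inverse
limit of the quotients `DY_c(gl_N) / I_p`. -/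
abbrev DYc : Type := UniformSpace.Completion (DY N c)

end Topology

section Twisted

variable {N : ℕ} [NeZero N]

/-- A complex matrix, regarded as a matrix of constant series. -/
def constMat (A : Type*) [Ring A] [Algebra K A] (G : Matrix (Fin N) (Fin N) ℂ) :
    Matrix (Fin N) (Fin N) (PowerSeries A) :=
  G.map fun z => C (algebraMap K A (algebraMap ℂ K z))

/-- For a matrix `M(u)` of power series in `u⁻¹` and an expansion `y` of `(α u + s)⁻¹`, the
expansion of `M(α u + s)` in negative powers of `u`. -/
def substInv {A : Type*} [Ring A] [Algebra K A] (M : Matrix (Fin N) (Fin N) (PowerSeries A))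
    (y : PowerSeries K) : Matrix (Fin N) (Fin N) (PowerSeries A) :=
  M.map fun f => evalInv (fun r => coeff r f) y

variable (c : ℂ) (G : Matrix (Fin N) (Fin N) ℂ)

/-- `S⁺(u) = T⁺(u) G T⁺(-u)ᵗ`, a matrix of power series in `u`. -/
def Splus : Matrix (Fin N) (Fin N) (PowerSeries (DY N c)) :=
  Tplus tGen * constMat _ G *
    ((Tplus tGen).map fun f => PowerSeries.mk fun m => (-1) ^ m * coeff m f).transpose

/-- `S(u) = T(u + hc) G T(-u)ᵗ`, a matrix of power series in `u⁻¹`. -/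
def Sminus : Matrix (Fin N) (Fin N) (PowerSeries (DY N c)) :=
  substInv (Tmat tGen) (invLin 1 (c • h)) * constMat _ G *
    (substInv (Tmat tGen) (invLin (-1) 0)).transpose

/-- The subalgebra `A_c(g_N)` of `DY_c(gl_N)` generated by the elements `s_ij^{(±r)}`, `r ≥ 1`, with
`s⁺_ij(u) = g_ij - h ∑ s_ij^{(-r)} u^{r-1}` and `s_ij(u) = g_ij + h ∑ s_ij^{(r)} u^{-r}`; these are
unique because `DY_c(gl_N)` has no `h`-torsion. -/
def Ac : Subalgebra K (DY N c) :=
  Algebra.adjoin K {x | ∃ (i j : Fin N) (r : ℕ),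
    coeff r (Splus c G i j) =
      algebraMap K _ (algebraMap ℂ K (if r = 0 then G i j else 0)) - h • x ∨
    coeff (r + 1) (Sminus c G i j) = h • x}

/-- The canonical map from `DY_c(gl_N)` to its completion. -/
def toDYc : DY N c →ₐ[K] DYc N c where
  toRingHom := UniformSpace.Completion.coeRingHom
  commutes' _ := rfl

/-- The completed algebra `Ã_c(g_N)`: the completion of `A_c(g_N)` with respect to the left ideals
`A_c(g_N) ∩ (I_p + h ^ n DY_c(gl_N))`, realized as the closure of `A_c(g_N)` in the completed double
Yangian. By the Poincaré–Birkhoff–Witt theorem these left ideals define the same topology on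
`A_c(g_N)` as the left ideals `(A_c(g_N) ∩ I_p) + h ^ n A_c(g_N)`, so that this is the `h`-adic
completion of the inverse limit of the quotients `A_c(g_N) / (A_c(g_N) ∩ I_p)`. -/
def Atilde : Subalgebra K (DYc N c) := ((Ac c G).map (toDYc c)).topologicalClosure

/-- Basis of `(ℂ^N)^{⊗ N}`. -/
abbrev Idx (N : ℕ) : Type := Fin N → Fin N

/-- The matrix `M` acting on the `k`-th tensor factor. -/
def atSite {B : Type*} [Zero B] (k : Fin N) (M : Matrix (Fin N) (Fin N) B) :
    Matrix (Idx N) (Idx N) B :=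
  Matrix.of fun I J => if ∀ m, m ≠ k → I m = J m then M (I k) (J k) else 0

/-- The matrix `M` acting on the `k`-th and the `l`-th tensor factor. -/
def atSites {B : Type*} [Zero B] (k l : Fin N) (M : Matrix (Fin N × Fin N) (Fin N × Fin N) B) :
    Matrix (Idx N) (Idx N) B :=
  Matrix.of fun I J =>
    if ∀ m, m ≠ k → m ≠ l → I m = J m then M (I k, I l) (J k, J l) else 0

/-- The anti-symmetrizer `A^{(N)} = (1/N!) ∑_σ sgn σ · σ` on `(ℂ^N)^{⊗ N}`. -/
def antisymmetrizer (N : ℕ) : Matrix (Idx N) (Idx N) ℂ :=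
  Matrix.of fun I J => (N.factorial : ℂ)⁻¹ *
    ∑ σ : Equiv.Perm (Fin N), if I = J ∘ σ then ((Equiv.Perm.sign σ : ℤ) : ℂ) else 0

/-- `R̄ᵗ_ij(-2u + s)`, expanded in powers of `u⁻¹`. -/
def RbarT (i j : Fin N) (s : K) : Matrix (Idx N) (Idx N) (PowerSeries K) :=
  atSites i j (partialTranspose (Rbar (invLin (-2) s)))

/-- `S_{[N]}(u_- + hc/2)` with `u_- = (u, u - h, …, u - (N-1)h)`: the ordered product over
`i = 0, …, N-1` of `S_i(u - ih + hc/2)` and, for `j = i+1, …, N-1`, of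
`R̄ᵗ_ij(-2u + (i+j)h - 2hc)`. -/
def Sbracket : Matrix (Idx N) (Idx N) (PowerSeries (DY N c)) :=
  ((List.finRange N).map fun i =>
    atSite i (substInv (Sminus c G) (invLin 1 ((c / 2 - (i : ℕ)) • h))) *
      (((List.finRange N).filter fun j => i < j).map fun j =>
        (RbarT i j (((i : ℕ) + (j : ℕ) - 2 * c : ℂ) • h)).map
          (PowerSeries.map (algebraMap K (DY N c)))).prod).prod

/-- The terms of the `h`-adically convergent expansion
`∑_l binom(m+l, l) (-ih) ^ l S⁺_{m+l}` of the coefficient of `u ^ m` in `S⁺(u - ih)`, where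
`S⁺(u) = ∑_m S⁺_m u ^ m`. -/
def shiftTerm (i : Fin N) (m l : ℕ) : Matrix (Fin N) (Fin N) (DYc N c) :=
  Matrix.of fun a b => toDYc c
    ((((m + l).choose l : ℂ) • (-(i : ℕ) : ℂ) ^ l • h ^ l : K) • coeff (m + l) (Splus c G a b))

/-- `S⁺_i(u - ih)`: the function that maps `k` to the coefficient of `u ^ k`. -/
def plusFactor (i : Fin N) : ℤ → Matrix (Idx N) (Idx N) (DYc N c)
  | Int.ofNat m => atSite i (∑' l, shiftTerm c G i m l)
  | Int.negSucc _ => 0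

/-- The coefficient of `u ^ k` in a matrix of power series in `u⁻¹`. -/
def negCoeff {B : Type*} [Semiring B] (M : Matrix (Idx N) (Idx N) (PowerSeries B)) (k : ℤ) :
    Matrix (Idx N) (Idx N) B :=
  if k ≤ 0 then M.map (coeff (-k).toNat) else 0

/-- The ordered list of the factors of `S⁺_{[N]}(u_-) S_{[N]}(u_- + hc/2)⁻¹`: for `i = 0, …, N-1`
the series `S⁺_i(u - ih)` and, for `j = i+1, …, N-1`, the series `R̄ᵗ_ij(-2u + (i+j)h)`; finally
`S_{[N]}(u_- + hc/2)⁻¹`. Every series is given by its coefficients. -/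
def factors : List (ℤ → Matrix (Idx N) (Idx N) (DYc N c)) :=
  ((List.finRange N).flatMap fun i =>
    plusFactor c G i ::
      (((List.finRange N).filter fun j => i < j).map fun j => fun k =>
        (negCoeff (RbarT i j (((i : ℕ) + (j : ℕ) : ℂ) • h)) k).map (algebraMap K (DYc N c)))) ++
    [fun k => (negCoeff (Ring.inverse (Sbracket c G)) k).map (toDYc c)]

/-- The contribution to the coefficient of `u ^ k` in the product of the factors that comes from
the coefficients of `u ^ (e 0)`, `u ^ (e 1)`, … in the successive factors, where `∑ e = k`. -/
def productTerm (k : ℤ) (e : {e : Fin (factors c G).length → ℤ // ∑ j, e j = k}) :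
    Matrix (Idx N) (Idx N) (DYc N c) :=
  (List.ofFn fun j => (factors c G).get j (e.1 j)).prod

/-- The coefficient of `u ^ k` in
`𝔸(u) = tr_{1,…,N} A^{(N)} S⁺_{[N]}(u_-) S_{[N]}(u_- + hc/2)⁻¹`. -/
def coeffA (k : ℤ) : DYc N c :=
  Matrix.trace ((antisymmetrizer N).map (fun z => algebraMap K (DYc N c) (algebraMap ℂ K z)) *
    ∑' e, productTerm c G k e)

end Twisted

end TwistedYangian

end

noncomputable section
namespace TwistedYangian
open PowerSeries Kronecker
set_option linter.unusedSectionVars false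

/-! ### Operators on tensor factors: one-site matrices, permutations and caps. -/

section Sites

variable {ι : Type*} [Fintype ι] [DecidableEq ι] {N : ℕ} {R : Type*} [Ring R]

/-- Operators on the tensor product of copies of the free module of rank `N`, one for every element
of `ι`. -/
abbrev SiteOp (ι : Type*) (N : ℕ) (R : Type*) := Matrix (ι → Fin N) (ι → Fin N) R

/-- The matrix `M` acting on the tensor factor `k`. -/
def siteOp (k : ι) (M : Matrix (Fin N) (Fin N) R) : SiteOp ι N R :=
  Matrix.of fun I J => if ∀ m, m ≠ k → I m = J m then M (I k) (J k) else 0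

/-- The permutation of the tensor factors `k` and `l`. -/
def swapOp (k l : ι) : SiteOp ι N R :=
  Matrix.of fun I J => if I = J ∘ Equiv.swap k l then 1 else 0

/-- The partial transpose of the permutation of the tensor factors `k` and `l`. -/
def capOp (k l : ι) : SiteOp ι N R :=
  Matrix.of fun I J =>
    if (∀ m, m ≠ k → m ≠ l → I m = J m) ∧ I k = I l ∧ J k = J l then 1 else 0

lemma eq_update_iff (k : ι) (I J : ι → Fin N) :
    (∀ m, m ≠ k → I m = J m) ↔ J = Function.update I k (J k) := by
  constructor
  · intro h
    ext m
    by_cases hm : m = k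
    · subst hm; simp
    · simp [Function.update_of_ne hm, h m hm]
  · intro h m hm
    rw [h, Function.update_of_ne hm]

lemma siteOp_mul_apply (k : ι) (M : Matrix (Fin N) (Fin N) R) (Z : SiteOp ι N R)
    (I J : ι → Fin N) :
    (siteOp k M * Z) I J = ∑ p, M (I k) p * Z (Function.update I k p) J := by
  rw [Matrix.mul_apply]
  symm
  refine Finset.sum_of_injOn (fun p => Function.update I k p)
    (fun p _ q _ h => by simpa using congrFun h k) (by simp) ?_ ?_
  · intro K _ hK
    have : ¬ ∀ m, m ≠ k → I m = K m := by
      intro h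
      rw [eq_update_iff] at h
      exact hK ⟨K k, by simp, h.symm⟩
    simp [siteOp, this]
  · intro p _
    have : ∀ m, m ≠ k → I m = Function.update I k p m := fun m hm => by
      rw [Function.update_of_ne hm]
    simp only [siteOp, Matrix.of_apply, if_pos this, Function.update_self]

lemma mul_siteOp_apply (k : ι) (M : Matrix (Fin N) (Fin N) R) (Z : SiteOp ι N R)
    (I J : ι → Fin N) :
    (Z * siteOp k M) I J = ∑ p, Z I (Function.update J k p) * M p (J k) := by
  rw [Matrix.mul_apply]
  symm
  refine Finset.sum_of_injOn (fun p => Function.update J k p)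
    (fun p _ q _ h => by simpa using congrFun h k) (by simp) ?_ ?_
  · intro K _ hK
    have : ¬ ∀ m, m ≠ k → K m = J m := by
      intro h
      have h' : ∀ m, m ≠ k → J m = K m := fun m hm => (h m hm).symm
      rw [eq_update_iff] at h'
      exact hK ⟨K k, by simp, h'.symm⟩
    simp [siteOp, this]
  · intro p _
    have : ∀ m, m ≠ k → Function.update J k p m = J m := fun m hm => by
      rw [Function.update_of_ne hm]
    simp only [siteOp, Matrix.of_apply, if_pos this, Function.update_self]

lemma comp_swap_swap (k l : ι) (J : ι → Fin N) :
    (J ∘ Equiv.swap k l) ∘ Equiv.swap k l = J := by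
  ext m; simp

lemma eq_comp_swap_iff (k l : ι) (I J : ι → Fin N) :
    I = J ∘ Equiv.swap k l ↔ J = I ∘ Equiv.swap k l :=
  ⟨fun h => by rw [h, comp_swap_swap], fun h => by rw [h, comp_swap_swap]⟩

lemma swapOp_mul_apply (k l : ι) (Z : SiteOp ι N R) (I J : ι → Fin N) :
    (swapOp k l * Z : SiteOp ι N R) I J = Z (I ∘ Equiv.swap k l) J := by
  simp [Matrix.mul_apply, swapOp, eq_comp_swap_iff k l I]

lemma mul_swapOp_apply (k l : ι) (Z : SiteOp ι N R) (I J : ι → Fin N) :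
    (Z * swapOp k l : SiteOp ι N R) I J = Z I (J ∘ Equiv.swap k l) := by
  simp [Matrix.mul_apply, swapOp]

lemma vecMul_swapOp_apply (k l : ι) (v : (ι → Fin N) → R) (J : ι → Fin N) :
    (Matrix.vecMul v (swapOp k l : SiteOp ι N R)) J = v (J ∘ Equiv.swap k l) := by
  simp [Matrix.vecMul, dotProduct, swapOp]

lemma swapOp_mul_self (k l : ι) : (swapOp k l * swapOp k l : SiteOp ι N R) = 1 := by
  ext I J
  rw [swapOp_mul_apply]
  simp only [swapOp, Matrix.of_apply, Matrix.one_apply]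
  congr 1
  rw [← eq_comp_swap_iff, comp_swap_swap, eq_iff_iff]
  exact eq_comm

lemma capOp_mul_apply {k l : ι} (hkl : k ≠ l) (Z : SiteOp ι N R) (I J : ι → Fin N) :
    (capOp k l * Z : SiteOp ι N R) I J =
      if I k = I l then ∑ p, Z (Function.update (Function.update I k p) l p) J else 0 := by
  rw [Matrix.mul_apply]
  split_ifs with hI
  · symm
    refine Finset.sum_of_injOn (fun p => Function.update (Function.update I k p) l p)
      (fun p _ q _ h => by simpa using congrFun h l) (by simp) ?_ ?_
    · intro K _ hK
      have : ¬ ((∀ m, m ≠ k → m ≠ l → I m = K m) ∧ I k = I l ∧ K k = K l) := by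
        rintro ⟨h, -, h'⟩
        refine hK ⟨K k, by simp, ?_⟩
        ext m
        by_cases hm : m = l
        · subst hm; simp [h']
        · by_cases hm' : m = k
          · subst hm'; simp [hm]
          · simp [hm, hm', h m hm' hm]
      simp [capOp, this]
    · intro p _
      have : (∀ m, m ≠ k → m ≠ l → I m = Function.update (Function.update I k p) l p m) ∧
          I k = I l ∧ Function.update (Function.update I k p) l p k =
            Function.update (Function.update I k p) l p l := by
        refine ⟨fun m hm hm' => by simp [hm, hm'], hI, by simp [hkl]⟩
      simp only [capOp, Matrix.of_apply, if_pos this, one_mul]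
  · simp [capOp, hI]

lemma capOp_comm (k l : ι) : (capOp k l : SiteOp ι N R) = capOp l k := by
  ext I J
  simp only [capOp, Matrix.of_apply]
  congr 1
  rw [eq_iff_iff]
  constructor
  · rintro ⟨h1, h2, h3⟩; exact ⟨fun m a b => h1 m b a, h2.symm, h3.symm⟩
  · rintro ⟨h1, h2, h3⟩; exact ⟨fun m a b => h1 m b a, h2.symm, h3.symm⟩

/-! Commutation of operators on disjoint tensor factors. -/

lemma swapOp_commute_siteOp {k l m : ι} (hk : m ≠ k) (hl : m ≠ l) (M : Matrix (Fin N) (Fin N) R) :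
    Commute (swapOp k l : SiteOp ι N R) (siteOp m M) := by
  ext I J
  rw [swapOp_mul_apply, mul_swapOp_apply]
  simp only [siteOp, Matrix.of_apply, Function.comp_apply, Equiv.swap_apply_of_ne_of_ne hk hl]
  congr 1
  rw [eq_iff_iff]
  have ne : ∀ x, x ≠ m → Equiv.swap k l x ≠ m := by
    intro x hx h
    rw [Equiv.swap_apply_eq_iff, Equiv.swap_apply_of_ne_of_ne hk hl] at h
    exact hx h
  constructor
  · intro h x hx
    simpa using h _ (ne x hx)
  · intro h x hx
    simpa using h _ (ne x hx)

lemma siteOp_mul_siteOp_apply {k l : ι} (hkl : k ≠ l) (M M' : Matrix (Fin N) (Fin N) R)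
    (I J : ι → Fin N) : (siteOp k M * siteOp l M') I J =
      if ∀ m, m ≠ k → m ≠ l → I m = J m then M (I k) (J k) * M' (I l) (J l) else 0 := by
  rw [siteOp_mul_apply, Finset.sum_eq_single (J k)]
  · simp only [siteOp, Matrix.of_apply, Function.update_of_ne hkl.symm, mul_ite, mul_zero]
    congr 1
    rw [eq_iff_iff]
    refine forall_congr' fun m => ?_
    by_cases hm : m = k
    · subst hm; simp
    · simp [hm]
  · intro p _ hp
    have : ¬ ∀ m, m ≠ l → Function.update I k p m = J m := fun h => hp (by simpa using h k hkl)
    simp [siteOp, this]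
  · simp

lemma siteOp_commute_siteOp {k l : ι} (hkl : k ≠ l) (M M' : Matrix (Fin N) (Fin N) R)
    (h : ∀ i j i' j', Commute (M i j) (M' i' j')) : Commute (siteOp k M) (siteOp l M') := by
  ext I J
  rw [siteOp_mul_siteOp_apply hkl, siteOp_mul_siteOp_apply hkl.symm, (h _ _ _ _).eq]
  congr 1
  rw [eq_iff_iff]
  exact ⟨fun h m a b => h m b a, fun h m a b => h m b a⟩

lemma siteOp_commute_capOp {k l m : ι} (hk : m ≠ k) (hl : m ≠ l) (M : Matrix (Fin N) (Fin N) R) :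
    Commute (siteOp m M) (capOp k l : SiteOp ι N R) := by
  ext I J
  rw [siteOp_mul_apply, mul_siteOp_apply, Finset.sum_eq_single (J m), Finset.sum_eq_single (I m)]
  · simp only [capOp, Matrix.of_apply, Function.update_of_ne hk.symm, Function.update_of_ne hl.symm,
      mul_ite, ite_mul, one_mul, mul_one, mul_zero, zero_mul]
    congr 2
    rw [eq_iff_iff]
    refine forall_congr' fun x => ?_
    by_cases hx : x = m
    · subst hx; simp
    · simp [hx]
  · intro p _ hp
    have : ¬ ∀ x, x ≠ k → x ≠ l → I x = Function.update J m p x :=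
      fun h => hp (by simpa using (h m hk hl).symm)
    simp [capOp, this]
  · simp
  · intro p _ hp
    have : ¬ ∀ x, x ≠ k → x ≠ l → Function.update I m p x = J x :=
      fun h => hp (by simpa using h m hk hl)
    simp [capOp, this]
  · simp

lemma capOp_mul_capOp_apply {k l m n : ι} (hkl : k ≠ l) (hkm : k ≠ m) (hkn : k ≠ n) (hlm : l ≠ m)
    (hln : l ≠ n) (I J : ι → Fin N) : (capOp k l * capOp m n : SiteOp ι N R) I J =
      if (∀ x, x ≠ k → x ≠ l → x ≠ m → x ≠ n → I x = J x) ∧ I k = I l ∧ J k = J l ∧ I m = I n ∧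
        J m = J n then 1 else 0 := by
  rw [capOp_mul_apply hkl]
  by_cases hI : I k = I l
  · rw [if_pos hI, Finset.sum_eq_single (J k)]
    · simp only [capOp, Matrix.of_apply]
      congr 1
      rw [eq_iff_iff]
      have e1 : Function.update (Function.update I k (J k)) l (J k) m = I m := by
        simp [hkm.symm, hlm.symm]
      have e2 : Function.update (Function.update I k (J k)) l (J k) n = I n := by
        simp [hkn.symm, hln.symm]
      rw [e1, e2]
      constructor
      · rintro ⟨h1, h2, h3⟩
        refine ⟨fun x a b c d => ?_, hI, ?_, h2, h3⟩
        · simpa [a, b] using h1 x c d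
        · simpa using h1 l hlm hln
      · rintro ⟨h1, -, h2, h3, h4⟩
        refine ⟨fun x a b => ?_, h3, h4⟩
        by_cases hx : x = l
        · subst hx; simp [h2]
        · by_cases hx' : x = k
          · subst hx'; simp [hx]
          · simp [hx, hx', h1 x hx' hx a b]
    · intro p _ hp
      have : ¬ ∀ x, x ≠ m → x ≠ n → Function.update (Function.update I k p) l p x = J x :=
        fun h => hp (by simpa [hkl] using h k hkm hkn)
      simp [capOp, this]
    · simp
  · simp [hI]

lemma capOp_commute_capOp {k l m n : ι} (hkl : k ≠ l) (hkm : k ≠ m) (hkn : k ≠ n) (hlm : l ≠ m)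
    (hln : l ≠ n) (hmn : m ≠ n) : Commute (capOp k l : SiteOp ι N R) (capOp m n) := by
  ext I J
  rw [capOp_mul_capOp_apply hkl hkm hkn hlm hln,
    capOp_mul_capOp_apply hmn hkm.symm hlm.symm hkn.symm hln.symm]
  congr 1
  rw [eq_iff_iff]
  constructor
  · rintro ⟨h1, h2, h3, h4, h5⟩; exact ⟨fun x a b c d => h1 x c d a b, h4, h5, h2, h3⟩
  · rintro ⟨h1, h2, h3, h4, h5⟩; exact ⟨fun x a b c d => h1 x c d a b, h4, h5, h2, h3⟩

/-- Conjugation by a permutation of the tensor factors only relabels the factors that a cap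
contracts. -/
lemma swapOp_mul_capOp (k l m n : ι) : (swapOp k l * capOp m n : SiteOp ι N R) =
    capOp (Equiv.swap k l m) (Equiv.swap k l n) * swapOp k l := by
  ext I J
  rw [swapOp_mul_apply, mul_swapOp_apply]
  simp only [capOp, Matrix.of_apply, Function.comp_apply, Equiv.swap_apply_self]
  congr 2
  rw [eq_iff_iff]
  constructor
  · intro h x hx hx'
    have := h (Equiv.swap k l x) (by rintro rfl; simp at hx) (by rintro rfl; simp at hx')
    simpa using this
  · intro h x hx hx'
    have := h (Equiv.swap k l x) (by simpa using hx) (by simpa using hx')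
    simpa using this

lemma swapOp_commute_capOp {k l m n : ι} (hkm : m ≠ k) (hlm : m ≠ l) (hkn : n ≠ k) (hln : n ≠ l) :
    Commute (swapOp k l : SiteOp ι N R) (capOp m n) := by
  have := swapOp_mul_capOp (N := N) (R := R) k l m n
  rwa [Equiv.swap_apply_of_ne_of_ne hkm hlm, Equiv.swap_apply_of_ne_of_ne hkn hln] at this

/-- Once the first cap ties the factor j to a, the second one merely reroutes the index of b.
Together with conjugation this is all that the transposed Yang–Baxter equation needs. -/
lemma capOp_mul_capOp {j a b : ι} (hja : j ≠ a) (hjb : j ≠ b) (hab : a ≠ b) :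
    (capOp j a * capOp j b : SiteOp ι N R) = capOp j a * swapOp a b := by
  ext I J
  rw [mul_swapOp_apply, capOp_mul_apply hja]
  by_cases hI : I j = I a
  · rw [if_pos hI, Finset.sum_eq_single (J a)]
    · simp only [capOp, Matrix.of_apply]
      congr 1
      rw [eq_iff_iff]
      simp only [Function.comp_apply, Equiv.swap_apply_left, Equiv.swap_apply_of_ne_of_ne hja hjb]
      simp only [Function.update_of_ne hja, Function.update_self, Function.update_of_ne hab.symm,
        Function.update_of_ne hjb.symm]
      constructor
      · rintro ⟨h1, h2, h3⟩
        refine ⟨fun x hx hx' => ?_, hI, h3⟩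
        by_cases hxb : x = b
        · subst hxb; rw [Equiv.swap_apply_right, h2]
        · rw [Equiv.swap_apply_of_ne_of_ne hx' hxb, ← h1 x hx hxb]; simp [hx, hx']
      · rintro ⟨h1, -, h3⟩
        refine ⟨fun x hx hx' => ?_, ?_, h3⟩
        · by_cases hxa : x = a
          · subst hxa; simp
          · rw [Function.update_of_ne hxa, Function.update_of_ne hx, h1 x hx hxa,
              Equiv.swap_apply_of_ne_of_ne hxa hx']
        · rw [h1 b hjb.symm hab.symm, Equiv.swap_apply_right]
    · intro p _ hp
      have : ¬ ∀ x, x ≠ j → x ≠ b → Function.update (Function.update I j p) a p x = J x :=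
        fun h => hp (by simpa using h a hja.symm hab)
      simp [capOp, this]
    · simp
  · simp [capOp, hI]

/-- The cap forces its row indices to agree and its column indices to agree, so M reads both of its
indices from the row multi-index and M' both from the column multi-index. This turns the reflected
relation into the ordinary one with permuted indices. -/
lemma siteOp_mul_capOp_mul_siteOp_apply {i j : ι} (hij : i ≠ j) (M M' : Matrix (Fin N) (Fin N) R)
    (I J : ι → Fin N) : (siteOp i M * capOp i j * siteOp j M' : SiteOp ι N R) I J =
      if ∀ m, m ≠ i → m ≠ j → I m = J m then M (I i) (I j) * M' (J i) (J j) else 0 := by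
  rw [mul_siteOp_apply, Finset.sum_eq_single (J i)]
  · rw [siteOp_mul_apply, Finset.sum_eq_single (I j)]
    · simp only [capOp, Matrix.of_apply, Function.update_self, Function.update_of_ne hij,
        Function.update_of_ne hij.symm, mul_ite, ite_mul, mul_one, mul_zero, zero_mul, and_true]
      congr 1
      rw [eq_iff_iff]
      refine forall_congr' fun x => ?_
      by_cases hx : x = i
      · subst hx; simp
      · by_cases hx' : x = j
        · subst hx'; simp
        · simp [hx, hx']
    · intro p _ hp
      simp [capOp, Function.update_of_ne hij.symm, hp]
    · simp
  · intro p _ hp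
    rw [siteOp_mul_apply]
    have : ∀ q, capOp (R := R) i j (Function.update I i q) (Function.update J j p) = 0 := by
      intro q
      simp [capOp, Function.update_of_ne hij, hp.symm]
    simp [this]
  · simp

end Sites

/-! ### The alternating form of top degree. -/

section Alternating

variable {N : ℕ} {R : Type*} [Ring R]

/-- The coordinates of the alternating form of degree `N` on a free module of rank `N`. -/
def altForm (J : Fin N → Fin N) : ℤ :=
  Matrix.det (Matrix.of fun i k => if J i = k then (1 : ℤ) else 0)

lemma altForm_comp_perm (J : Fin N → Fin N) (σ : Equiv.Perm (Fin N)) :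
    altForm (J ∘ σ) = Equiv.Perm.sign σ * altForm J :=
  Matrix.det_permute σ (Matrix.of fun i k => if J i = k then (1 : ℤ) else 0)

lemma altForm_id : altForm (id : Fin N → Fin N) = 1 := by
  have : (Matrix.of fun i k : Fin N => if id i = k then (1 : ℤ) else 0) = 1 := by
    ext i k; simp [Matrix.one_apply]
  rw [altForm, this, Matrix.det_one]

lemma altForm_comp_swap (J : Fin N → Fin N) {i j : Fin N} (hij : i ≠ j) :
    altForm (J ∘ Equiv.swap i j) = -altForm J := by
  rw [altForm_comp_perm, Equiv.Perm.sign_swap hij]; simp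

/-- A function of `N` indices that changes sign under the permutations of adjacent indices. -/
def IsAlt (φ : (Fin N → Fin N) → R) : Prop :=
  ∀ (J : Fin N → Fin N) (i j : Fin N), (j : ℕ) = i + 1 → φ (J ∘ Equiv.swap i j) = -φ J

/-- Adjacent transpositions generate the symmetric group. -/
lemma IsAlt.comp_perm {φ : (Fin N → Fin N) → R} (hφ : IsAlt φ) (J : Fin N → Fin N)
    (σ : Equiv.Perm (Fin N)) : φ (J ∘ σ) = ((Equiv.Perm.sign σ : ℤ) : R) * φ J := by
  obtain _ | n := N
  · have : σ = 1 := Subsingleton.elim _ _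
    subst this; simp
  · have hσ : σ ∈ Submonoid.closure
        (Set.range fun i : Fin n => Equiv.swap i.castSucc i.succ) := by
      rw [Equiv.Perm.mclosure_swap_castSucc_succ]; trivial
    induction hσ using Submonoid.closure_induction generalizing J with
    | mem x hx =>
      obtain ⟨i, rfl⟩ := hx
      rw [hφ J _ _ (by simp), Equiv.Perm.sign_swap (Fin.castSucc_lt_succ).ne]
      simp
    | one => simp
    | mul x y _ _ hx hy =>
      have : J ∘ (x * y : Equiv.Perm _) = (J ∘ x) ∘ y := rfl
      rw [this, hy, hx, Equiv.Perm.sign_mul, ← mul_assoc, mul_comm (Equiv.Perm.sign x)]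
      push_cast; rfl

/-- An injective multi-index is a permutation of the identity, which fixes the value up to sign. A
multi-index with a repetition is fixed by a transposition, so its value equals its own negative and
vanishes in the absence of 2-torsion. -/
lemma IsAlt.eq_mul {φ : (Fin N → Fin N) → R} (hφ : IsAlt φ) (h2 : ∀ x : R, x + x = 0 → x = 0)
    (J : Fin N → Fin N) : φ J = φ id * (altForm J : R) := by
  by_cases hJ : Function.Injective J
  · set σ := Equiv.ofBijective J (Finite.injective_iff_bijective.1 hJ) with hσ
    have e : J = id ∘ σ := rfl
    rw [e, hφ.comp_perm, altForm_comp_perm, altForm_id, mul_one]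
    exact (Int.cast_commute _ _).eq
  · simp only [Function.Injective, not_forall] at hJ
    obtain ⟨i, j, hij, hne⟩ := hJ
    have e : J ∘ Equiv.swap i j = J := by
      ext x
      by_cases hx : x = i
      · subst hx; simp [hij]
      · by_cases hx' : x = j
        · subst hx'; simp [hij]
        · simp [Equiv.swap_apply_of_ne_of_ne hx hx']
    have h1 : φ J = 0 := by
      apply h2
      have := hφ.comp_perm J (Equiv.swap i j)
      rw [e, Equiv.Perm.sign_swap hne] at this
      nth_rewrite 1 [this]
      simp
    have h3 : altForm J = 0 := by
      have := altForm_comp_swap J hne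
      rw [e] at this
      omega
    rw [h1, h3]; simp

/-- Cramer's rule: replacing row i of the 0-1 matrix of J by a unit vector produces an entry of the
adjugate, and the sum is an entry of adj(M) M = det(M). -/
lemma sum_altForm_update (J : Fin N → Fin N) (a b : Fin N) :
    ∑ i, (if J i = a then altForm (Function.update J i b) else 0) =
      if b = a then altForm J else 0 := by
  set M : Matrix (Fin N) (Fin N) ℤ := Matrix.of fun i k => if J i = k then (1 : ℤ) else 0 with hM
  have h1 : ∀ i, altForm (Function.update J i b) = M.adjugate b i := by
    intro i
    rw [Matrix.adjugate_apply, altForm]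
    congr 1
    ext x k
    by_cases hx : x = i
    · subst hx; simp [Pi.single_apply, eq_comm]
    · simp [hx, hM]
  have h2 := congrFun (congrFun (Matrix.adjugate_mul M) b) a
  rw [Matrix.mul_apply] at h2
  simp only [Matrix.smul_apply, Matrix.one_apply, smul_eq_mul, mul_ite, mul_one, mul_zero] at h2
  rw [show altForm J = M.det from rfl, ← h2]
  refine Finset.sum_congr rfl fun i _ => ?_
  rw [h1]
  simp [hM]

variable (N R) in
/-- The alternating form as a row vector. -/
def altVec : (Fin N → Fin N) → R := fun J => (altForm J : R)

end Alternating

/-! ### RTT relations and operators carried through by the antisymmetrizer of two factors. -/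

section Fusion

variable {ι : Type*} [Fintype ι] [DecidableEq ι] {N : ℕ} {L R : Type*} [CommRing L] [Ring R]
  [Algebra L R]

/-- The matrices `M`, `M'` satisfy `(α - β P) M₁ M'₂ = M'₂ M₁ (α' - β' P)`. -/
def RTT (M M' : Matrix (Fin N) (Fin N) R) (α β α' β' : L) : Prop :=
  ∀ i j k l, α • (M i j * M' k l) - β • (M k j * M' i l) =
    α' • (M' k l * M i j) - β' • (M' k j * M i l)

/-- Transposition swaps the two sides of the relation together with the two matrices; this is why
the transposed matrices need the opposite order of spectral parameters. -/
lemma RTT.transpose {M M' : Matrix (Fin N) (Fin N) R} {α β α' β' : L} (hM : RTT M M' α β α' β') :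
    RTT M'.transpose M.transpose α' β' α β := by
  intro i j k l
  simp only [Matrix.transpose_apply]
  exact (hM l k j i).symm

lemma RTT.mul_siteOp {M M' : Matrix (Fin N) (Fin N) R} {α β α' β' : L}
    (hM : RTT M M' α β α' β') {a b : ι} (hab : a ≠ b) :
    (α • 1 - β • swapOp a b) * (siteOp a M * siteOp b M') =
      siteOp b M' * siteOp a M * (α' • 1 - β' • swapOp a b) := by
  ext I J
  rw [sub_mul, mul_sub, smul_mul_assoc, smul_mul_assoc, mul_smul_comm, mul_smul_comm, one_mul,
    mul_one, Matrix.sub_apply, Matrix.sub_apply, Matrix.smul_apply, Matrix.smul_apply,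
    Matrix.smul_apply, Matrix.smul_apply, swapOp_mul_apply,
    mul_swapOp_apply, siteOp_mul_siteOp_apply hab, siteOp_mul_siteOp_apply hab,
    siteOp_mul_siteOp_apply hab.symm, siteOp_mul_siteOp_apply hab.symm]
  simp only [Function.comp_apply, Equiv.swap_apply_left, Equiv.swap_apply_right]
  by_cases h : ∀ m, m ≠ a → m ≠ b → I m = J m
  · have h1 : ∀ m, m ≠ b → m ≠ a → I m = J m := fun m x y => h m y x
    have h2 : ∀ m, m ≠ a → m ≠ b → I (Equiv.swap a b m) = J m := fun m x y => by
      rw [Equiv.swap_apply_of_ne_of_ne x y, h m x y]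
    have h3 : ∀ m, m ≠ b → m ≠ a → I m = J (Equiv.swap a b m) := fun m x y => by
      rw [Equiv.swap_apply_of_ne_of_ne y x, h m y x]
    rw [if_pos h, if_pos h1, if_pos h2, if_pos h3]
    exact hM _ _ _ _
  · have h1 : ¬ ∀ m, m ≠ b → m ≠ a → I m = J m := fun g => h fun m x y => g m y x
    have h2 : ¬ ∀ m, m ≠ a → m ≠ b → I (Equiv.swap a b m) = J m := fun g => h fun m x y => by
      rw [← g m x y, Equiv.swap_apply_of_ne_of_ne x y]
    have h3 : ¬ ∀ m, m ≠ b → m ≠ a → I m = J (Equiv.swap a b m) := fun g => h fun m x y => by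
      rw [g m y x, Equiv.swap_apply_of_ne_of_ne x y]
    rw [if_neg h, if_neg h1, if_neg h2, if_neg h3]
    simp

/-- The reflected form of the `RTT`-relation. -/
lemma RTT.reflect {M M' : Matrix (Fin N) (Fin N) R} {y : L} (hM : RTT M M' 1 y 1 y) {a b : ι}
    (hab : a ≠ b) :
    siteOp a M.transpose * (1 - y • capOp a b) * siteOp b M' =
      siteOp b M' * (1 - y • capOp a b) * siteOp a M.transpose := by
  ext I J
  simp only [mul_sub, sub_mul, mul_one, mul_smul_comm, smul_mul_assoc]
  rw [capOp_comm a b, Matrix.sub_apply, Matrix.sub_apply, Matrix.smul_apply, Matrix.smul_apply,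
    siteOp_mul_capOp_mul_siteOp_apply hab.symm, capOp_comm b a,
    siteOp_mul_capOp_mul_siteOp_apply hab,
    siteOp_mul_siteOp_apply hab, siteOp_mul_siteOp_apply hab.symm]
  by_cases h : ∀ m, m ≠ a → m ≠ b → I m = J m
  · have h1 : ∀ m, m ≠ b → m ≠ a → I m = J m := fun m x y => h m y x
    rw [if_pos h, if_pos h1, if_pos h, if_pos h1]
    have := hM (J a) (I a) (I b) (J b)
    simpa only [one_smul, Matrix.transpose_apply] using this
  · have h1 : ¬ ∀ m, m ≠ b → m ≠ a → I m = J m := fun g => h fun m x y => g m y x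
    rw [if_neg h, if_neg h1, if_neg h, if_neg h1]

/-- The operators that the antisymmetrizer of the tensor factors `a` and `b` is carried through. -/
def Fused (a b : ι) (Z : SiteOp ι N R) : Prop := (1 - swapOp a b) * Z * (1 + swapOp a b) = 0

lemma Fused.of_commute {a b : ι} {Z : SiteOp ι N R} (hZ : Commute (swapOp a b) Z) :
    Fused a b Z := by
  have : (1 - swapOp a b) * (1 + swapOp a b) = (0 : SiteOp ι N R) := by
    rw [sub_mul, mul_add, mul_add, swapOp_mul_self]; simp [add_comm]
  have h1 : Commute (1 - swapOp a b) Z := (Commute.one_left Z).sub_left hZ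
  rw [Fused, h1.eq, mul_assoc, this, mul_zero]

lemma Fused.of_intertwine {a b : ι} {Z Z' : SiteOp ι N R}
    (hZ : (1 - swapOp a b) * Z = Z' * (1 - swapOp a b)) : Fused a b Z := by
  have : (1 - swapOp a b) * (1 + swapOp a b) = (0 : SiteOp ι N R) := by
    rw [sub_mul, mul_add, mul_add, swapOp_mul_self]; simp [add_comm]
  rw [Fused, hZ, mul_assoc, this, mul_zero]

/-- Insert 2 = (1 - P) + (1 + P) between the two factors: one term dies by the hypothesis on Z', the
other by the hypothesis on Z. Only 2-torsion has to be excluded. -/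
lemma Fused.mul (h2 : ∀ x : R, x + x = 0 → x = 0) {a b : ι} {Z Z' : SiteOp ι N R}
    (hZ : Fused a b Z) (hZ' : Fused a b Z') : Fused a b (Z * Z') := by
  unfold Fused at *
  set D : SiteOp ι N R := 1 - swapOp a b with hD
  set E : SiteOp ι N R := 1 + swapOp a b with hE
  have h1 : D + E = 1 + 1 := by rw [hD, hE]; abel
  have h3 : D * (Z * Z') * E + D * (Z * Z') * E = 0 := by
    calc D * (Z * Z') * E + D * (Z * Z') * E = D * Z * (1 + 1) * (Z' * E) := by noncomm_ring
      _ = D * Z * D * (Z' * E) + D * Z * E * (Z' * E) := by rw [← h1]; noncomm_ring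
      _ = D * Z * (D * Z' * E) := by rw [hZ]; noncomm_ring
      _ = 0 := by rw [hZ', mul_zero]
  ext I J
  exact h2 _ (congrFun (congrFun h3 I) J)

lemma Fused.smul {a b : ι} {Z : SiteOp ι N R} (hZ : Fused a b Z) (y : L) : Fused a b (y • Z) := by
  rw [Fused, mul_smul_comm, smul_mul_assoc, hZ, smul_zero]

/-- The Yang–Baxter equation with one factor transposed, at the point where the R-matrix of a and b
degenerates to 1 - P. The condition on y and y' says 1/y' - 1/y = 1. -/
lemma Fused.cap_mul_cap {j a b : ι} (hja : j ≠ a) (hjb : j ≠ b) (hab : a ≠ b) {y y' : L}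
    (hy : y - y' = y * y') :
    Fused a b ((1 - y • capOp j a) * (1 - y' • capOp j b) : SiteOp ι N R) := by
  apply Fused.of_intertwine (Z' := (1 - y' • capOp j b) * (1 - y • capOp j a))
  have e1 := swapOp_mul_capOp (N := N) (R := R) a b j a
  rw [Equiv.swap_apply_left, Equiv.swap_apply_of_ne_of_ne hja hjb] at e1
  have e2 := swapOp_mul_capOp (N := N) (R := R) a b j b
  rw [Equiv.swap_apply_right, Equiv.swap_apply_of_ne_of_ne hja hjb] at e2
  have e3 := capOp_mul_capOp (N := N) (R := R) hja hjb hab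
  have e4 := capOp_mul_capOp (N := N) (R := R) hjb hja hab.symm
  have e5 : (swapOp b a : SiteOp ι N R) = swapOp a b := by
    simp only [swapOp, Equiv.swap_comm a b]
  rw [e5] at e4
  set P : SiteOp ι N R := swapOp a b
  set A : SiteOp ι N R := capOp j a
  set B : SiteOp ι N R := capOp j b
  have e6 : P * (A * P) = B * (P * P) := by rw [← mul_assoc, e1, mul_assoc]
  simp only [sub_mul, mul_sub, one_mul, mul_one, smul_mul_assoc, mul_smul_comm, e1, e2, e6, e3, e4,
    mul_assoc, smul_sub, smul_smul]
  have e7 : y = y * y' + y' := by rw [← hy]; ring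
  rw [← sub_eq_zero]
  rw [mul_comm y' y]
  generalize y * y' = z at *
  rw [e7]
  simp only [add_smul]
  abel

/-- The term G_a G_b commutes with P. In the cap term the entry is G(I a, I b) G(J a, J b): a
symmetric G is killed by 1 - P acting on the rows, a skew-symmetric one by 1 + P acting on the
columns. This is where the symmetry type of G enters, and y plays no role. -/
lemma Fused.reflect {a b : ι} (hab : a ≠ b) (G : Matrix (Fin N) (Fin N) L)
    (hG : G.transpose = G ∨ G.transpose = -G) (y : L) :
    Fused a b (siteOp a (G.map (algebraMap L R)) * (1 - y • capOp a b) *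
      siteOp b (G.map (algebraMap L R)) : SiteOp ι N R) := by
  set H : Matrix (Fin N) (Fin N) R := G.map (algebraMap L R) with hH
  have hc : ∀ i j (x : R), Commute (H i j) x := fun i j x => Algebra.commutes _ _
  have c1 : Commute (swapOp a b) (siteOp a H * siteOp b H) := by
    ext I J
    rw [swapOp_mul_apply, mul_swapOp_apply, siteOp_mul_siteOp_apply hab,
      siteOp_mul_siteOp_apply hab]
    simp only [Function.comp_apply, Equiv.swap_apply_left, Equiv.swap_apply_right]
    rw [(hc (I b) (J a) _).eq]
    congr 1
    rw [eq_iff_iff]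
    refine forall_congr' fun m => forall_congr' fun hm => forall_congr' fun hm' => ?_
    rw [Equiv.swap_apply_of_ne_of_ne hm hm']
  have f1 := Fused.of_commute c1
  unfold Fused at *
  have e1 : siteOp a H * (1 - y • capOp a b) * siteOp b H =
      siteOp a H * siteOp b H - y • (siteOp a H * capOp a b * siteOp b H) := by
    rw [mul_sub, mul_one, sub_mul, mul_smul_comm, smul_mul_assoc]
  rw [e1, mul_sub, sub_mul, f1, zero_sub, neg_eq_zero, mul_smul_comm, smul_mul_assoc]
  convert smul_zero y
  ext I J
  rw [mul_add, mul_one, Matrix.add_apply, mul_swapOp_apply, sub_mul, one_mul, Matrix.sub_apply,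
    Matrix.sub_apply, swapOp_mul_apply, swapOp_mul_apply]
  simp only [siteOp_mul_capOp_mul_siteOp_apply hab, Function.comp_apply, Equiv.swap_apply_left,
    Equiv.swap_apply_right]
  have s1 : ∀ I J : ι → Fin N, (∀ m, m ≠ a → m ≠ b → I (Equiv.swap a b m) = J m) ↔
      ∀ m, m ≠ a → m ≠ b → I m = J m := fun I J =>
    forall_congr' fun m => forall_congr' fun hm => forall_congr' fun hm' => by
      rw [Equiv.swap_apply_of_ne_of_ne hm hm']
  have s2 : ∀ I J : ι → Fin N, (∀ m, m ≠ a → m ≠ b → I m = J (Equiv.swap a b m)) ↔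
      ∀ m, m ≠ a → m ≠ b → I m = J m := fun I J =>
    forall_congr' fun m => forall_congr' fun hm => forall_congr' fun hm' => by
      rw [Equiv.swap_apply_of_ne_of_ne hm hm']
  have s3 : ∀ I J : ι → Fin N, (∀ m, m ≠ a → m ≠ b → I (Equiv.swap a b m) =
      J (Equiv.swap a b m)) ↔ ∀ m, m ≠ a → m ≠ b → I m = J m := fun I J =>
    forall_congr' fun m => forall_congr' fun hm => forall_congr' fun hm' => by
      rw [Equiv.swap_apply_of_ne_of_ne hm hm']
  simp only [s1, s2, s3]
  split_ifs
  · rcases hG with hG | hG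
    · have : ∀ i j, H i j = H j i := fun i j => by
        simp only [hH, Matrix.map_apply]; rw [← hG, Matrix.transpose_apply, hG]
      rw [this (I b) (I a)]
      simp
    · have : ∀ i j, H i j = -H j i := fun i j => by
        simp only [hH, Matrix.map_apply]
        rw [← map_neg, ← Matrix.neg_apply, ← hG, Matrix.transpose_apply]
      rw [this (J b) (J a)]
      simp
  · simp

end Fusion

/-! ### Ordered products of rows, and their factorization. -/

section Rows

variable {ι : Type*} [Fintype ι] [DecidableEq ι] {N : ℕ} {L R : Type*} [CommRing L] [Ring R]
  [Algebra L R]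

/-- The ordered product of the operators `S i * ∏ j, Q i j` over `i` in the list, where `j` runs
over the elements of the list behind `i`. -/
def rowProd {E : Type*} [Monoid E] (S : ι → E) (Q : ι → ι → E) : List ι → E
  | [] => 1
  | i :: l => S i * (l.map (Q i)).prod * rowProd S Q l

lemma rowProd_eq {n : ℕ} {E : Type*} [Monoid E] (S : Fin n → E) (Q : Fin n → Fin n → E) (l : List (Fin n))
    (hl : l.Pairwise (· < ·)) :
    (l.map fun i => S i * ((l.filter fun j => i < j).map (Q i)).prod).prod = rowProd S Q l := by
  induction l with
  | nil => rfl
  | cons i l ih =>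
    rw [List.pairwise_cons] at hl
    rw [List.map_cons, List.prod_cons, rowProd, ← ih hl.2]
    have e1 : (i :: l).filter (fun j => i < j) = l := by
      rw [List.filter_cons_of_neg (by simp), List.filter_eq_self]
      intro j hj
      simpa using hl.1 j hj
    rw [e1]
    congr 2
    refine List.map_congr_left fun j hj => ?_
    rw [List.filter_cons_of_neg (by simpa using (hl.1 j hj).le)]

/-- The transposed `R`-matrix with the normalizing factor `γ i j` in the tensor factors `i`
and `j`. -/
def reflR (γ η : ι → ι → L) (i j : ι) : SiteOp ι N R := γ i j • (1 - η i j • capOp i j)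

lemma commute_reflR {Z : SiteOp ι N R} {γ η : ι → ι → L} {i j : ι}
    (hZ : Commute Z (capOp i j)) : Commute Z (reflR γ η i j) :=
  ((Commute.one_right Z).sub_right (hZ.smul_right _)).smul_right _

lemma commute_list_prod {E κ : Type*} [Monoid E] {z : E} {f : κ → E} {l : List κ}
    (h : ∀ k ∈ l, Commute z (f k)) : Commute z (l.map f).prod := by
  apply Commute.list_prod_right
  intro x hx
  obtain ⟨k, hk, rfl⟩ := List.mem_map.1 hx
  exact h k hk

lemma Fused.list_prod (h2 : ∀ x : R, x + x = 0 → x = 0) {κ : Type*} {a b : ι}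
    {f : κ → SiteOp ι N R} {l : List κ} (h : ∀ k ∈ l, Fused a b (f k)) :
    Fused a b (l.map f).prod := by
  induction l with
  | nil => exact Fused.of_commute (Commute.one_right _)
  | cons k l ih =>
    rw [List.map_cons, List.prod_cons]
    exact (h k (by simp)).mul h2 (ih fun k' hk' => h k' (by simp [hk']))

lemma Fused.cap_mul_cap' {k a b : ι} (hka : k ≠ a) (hkb : k ≠ b) (hab : a ≠ b) {y y' : L}
    (hy : y - y' = y * y') :
    Fused a b ((1 - y • capOp a k) * (1 - y' • capOp b k) : SiteOp ι N R) := by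
  rw [capOp_comm a k, capOp_comm b k]
  exact Fused.cap_mul_cap hka hkb hab hy

/-- Only the two neighbouring factors with indices a and b feel the permutation; they form a
Yang–Baxter pair, and all the others commute with P. -/
lemma Fused.row (h2 : ∀ x : R, x + x = 0 → x = 0) {γ η : ι → ι → L} {i a b : ι}
    (hia : i ≠ a) (hib : i ≠ b) (hab : a ≠ b) (hη : η i a - η i b = η i a * η i b)
    {pre post : List ι} (hnd : (pre ++ a :: b :: post).Nodup) :
    Fused a b (((pre ++ a :: b :: post).map (reflR γ η i)).prod : SiteOp ι N R) := by
  have hc : ∀ k, k ≠ a → k ≠ b → Fused a b (reflR γ η i k : SiteOp ι N R) := fun k h1 h3 =>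
    Fused.of_commute (commute_reflR (swapOp_commute_capOp hia hib h1 h3))
  have hpre : ∀ k ∈ pre, k ≠ a ∧ k ≠ b := by
    intro k hk
    have := (List.nodup_append.1 hnd).2.2 k hk
    exact ⟨this a (by simp), this b (by simp)⟩
  have hpost : ∀ k ∈ post, k ≠ a ∧ k ≠ b := by
    intro k hk
    have := (List.nodup_append.1 hnd).2.1
    simp only [List.nodup_cons, List.mem_cons, not_or] at this
    exact ⟨fun h => this.1.2 (h ▸ hk), fun h => this.2.1 (h ▸ hk)⟩
  rw [List.map_append, List.prod_append, List.map_cons, List.map_cons, List.prod_cons,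
    List.prod_cons, ← mul_assoc (reflR γ η i a)]
  refine (Fused.list_prod h2 fun k hk => hc k (hpre k hk).1 (hpre k hk).2).mul h2
    (Fused.mul h2 ?_ (Fused.list_prod h2 fun k hk => hc k (hpost k hk).1 (hpost k hk).2))
  unfold reflR
  rw [smul_mul_assoc, mul_smul_comm]
  exact ((Fused.cap_mul_cap hia hib hab hη).smul _).smul _

/-- Caps on disjoint pairs of factors commute, so the rows of a and b can be interleaved into pairs
that end at the same k. -/
lemma prod_rows {γ η : ι → ι → L} {a b : ι} (hab : a ≠ b) {post : List ι} (hnd : post.Nodup)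
    (ha : a ∉ post) (hb : b ∉ post) :
    (post.map (reflR γ η a)).prod * (post.map (reflR γ η b)).prod =
      (post.map fun k => (reflR γ η a k * reflR γ η b k : SiteOp ι N R)).prod := by
  induction post with
  | nil => simp
  | cons k l ih =>
    simp only [List.mem_cons, not_or] at ha hb
    rw [List.nodup_cons] at hnd
    simp only [List.map_cons, List.prod_cons]
    rw [← ih hnd.2 ha.2 hb.2]
    have : Commute (reflR γ η b k : SiteOp ι N R) (l.map (reflR γ η a)).prod := by
      apply commute_list_prod
      intro k' hk'
      have h1 : k' ≠ k := fun h => hnd.1 (h ▸ hk')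
      have h3 : k' ≠ a := fun h => ha.2 (h ▸ hk')
      have h4 : k' ≠ b := fun h => hb.2 (h ▸ hk')
      exact (commute_reflR (commute_reflR
        (capOp_commute_capOp h3.symm hab ha.1 h4 h1 hb.1)).symm)
    rw [mul_assoc, mul_assoc, ← mul_assoc _ (reflR γ η b k), ← this.eq, mul_assoc]

/-- The rows of the product of the transposed `R`-matrices and the matrix `G` are carried through by
the antisymmetrizer of two adjacent tensor factors. -/
lemma Fused.rowProd (h2 : ∀ x : R, x + x = 0 → x = 0) (G : Matrix (Fin N) (Fin N) L)
    (hG : G.transpose = G ∨ G.transpose = -G) {γ η : ι → ι → L} {a b : ι} (hab : a ≠ b)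
    (hη : ∀ i, i ≠ a → i ≠ b → η i a - η i b = η i a * η i b)
    (hη' : ∀ i, i ≠ a → i ≠ b → η a i - η b i = η a i * η b i)
    {pre post : List ι} (hnd : (pre ++ a :: b :: post).Nodup) :
    Fused a b (TwistedYangian.rowProd (fun i => siteOp i (G.map (algebraMap L R))) (reflR γ η)
      (pre ++ a :: b :: post) : SiteOp ι N R) := by
  set H : Matrix (Fin N) (Fin N) R := G.map (algebraMap L R) with hH
  induction pre with
  | nil =>
    simp only [List.nil_append, List.nodup_cons, List.mem_cons, not_or] at hnd
    obtain ⟨⟨-, ha⟩, hb, hnd⟩ := hnd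
    rw [List.nil_append, TwistedYangian.rowProd, TwistedYangian.rowProd, List.map_cons,
      List.prod_cons]
    have c1 : Commute (siteOp b H : SiteOp ι N R) (post.map (reflR γ η a)).prod := by
      apply commute_list_prod
      intro k hk
      exact commute_reflR (siteOp_commute_capOp hab.symm (fun h => hb (h ▸ hk)) _)
    -- G_b commutes with the part of row a beyond b. The two rows therefore regroup as G_a R_ab G_b
    -- followed by the pairs R_ak R_bk, each of which is already known to be carried through.
    have e : siteOp a H * (reflR γ η a b * (post.map (reflR γ η a)).prod) *
        (siteOp b H * (post.map (reflR γ η b)).prod *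
          TwistedYangian.rowProd (fun i => siteOp i H) (reflR γ η) post) =
        γ a b • (siteOp a H * (1 - η a b • capOp a b) * siteOp b H) *
          (post.map fun k => (reflR γ η a k * reflR γ η b k : SiteOp ι N R)).prod *
          TwistedYangian.rowProd (fun i => siteOp i H) (reflR γ η) post := by
      rw [← prod_rows hab hnd ha hb]
      simp only [← mul_assoc]
      rw [mul_assoc (siteOp a H * reflR γ η a b), ← c1.eq, ← mul_assoc]
      congr 3
      simp only [reflR, smul_mul_assoc, mul_smul_comm]
    rw [e]
    refine ((((Fused.reflect hab G hG _).smul _).mul h2 (Fused.list_prod h2 ?_))).mul h2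
      (Fused.of_commute ?_)
    · intro k hk
      have hka : k ≠ a := fun h => ha (h ▸ hk)
      have hkb : k ≠ b := fun h => hb (h ▸ hk)
      simp only [reflR]
      rw [smul_mul_assoc, mul_smul_comm]
      exact ((Fused.cap_mul_cap' hka hkb hab (hη' k hka hkb)).smul _).smul _
    -- The remaining rows involve neither a nor b, so they commute with the permutation.
    · clear e c1
      induction post with
      | nil => exact Commute.one_right _
      | cons k l ih =>
        simp only [List.mem_cons, not_or, List.nodup_cons] at ha hb hnd
        rw [TwistedYangian.rowProd]
        refine ((swapOp_commute_siteOp (Ne.symm ha.1) (Ne.symm hb.1) _).mul_right ?_).mul_right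
          (ih ha.2 hb.2 hnd.2)
        apply commute_list_prod
        intro k' hk'
        exact commute_reflR (swapOp_commute_capOp (Ne.symm ha.1) (Ne.symm hb.1)
          (fun h => ha.2 (h ▸ hk')) (fun h => hb.2 (h ▸ hk')))
  | cons i pre ih =>
    rw [List.cons_append, List.nodup_cons] at hnd
    have hia : i ≠ a := fun h => hnd.1 (by simp [h])
    have hib : i ≠ b := fun h => hnd.1 (by simp [h])
    rw [List.cons_append, TwistedYangian.rowProd]
    exact ((Fused.of_commute (swapOp_commute_siteOp hia hib _)).mul h2
      (Fused.row h2 hia hib hab (hη i hia hib) hnd.2)).mul h2 (ih hnd.2)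

/-- Products of matrices in successive tensor factors. -/
lemma Fused.siteProd (h2 : ∀ x : R, x + x = 0 → x = 0) (T : ι → Matrix (Fin N) (Fin N) R)
    {a b : ι} (hab : a ≠ b) (hT : RTT (T a) (T b) (1 : L) 1 1 1)
    {pre post : List ι} (hnd : (pre ++ a :: b :: post).Nodup) :
    Fused a b (((pre ++ a :: b :: post).map fun i => siteOp i (T i)).prod : SiteOp ι N R) := by
  have hc : ∀ k, k ≠ a → k ≠ b → Fused a b (siteOp k (T k)) := fun k h1 h3 =>
    Fused.of_commute (swapOp_commute_siteOp h1 h3 _)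
  have hpre : ∀ k ∈ pre, k ≠ a ∧ k ≠ b := by
    intro k hk
    have := (List.nodup_append.1 hnd).2.2 k hk
    exact ⟨this a (by simp), this b (by simp)⟩
  have hpost : ∀ k ∈ post, k ≠ a ∧ k ≠ b := by
    intro k hk
    have := (List.nodup_append.1 hnd).2.1
    simp only [List.nodup_cons, List.mem_cons, not_or] at this
    exact ⟨fun h => this.1.2 (h ▸ hk), fun h => this.2.1 (h ▸ hk)⟩
  rw [List.map_append, List.prod_append, List.map_cons, List.map_cons, List.prod_cons,
    List.prod_cons, ← mul_assoc (siteOp a (T a))]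
  refine (Fused.list_prod h2 fun k hk => hc k (hpre k hk).1 (hpre k hk).2).mul h2
    (Fused.mul h2 ?_ (Fused.list_prod h2 fun k hk => hc k (hpost k hk).1 (hpost k hk).2))
  have := hT.mul_siteOp hab
  rw [one_smul, one_smul] at this
  exact Fused.of_intertwine this

/-- The factorization of the product of the matrices `T i * G * U i` and transposed `R`-matrices. -/
lemma rowProd_factor (G : Matrix (Fin N) (Fin N) L) (T U : ι → Matrix (Fin N) (Fin N) R)
    (γ η : ι → ι → L) (l : List ι) (hnd : l.Nodup)
    (hTU : l.Pairwise fun i j => RTT (U i).transpose (T j) (1 : L) (η i j) 1 (η i j)) :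
    (rowProd (fun i => siteOp i (T i) * siteOp i (G.map (algebraMap L R)) * siteOp i (U i))
      (reflR γ η) l : SiteOp ι N R) =
    (l.map fun i => siteOp i (T i)).prod *
      rowProd (fun i => siteOp i (G.map (algebraMap L R))) (reflR γ η) l *
      (l.map fun i => siteOp i (U i)).prod := by
  set H : Matrix (Fin N) (Fin N) R := G.map (algebraMap L R) with hH
  have hc : ∀ i j (x : R), Commute (H i j) x := fun i j x => Algebra.commutes _ _
  -- U i crosses its whole row one j at a time: the reflected relation exchanges U i and T j around
  -- R_ij, T j commutes with the later R_ik, and R_ij commutes with the later T k.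
  have key : ∀ (i : ι) (l : List ι), i ∉ l → l.Nodup →
      (∀ j ∈ l, RTT (U i).transpose (T j) (1 : L) (η i j) 1 (η i j)) →
      (siteOp i (U i) * (l.map (reflR γ η i)).prod * (l.map fun i => siteOp i (T i)).prod :
        SiteOp ι N R) =
      (l.map fun i => siteOp i (T i)).prod * (l.map (reflR γ η i)).prod * siteOp i (U i) := by
    intro i l hi hnd hR
    induction l with
    | nil => simp
    | cons j l ih =>
      simp only [List.mem_cons, not_or] at hi
      rw [List.nodup_cons] at hnd
      have ih := ih hi.2 hnd.2 fun k hk => hR k (by simp [hk])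
      simp only [List.map_cons, List.prod_cons]
      have c1 : Commute (siteOp j (T j)) (l.map (reflR γ η i : ι → SiteOp ι N R)).prod :=
        commute_list_prod fun k hk => commute_reflR
          (siteOp_commute_capOp (Ne.symm hi.1) (fun h => hnd.1 (h ▸ hk)) _)
      have c2 : Commute (reflR γ η i j : SiteOp ι N R) (l.map fun i => siteOp i (T i)).prod :=
        commute_list_prod fun k hk => (commute_reflR
          (siteOp_commute_capOp (ne_of_mem_of_not_mem hk hi.2)
            (ne_of_mem_of_not_mem hk hnd.1) _)).symm
      have r := (hR j (by simp)).reflect hi.1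
      rw [Matrix.transpose_transpose] at r
      have r' : siteOp i (U i) * reflR γ η i j * siteOp j (T j) =
          siteOp j (T j) * reflR γ η i j * siteOp i (U i) := by
        simp only [reflR, mul_smul_comm, smul_mul_assoc, r]
      calc _ = siteOp i (U i) * reflR γ η i j * ((l.map (reflR γ η i)).prod * siteOp j (T j)) *
            (l.map fun i => siteOp i (T i)).prod := by simp only [mul_assoc]
        _ = siteOp j (T j) * reflR γ η i j * (siteOp i (U i) * (l.map (reflR γ η i)).prod *
            (l.map fun i => siteOp i (T i)).prod) := by
          rw [← c1.eq, ← mul_assoc _ (siteOp j (T j)), r']; simp only [mul_assoc]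
        _ = siteOp j (T j) * (reflR γ η i j * (l.map fun i => siteOp i (T i)).prod) *
            (l.map (reflR γ η i)).prod * siteOp i (U i) := by rw [ih]; simp only [mul_assoc]
        _ = _ := by rw [c2.eq]; simp only [mul_assoc]
  induction l with
  | nil => simp [rowProd]
  | cons i l ih =>
    rw [List.pairwise_cons] at hTU
    rw [List.nodup_cons] at hnd
    rw [rowProd, rowProd, ih hnd.2 hTU.2]
    simp only [List.map_cons, List.prod_cons]
    have k1 := key i l hnd.1 hnd.2 hTU.1
    have c1 : Commute (siteOp i H : SiteOp ι N R) (l.map fun i => siteOp i (T i)).prod :=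
      commute_list_prod fun k hk => siteOp_commute_siteOp (ne_of_mem_of_not_mem hk hnd.1).symm _ _
        fun _ _ _ _ => hc _ _ _
    have c2 : Commute (siteOp i (U i)) (rowProd (fun i => siteOp i H) (reflR γ η) l) := by
      have hi := hnd.1
      clear ih hnd hTU k1 c1
      induction l with
      | nil => exact Commute.one_right _
      | cons k l ih =>
        simp only [List.mem_cons, not_or] at hi
        rw [rowProd]
        refine ((siteOp_commute_siteOp hi.1 _ _ fun _ _ _ _ => (hc _ _ _).symm).mul_right
          ?_).mul_right (ih hi.2)
        exact commute_list_prod fun k' hk' => commute_reflR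
          (siteOp_commute_capOp hi.1 (fun h => hi.2 (h ▸ hk')) _)
    calc _ = siteOp i (T i) * siteOp i H * (siteOp i (U i) * (l.map (reflR γ η i)).prod *
          (l.map fun i => siteOp i (T i)).prod) *
          rowProd (fun i => siteOp i H) (reflR γ η) l * (l.map fun i => siteOp i (U i)).prod := by
          simp only [mul_assoc]
      _ = siteOp i (T i) * (siteOp i H * (l.map fun i => siteOp i (T i)).prod) *
          (l.map (reflR γ η i)).prod * (siteOp i (U i) *
          rowProd (fun i => siteOp i H) (reflR γ η) l) * (l.map fun i => siteOp i (U i)).prod := by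
          rw [k1]; simp only [mul_assoc]
      _ = _ := by rw [c1.eq, c2.eq]; simp only [mul_assoc]

end Rows

/-! ### From adjacent antisymmetrizers to an eigenvector. -/

section Scalars

variable {N : ℕ} {L R : Type*} [CommRing L] [Ring R] [Algebra L R]

lemma finRange_split {i j : Fin N} (hij : (j : ℕ) = i + 1) :
    ∃ pre post, List.finRange N = pre ++ i :: j :: post := by
  refine ⟨(List.finRange N).take i, (List.finRange N).drop (i + 2), ?_⟩
  conv_lhs => rw [← List.take_append_drop i (List.finRange N)]
  have h1 : (i : ℕ) < (List.finRange N).length := by simp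
  have h2 : (i : ℕ) + 1 < (List.finRange N).length := by simp; omega
  rw [List.drop_eq_getElem_cons h1, List.drop_eq_getElem_cons h2]
  congr 3
  · simp
  · congr 1
    ext; simp [hij]

/-- Operators that are carried through by the antisymmetrizers of adjacent factors act by a scalar on
the alternating form. -/
lemma vecMul_altVec (h2 : ∀ x : R, x + x = 0 → x = 0) {Z : SiteOp (Fin N) N R}
    (hZ : ∀ i j : Fin N, (j : ℕ) = i + 1 → Fused i j Z) :
    ∃ d : R, Matrix.vecMul (altVec N R) Z = d • altVec N R := by
  -- The eigenvalue is the coordinate at the identity multi-index, where the alternating form equals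
  -- 1.
  refine ⟨Matrix.vecMul (altVec N R) Z id, ?_⟩
  have : IsAlt (Matrix.vecMul (altVec N R) Z) := by
    intro J i j hij
    have hne : i ≠ j := by rintro rfl; omega
    -- Ω (1 - P) = 2Ω, so being carried through says 2 Ω Z (1 + P) = 0: the row Ω Z is again
    -- alternating.
    have e1 : Matrix.vecMul (altVec N R) (1 - swapOp i j) = altVec N R + altVec N R := by
      ext J
      rw [Matrix.vecMul_sub, Matrix.vecMul_one, Pi.sub_apply, vecMul_swapOp_apply]
      simp only [altVec]
      rw [altForm_comp_swap J hne]
      simp [altVec]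
    have e2 := congrArg (Matrix.vecMul (altVec N R)) (hZ i j hij)
    rw [← Matrix.vecMul_vecMul, ← Matrix.vecMul_vecMul, e1, Matrix.vecMul_zero, Matrix.add_vecMul,
      Matrix.vecMul_add, Matrix.vecMul_one] at e2
    have e3 := congrFun e2 J
    rw [Pi.add_apply, vecMul_swapOp_apply, Pi.zero_apply, Pi.add_apply, Pi.add_apply] at e3
    rw [eq_neg_iff_add_eq_zero, add_comm]
    apply h2
    rw [← e3]
    abel
  ext J
  rw [this.eq_mul h2 J]
  rfl

end Scalars

/-! ### An auxiliary tensor factor, and commutation with quantum determinants. -/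

section Auxiliary

variable {N : ℕ} {L R : Type*} [CommRing L] [Ring R] [Algebra L R]

lemma swapOp_comm {ι : Type*} [Fintype ι] [DecidableEq ι] (a b : ι) :
    (swapOp a b : SiteOp ι N R) = swapOp b a := by
  simp only [swapOp, Equiv.swap_comm a b]

lemma vecMul_siteOp_apply {ι : Type*} [Fintype ι] [DecidableEq ι] (k : ι)
    (M : Matrix (Fin N) (Fin N) R) (v : (ι → Fin N) → R) (J : ι → Fin N) :
    Matrix.vecMul v (siteOp k M) J = ∑ p, v (Function.update J k p) * M p (J k) :=
  mul_siteOp_apply k M (Matrix.of fun _ => v) J J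

/-- The row vector `v` in the tensor factors `some i` and the basis vector `a` in the auxiliary
tensor factor `none`. -/
def auxVec (a : Fin N) (v : (Fin N → Fin N) → R) : (Option (Fin N) → Fin N) → R :=
  fun K => if K none = a then v (K ∘ some) else 0

lemma auxVec_smul (a : Fin N) (d : R) (v : (Fin N → Fin N) → R) :
    auxVec a (d • v) = d • auxVec a v := by
  ext K; simp [auxVec]

lemma update_some_comp (K : Option (Fin N) → Fin N) (i p : Fin N) :
    Function.update K (some i) p ∘ some = Function.update (K ∘ some) i p := by
  ext x
  by_cases hx : x = i
  · subst hx; simp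
  · simp [hx]

lemma auxVec_vecMul_siteOp (a i : Fin N) (v : (Fin N → Fin N) → R)
    (M : Matrix (Fin N) (Fin N) R) :
    Matrix.vecMul (auxVec a v) (siteOp (some i) M) = auxVec a (Matrix.vecMul v (siteOp i M)) := by
  ext K
  rw [vecMul_siteOp_apply]
  simp only [auxVec, update_some_comp, ne_eq, reduceCtorEq, not_false_eq_true,
    Function.update_of_ne]
  split_ifs
  · rw [vecMul_siteOp_apply]; rfl
  · simp

lemma auxVec_vecMul_prod (a : Fin N) (T : Fin N → Matrix (Fin N) (Fin N) R) (l : List (Fin N))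
    (v : (Fin N → Fin N) → R) :
    Matrix.vecMul (auxVec a v) (l.map fun i => siteOp (some i) (T i)).prod =
      auxVec a (Matrix.vecMul v (l.map fun i => siteOp i (T i)).prod) := by
  induction l generalizing v with
  | nil => simp
  | cons i l ih =>
    simp only [List.map_cons, List.prod_cons, ← Matrix.vecMul_vecMul, auxVec_vecMul_siteOp, ih]

lemma auxVec_vecMul_none (a : Fin N) (Z : Matrix (Fin N) (Fin N) R) :
    Matrix.vecMul (auxVec a (altVec N R)) (siteOp none Z) =
      ∑ p, Z a p • auxVec p (altVec N R) := by
  ext K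
  rw [vecMul_siteOp_apply, Finset.sum_apply]
  have e : ∀ p, Function.update K none p ∘ some = K ∘ some := by
    intro p; ext x; simp
  simp only [auxVec, Function.update_self, e, Pi.smul_apply, smul_eq_mul, mul_ite, mul_zero,
    ite_mul, zero_mul, Finset.sum_ite_eq, Finset.sum_ite_eq', Finset.mem_univ, if_true, altVec]
  exact (Int.cast_commute _ _).eq

lemma auxVec_vecMul_swapOp (a : Fin N) {i j : Fin N} (hij : i ≠ j) :
    Matrix.vecMul (auxVec a (altVec N R)) (swapOp (some i) (some j)) =
      -auxVec a (altVec N R) := by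
  ext K
  rw [vecMul_swapOp_apply]
  have e : (K ∘ Equiv.swap (some i) (some j)) ∘ some = (K ∘ some) ∘ Equiv.swap i j := by
    ext x
    by_cases hx : x = i
    · subst hx; simp
    · by_cases hx' : x = j
      · subst hx'; simp
      · simp [Equiv.swap_apply_of_ne_of_ne hx hx', Equiv.swap_apply_of_ne_of_ne
          (a := some i) (b := some j) (x := some x) (by simpa using hx) (by simpa using hx')]
  have e' : Equiv.swap (some i) (some j) none = none :=
    Equiv.swap_apply_of_ne_of_ne (by simp) (by simp)
  simp only [auxVec, e, Function.comp_apply, e', Pi.neg_apply, altVec, altForm_comp_swap _ hij]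
  split_ifs <;> simp

/-- P_{0i} P_{0j} = P_{ij} P_{0i}, and Ω changes sign under P_{ij}. Thus the sum of the vectors Ω
P_{0i} over the factors already passed is only rescaled by the next R-matrix. -/
lemma auxVec_vecMul_swap_swap (a : Fin N) {i j : Fin N} (hij : i ≠ j) :
    Matrix.vecMul (Matrix.vecMul (auxVec a (altVec N R)) (swapOp none (some i)))
      (swapOp none (some j)) =
      -Matrix.vecMul (auxVec a (altVec N R)) (swapOp none (some i)) := by
  ext K
  have h1 := congrFun (auxVec_vecMul_swapOp (R := R) a hij) (K ∘ Equiv.swap none (some i))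
  rw [vecMul_swapOp_apply] at h1
  rw [vecMul_swapOp_apply, vecMul_swapOp_apply, Pi.neg_apply, vecMul_swapOp_apply,
    ← Pi.neg_apply, ← h1]
  congr 1
  ext x
  simp only [Function.comp_apply]
  congr 2
  have : Equiv.swap none (some j) * Equiv.swap none (some i) =
      Equiv.swap none (some i) * Equiv.swap (some i) (some j) := by
    rw [Equiv.mul_swap_eq_swap_mul (Equiv.swap none (some i)), Equiv.swap_apply_right,
      Equiv.swap_apply_of_ne_of_ne (by simp) (by simpa using hij.symm)]
  exact congrArg (fun e : Equiv.Perm (Option (Fin N)) => e x) this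

/-- There is no alternating form in N + 1 indices with N values; expanding the vanishing
antisymmetrization along the auxiliary index gives this identity. -/
lemma sum_auxVec_vecMul_swapOp (a : Fin N) :
    ∑ i, Matrix.vecMul (auxVec a (altVec N R)) (swapOp none (some i)) = auxVec a (altVec N R) := by
  ext K
  rw [Finset.sum_apply]
  simp only [vecMul_swapOp_apply]
  have e : ∀ i, (K ∘ Equiv.swap none (some i)) ∘ some =
      Function.update (K ∘ some) i (K none) := by
    intro i; ext x
    by_cases hx : x = i
    · subst hx; simp
    · simp [hx, Equiv.swap_apply_of_ne_of_ne (a := none) (b := some i) (x := some x) (by simp)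
        (by simpa using hx)]
  simp only [auxVec, e, Function.comp_apply, Equiv.swap_apply_left, altVec]
  have := congrArg (Int.cast (R := R)) (sum_altForm_update (K ∘ some) a (K none))
  push_cast at this
  simpa only [Function.comp_apply, apply_ite (Int.cast (R := R)), Int.cast_zero] using this

/-- The operator `α - β P` in the auxiliary tensor factor and the tensor factor `i`. -/
def auxR (α β : Fin N → L) (i : Fin N) : SiteOp (Option (Fin N)) N R :=
  α i • 1 - β i • swapOp none (some i)

/-- Write Σ for the sum of the Ω P_{0i} passed so far. The factor α_k - β_k P_{0k} sends Ω to α_k Ω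
- β_k Ω P_{0k} and Σ to (α_k + β_k) Σ. The chain condition is exactly what gives Σ and the new term
Ω P_{0k} the same coefficient, so the shape persists. -/
lemma auxVec_vecMul_chain (a : Fin N) (α β : Fin N → L) (l : List (Fin N)) (k : Fin N)
    (hnd : (l ++ [k]).Nodup)
    (hch : (l ++ [k]).IsChain fun i j => β i * (α j + β j) = α i * β j) :
    Matrix.vecMul (auxVec a (altVec N R)) ((l ++ [k]).map (auxR α β)).prod =
      ((l ++ [k]).map α).prod • auxVec a (altVec N R) - ((l.map α).prod * β k) •
        ((l ++ [k]).map fun i =>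
          Matrix.vecMul (auxVec a (altVec N R)) (swapOp none (some i))).sum := by
  induction l using List.reverseRecOn generalizing k with
  | nil =>
    simp only [List.nil_append, List.map_cons, List.map_nil, List.prod_cons, List.prod_nil, mul_one,
      one_mul, List.sum_cons, List.sum_nil, add_zero, auxR, Matrix.vecMul_sub, Matrix.vecMul_smul,
      Matrix.vecMul_one]
  | append_singleton l j ih =>
    have hnd' := (List.nodup_append.1 hnd)
    have hch' := List.isChain_append.1 hch
    have hrel : β j * (α k + β k) = α j * β k := hch'.2.2 j (by simp) k (by simp)
    rw [List.map_append, List.prod_append, ← Matrix.vecMul_vecMul, ih j hnd'.1 hch'.1]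
    set Ω := auxVec a (altVec N R) with hΩ
    have e1 : Matrix.vecMul ((l ++ [j]).map fun i => Matrix.vecMul Ω (swapOp none (some i))).sum
        (swapOp none (some k)) =
        -((l ++ [j]).map fun i => Matrix.vecMul Ω (swapOp none (some i))).sum := by
      have : ∀ i ∈ l ++ [j], i ≠ k := fun i hi => hnd'.2.2 i hi k (by simp)
      generalize l ++ [j] = m at this
      induction m with
      | nil => simp
      | cons i m ih =>
        simp only [List.map_cons, List.sum_cons, Matrix.add_vecMul, neg_add]
        rw [ih fun x hx => this x (by simp [hx]),
          auxVec_vecMul_swap_swap a (this i (by simp))]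
    rw [List.map_append (l₁ := l ++ [j]), List.prod_append,
      List.map_append (l₁ := l ++ [j]), List.sum_append]
    generalize ((l ++ [j]).map fun i => Matrix.vecMul Ω (swapOp none (some i))).sum = S at e1 ⊢
    simp only [List.map_cons, List.map_nil, List.prod_cons, List.prod_nil, mul_one, auxR,
      Matrix.vecMul_sub, Matrix.vecMul_smul, Matrix.vecMul_one, Matrix.sub_vecMul,
      Matrix.smul_vecMul, e1, List.map_append, List.prod_append, List.sum_cons,
      List.sum_nil, add_zero]
    have e2 : (l.map α).prod * α j * β k = (l.map α).prod * β j * (α k + β k) := by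
      rw [mul_assoc, ← hrel]; ring
    rw [smul_add]
    nth_rewrite 1 [e2]
    module

/-- The product of the `α i` with the last factor replaced by `α i - β i`. -/
def lastProd (α β : Fin N → L) : L := ∏ i : Fin N, if (i : ℕ) + 1 = N then α i - β i else α i

/-- The product of the `α i` with the first factor replaced by `α i - β i`. -/
def firstProd (α β : Fin N → L) : L := ∏ i : Fin N, if (i : ℕ) = 0 then α i - β i else α i

/-- After all N factors the sum of the Ω P_{0i} is Ω itself, so the result is a multiple of Ω and
the last factor contributes α - β instead of α. -/
lemma auxVec_vecMul_finRange (a : Fin N) (α β : Fin N → L)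
    (hch : ∀ i j : Fin N, (j : ℕ) = i + 1 → β i * (α j + β j) = α i * β j) :
    Matrix.vecMul (auxVec a (altVec N R)) ((List.finRange N).map (auxR α β)).prod =
      lastProd α β • auxVec a (altVec N R) := by
  obtain _ | n := N
  · exact a.elim0
  · have e := List.finRange_succ_last (n := n)
    have h1 := auxVec_vecMul_chain (R := R) a α β ((List.finRange n).map Fin.castSucc) (Fin.last n)
      (by rw [← e]; exact List.nodup_finRange _) (by
        rw [← e, List.isChain_iff_getElem]
        intro i hi
        exact hch _ _ (by simp))
    rw [← e] at h1
    rw [h1, ← List.ofFn_eq_map, ← List.ofFn_eq_map (f := fun i => Matrix.vecMul _ _),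
      List.sum_ofFn, sum_auxVec_vecMul_swapOp, ← sub_smul, List.ofFn_eq_map]
    congr 1
    rw [e, List.map_append, List.prod_append, List.map_map, ← List.ofFn_eq_map, List.prod_ofFn,
      lastProd, Fin.prod_univ_castSucc, if_pos (by simp)]
    have : ∀ i : Fin n, (if ((i.castSucc : Fin (n + 1)) : ℕ) + 1 = n + 1 then
        α i.castSucc - β i.castSucc else α i.castSucc) = α i.castSucc := by
      intro i
      rw [if_neg]
      have := i.2
      simp; omega
    simp only [this]
    simp [mul_sub]

lemma auxVec_vecMul_finRange_reverse (a : Fin N) (α β : Fin N → L)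
    (hch : ∀ i j : Fin N, (j : ℕ) = i + 1 → β j * (α i + β i) = α j * β i) :
    Matrix.vecMul (auxVec a (altVec N R)) ((List.finRange N).reverse.map (auxR α β)).prod =
      firstProd α β • auxVec a (altVec N R) := by
  obtain _ | n := N
  · exact a.elim0
  · have e : (List.finRange (n + 1)).reverse =
        ((List.finRange n).map Fin.succ).reverse ++ [0] := by
      rw [List.finRange_succ, List.reverse_cons]
    have h1 := auxVec_vecMul_chain (R := R) a α β ((List.finRange n).map Fin.succ).reverse 0
      (by rw [← e]; exact List.nodup_reverse.2 (List.nodup_finRange _)) (by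
        rw [← e, List.isChain_reverse, List.isChain_iff_getElem]
        intro i hi
        exact hch _ _ (by simp))
    rw [← e] at h1
    rw [h1, List.map_reverse (f := fun i => Matrix.vecMul _ _), List.sum_reverse,
      ← List.ofFn_eq_map (f := fun i => Matrix.vecMul _ _), List.sum_ofFn, sum_auxVec_vecMul_swapOp, ← sub_smul]
    congr 1
    rw [List.map_reverse, List.map_reverse, List.prod_reverse, List.prod_reverse, List.map_map,
      ← List.ofFn_eq_map, ← List.ofFn_eq_map, List.prod_ofFn, List.prod_ofFn, firstProd,
      Fin.prod_univ_succ, Fin.prod_univ_succ, if_pos (by simp)]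
    simp only [Fin.val_succ, Nat.succ_ne_zero, if_false, Function.comp_apply]
    ring

lemma commute_auxR {i j : Fin N} (hij : i ≠ j) (α β : Fin N → L) (M : Matrix (Fin N) (Fin N) R) :
    Commute (auxR α β j) (siteOp (some i) M) := by
  unfold auxR
  exact (((Commute.one_left _).smul_left _).sub_left
    ((swapOp_commute_siteOp (by simp) (by simpa using hij) M).smul_left _))

/-- If `T i` and `Z` satisfy `RTT`-relations and the alternating form is an eigenvector of the product
of the `T i` with the eigenvalue `d`, then `d` commutes with `Z` up to a scalar. -/
theorem eigenvalue_mul_comm {T : Fin N → Matrix (Fin N) (Fin N) R} {d : R}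
    (hd : Matrix.vecMul (altVec N R) ((List.finRange N).map fun i => siteOp i (T i)).prod =
      d • altVec N R)
    (Z : Matrix (Fin N) (Fin N) R) (α β α' β' : Fin N → L)
    (hZ : ∀ i, RTT (T i) Z (α i) (β i) (α' i) (β' i))
    (hch : ∀ i j : Fin N, (j : ℕ) = i + 1 → β i * (α j + β j) = α i * β j)
    (hch' : ∀ i j : Fin N, (j : ℕ) = i + 1 → β' i * (α' j + β' j) = α' i * β' j) (a b : Fin N) :
    lastProd α β • (d * Z a b) = lastProd α' β' • (Z a b * d) := by
  have rel : ∀ i, auxR α β i * siteOp (some i) (T i) * siteOp none Z =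
      siteOp none Z * siteOp (some i) (T i) * auxR α' β' i := by
    intro i
    have := (hZ i).mul_siteOp (a := some i) (b := none) (by simp)
    rw [swapOp_comm (R := R) (some i) none, ← mul_assoc] at this
    exact this
  -- The auxiliary matrix Z crosses T_1 ⋯ T_N; an R-matrix of the auxiliary factor commutes with the
  -- T in the other sites, so all of them can be collected at the two ends.
  have key : ∀ l : List (Fin N), l.Nodup →
      (l.map (auxR α β)).prod * (l.map fun i => siteOp (some i) (T i)).prod * siteOp none Z =
      siteOp none Z * (l.map fun i => siteOp (some i) (T i)).prod * (l.map (auxR α' β')).prod := by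
    intro l hl
    induction l with
    | nil => simp
    | cons i l ih =>
      rw [List.nodup_cons] at hl
      simp only [List.map_cons, List.prod_cons]
      have c1 : Commute (siteOp (some i) (T i)) (l.map (auxR α β)).prod :=
        commute_list_prod fun k hk =>
          (commute_auxR (ne_of_mem_of_not_mem hk hl.1).symm _ _ _).symm
      have c2 : Commute (auxR α' β' i) (l.map fun i => siteOp (some i) (T i)).prod :=
        commute_list_prod fun k hk => commute_auxR (ne_of_mem_of_not_mem hk hl.1) _ _ _
      calc _ = auxR α β i * ((l.map (auxR α β)).prod * siteOp (some i) (T i)) *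
            (l.map fun i => siteOp (some i) (T i)).prod * siteOp none Z := by
            simp only [mul_assoc]
        _ = auxR α β i * siteOp (some i) (T i) * ((l.map (auxR α β)).prod *
            (l.map fun i => siteOp (some i) (T i)).prod * siteOp none Z) := by
            rw [← c1.eq]; simp only [mul_assoc]
        _ = auxR α β i * siteOp (some i) (T i) * siteOp none Z *
            ((l.map fun i => siteOp (some i) (T i)).prod * (l.map (auxR α' β')).prod) := by
            rw [ih hl.2]; simp only [mul_assoc]
        _ = siteOp none Z * siteOp (some i) (T i) * (auxR α' β' i *
            (l.map fun i => siteOp (some i) (T i)).prod) * (l.map (auxR α' β')).prod := by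
            rw [rel]; simp only [mul_assoc]
        _ = _ := by rw [c2.eq]; simp only [mul_assoc]
  have h1 := congrArg (Matrix.vecMul (auxVec a (altVec N R))) (key _ (List.nodup_finRange N))
  simp only [← Matrix.vecMul_vecMul] at h1
  rw [auxVec_vecMul_finRange a α β hch, Matrix.smul_vecMul, Matrix.smul_vecMul,
    auxVec_vecMul_prod, hd, auxVec_smul, Matrix.smul_vecMul, auxVec_vecMul_none] at h1
  simp only [Matrix.sum_vecMul, Matrix.smul_vecMul, auxVec_vecMul_prod, hd, auxVec_smul,
    auxVec_vecMul_finRange _ α' β' hch'] at h1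
  -- Evaluate at the multi-index with b in the auxiliary place and the identity in the others: the
  -- form equals 1 there, and only the basis vector b survives.
  have h2 := congrFun h1 fun o => o.elim b id
  have e : ∀ p : Fin N, auxVec p (altVec N R) (fun o => o.elim b id) = if b = p then 1 else 0 := by
    intro p
    have : (fun o : Option (Fin N) => o.elim b id) ∘ some = id := rfl
    simp [auxVec, this, altVec, altForm_id]
  simpa [Finset.sum_apply, e] using h2

/-- The analogue of `eigenvalue_mul_comm` for the `RTT`-relations with the factors in the opposite
order. -/
theorem mul_eigenvalue_comm {T : Fin N → Matrix (Fin N) (Fin N) R} {d : R}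
    (hd : Matrix.vecMul (altVec N R) ((List.finRange N).map fun i => siteOp i (T i)).prod =
      d • altVec N R)
    (Z : Matrix (Fin N) (Fin N) R) (α β α' β' : Fin N → L)
    (hZ : ∀ i, RTT Z (T i) (α i) (β i) (α' i) (β' i))
    (hch : ∀ i j : Fin N, (j : ℕ) = i + 1 → β j * (α i + β i) = α j * β i)
    (hch' : ∀ i j : Fin N, (j : ℕ) = i + 1 → β' j * (α' i + β' i) = α' j * β' i) (a b : Fin N) :
    firstProd α β • (Z a b * d) = firstProd α' β' • (d * Z a b) := by
  have rel : ∀ i, auxR α β i * siteOp none Z * siteOp (some i) (T i) =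
      siteOp (some i) (T i) * siteOp none Z * auxR α' β' i := by
    intro i
    have := (hZ i).mul_siteOp (a := none) (b := some i) (by simp)
    rw [← mul_assoc] at this
    exact this
  -- With Z to the left of the T the R-matrices accumulate in reverse order, so the exceptional
  -- factor of the eigenvalue is now the first one.
  have key : ∀ l : List (Fin N), l.Nodup →
      (l.reverse.map (auxR α β)).prod * siteOp none Z * (l.map fun i => siteOp (some i) (T i)).prod =
      (l.map fun i => siteOp (some i) (T i)).prod * siteOp none Z *
        (l.reverse.map (auxR α' β')).prod := by
    intro l hl
    induction l with
    | nil => simp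
    | cons i l ih =>
      rw [List.nodup_cons] at hl
      simp only [List.map_cons, List.prod_cons, List.reverse_cons, List.map_append,
        List.prod_append, List.map_nil, List.prod_nil, mul_one]
      have c1 : Commute (siteOp (some i) (T i)) (l.reverse.map (auxR α β)).prod :=
        commute_list_prod fun k hk =>
          (commute_auxR (ne_of_mem_of_not_mem (List.mem_reverse.1 hk) hl.1).symm _ _ _).symm
      have c2 : Commute (auxR α' β' i) (l.map fun i => siteOp (some i) (T i)).prod :=
        commute_list_prod fun k hk => commute_auxR (ne_of_mem_of_not_mem hk hl.1) _ _ _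
      calc _ = (l.reverse.map (auxR α β)).prod * (auxR α β i * siteOp none Z *
            siteOp (some i) (T i)) * (l.map fun i => siteOp (some i) (T i)).prod := by
            simp only [mul_assoc]
        _ = ((l.reverse.map (auxR α β)).prod * siteOp (some i) (T i)) * siteOp none Z *
            (auxR α' β' i * (l.map fun i => siteOp (some i) (T i)).prod) := by
            rw [rel]; simp only [mul_assoc]
        _ = siteOp (some i) (T i) * ((l.reverse.map (auxR α β)).prod * siteOp none Z *
            (l.map fun i => siteOp (some i) (T i)).prod) * auxR α' β' i := by
            rw [c2.eq, ← c1.eq]; simp only [mul_assoc]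
        _ = _ := by rw [ih hl.2]; simp only [mul_assoc]
  have h1 := congrArg (Matrix.vecMul (auxVec a (altVec N R))) (key _ (List.nodup_finRange N))
  simp only [← Matrix.vecMul_vecMul] at h1
  rw [auxVec_vecMul_finRange_reverse a α β hch, Matrix.smul_vecMul, Matrix.smul_vecMul,
    auxVec_vecMul_prod, hd, auxVec_smul, Matrix.smul_vecMul, auxVec_vecMul_none,
    Matrix.smul_vecMul] at h1
  simp only [Matrix.sum_vecMul, Matrix.smul_vecMul, auxVec_vecMul_prod, hd, auxVec_smul,
    auxVec_vecMul_finRange_reverse _ α' β' hch'] at h1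
  have h2 := congrFun h1 fun o => o.elim b id
  have e : ∀ p : Fin N, auxVec p (altVec N R) (fun o => o.elim b id) = if b = p then 1 else 0 := by
    intro p
    have : (fun o : Option (Fin N) => o.elim b id) ∘ some = id := rfl
    simp [auxVec, this, altVec, altForm_id]
  simpa [Finset.sum_apply, e] using h2

end Auxiliary

/-! ### Substitution of a central series without constant term. -/

section Subst

variable {A B : Type*} [Ring A] [Ring B]

lemma eq_X_mul_of_constantCoeff {y : PowerSeries B} (hy : constantCoeff y = 0) :
    ∃ y', y = X * y' :=
  ⟨_, by conv_lhs => rw [PowerSeries.eq_X_mul_shift_add_const y, hy, map_zero, add_zero]⟩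

lemma coeff_mul_pow_eq_zero {y : PowerSeries B} (hy : constantCoeff y = 0) (f : PowerSeries B)
    {m r : ℕ} (hmr : m < r) : coeff m (f * y ^ r) = 0 := by
  obtain ⟨y', rfl⟩ := eq_X_mul_of_constantCoeff hy
  have hX : ∀ f : PowerSeries B, Commute X f := fun f => (PowerSeries.commute_X f).symm
  rw [(hX y').mul_pow, ← mul_assoc, ← ((hX f).pow_left r).eq, mul_assoc, coeff_X_pow_mul',
    if_neg (by omega)]

/-- The map `∑ r, a r * X ^ r ↦ ∑ r, ψ (a r) * y ^ r` for a power series `y` without constant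
term. -/
def substFun (ψ : A →+* PowerSeries B) (y : PowerSeries B) (f : PowerSeries A) : PowerSeries B :=
  PowerSeries.mk fun m => ∑ r ∈ Finset.range (m + 1), coeff m (ψ (coeff r f) * y ^ r)

lemma coeff_substFun_of_le (ψ : A →+* PowerSeries B) {y : PowerSeries B}
    (hy : constantCoeff y = 0) (f : PowerSeries A) {m n : ℕ} (hmn : m ≤ n) :
    coeff m (substFun ψ y f) =
      coeff m (∑ r ∈ Finset.range (n + 1), ψ (coeff r f) * y ^ r) := by
  rw [substFun, coeff_mk, map_sum]
  refine Finset.sum_subset (fun r hr => ?_) fun r _ hr => ?_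
  · simp only [Finset.mem_range] at *; omega
  · simp only [Finset.mem_range] at hr
    exact coeff_mul_pow_eq_zero hy _ (by omega)

/-- Up to order m both substitutions can be truncated at the same length. Centrality of y brings a
term to the form ψ(ab) y^(r+s), and the pairs with r + s > m vanish because y has no constant term.
-/
lemma substFun_mul (ψ : A →+* PowerSeries B) {y : PowerSeries B} (hy : constantCoeff y = 0)
    (hc : ∀ f, Commute y f) (f g : PowerSeries A) :
    substFun ψ y (f * g) = substFun ψ y f * substFun ψ y g := by
  ext m
  have e : coeff m (substFun ψ y f * substFun ψ y g) =
      coeff m ((∑ r ∈ Finset.range (m + 1), ψ (coeff r f) * y ^ r) *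
        ∑ r ∈ Finset.range (m + 1), ψ (coeff r g) * y ^ r) := by
    rw [coeff_mul, coeff_mul]
    refine Finset.sum_congr rfl fun p hp => ?_
    have hp := Finset.HasAntidiagonal.mem_antidiagonal.1 hp
    rw [coeff_substFun_of_le ψ hy f (n := m) (by omega),
      coeff_substFun_of_le ψ hy g (n := m) (by omega)]
  rw [e, Finset.sum_mul_sum, map_sum]
  simp only [map_sum]
  rw [← Finset.sum_product']
  have e2 : ∀ r s, ψ (coeff r f) * y ^ r * (ψ (coeff s g) * y ^ s) =
      ψ (coeff r f * coeff s g) * y ^ (r + s) := by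
    intro r s
    rw [map_mul, pow_add, mul_assoc, ← mul_assoc (y ^ r), ((hc _).pow_left r).eq]
    simp only [mul_assoc]
  have e3 : ∀ n, coeff m (ψ (coeff n (f * g)) * y ^ n) =
      ∑ p ∈ Finset.HasAntidiagonal.antidiagonal n,
        coeff m (ψ (coeff p.1 f * coeff p.2 g) * y ^ n) := by
    intro n
    rw [coeff_mul n, map_sum, Finset.sum_mul, map_sum]
  simp only [e2, substFun, coeff_mk, e3]
  rw [Finset.sum_sigma']
  refine Finset.sum_of_injOn (fun p => p.2) ?_ ?_ ?_ ?_
  · rintro ⟨n, p⟩ hp ⟨n', p'⟩ hp' h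
    simp only [Finset.coe_sigma, Set.mem_sigma_iff, Finset.mem_coe,
      Finset.HasAntidiagonal.mem_antidiagonal] at hp hp'
    obtain rfl : p = p' := h
    obtain rfl : n = n' := by rw [← hp.2, ← hp'.2]
    rfl
  · rintro ⟨n, p⟩ hp
    simp only [Finset.coe_sigma, Set.mem_sigma_iff, Finset.mem_coe,
      Finset.HasAntidiagonal.mem_antidiagonal, Finset.mem_range] at hp
    simp only [Finset.coe_product, Set.mem_prod, Finset.mem_coe, Finset.mem_range]
    omega
  · intro p _ hp
    apply coeff_mul_pow_eq_zero hy
    by_contra hlt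
    exact hp ⟨⟨p.1 + p.2, p⟩, by simp; omega, rfl⟩
  · rintro ⟨n, p⟩ hp
    simp only [Finset.mem_sigma, Finset.HasAntidiagonal.mem_antidiagonal] at hp
    simp only [← hp.2]

/-- The substitution `∑ r, a r * X ^ r ↦ ∑ r, ψ (a r) * y ^ r` for a central power series `y`
without constant term. -/
def substHom (ψ : A →+* PowerSeries B) (y : PowerSeries B) (hy : constantCoeff y = 0)
    (hc : ∀ f, Commute y f) : PowerSeries A →+* PowerSeries B where
  toFun := substFun ψ y
  map_zero' := by ext m; simp [substFun]
  map_add' := fun f g => by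
    ext m
    simp only [substFun, coeff_mk, map_add, add_mul, Finset.sum_add_distrib]
  map_one' := by
    ext m
    simp only [substFun, coeff_mk]
    rw [Finset.sum_eq_single 0]
    · simp
    · intro r _ hr
      simp [coeff_one, hr]
    · simp
  map_mul' := substFun_mul ψ hy hc

variable {ψ : A →+* PowerSeries B} {y : PowerSeries B} {hy : constantCoeff y = 0}
    {hc : ∀ f, Commute y f}

lemma coeff_substHom (f : PowerSeries A) (m : ℕ) : coeff m (substHom ψ y hy hc f) =
    ∑ r ∈ Finset.range (m + 1), coeff m (ψ (coeff r f) * y ^ r) := by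
  change coeff m (substFun ψ y f) = _
  rw [substFun, coeff_mk]

@[simp]
lemma substHom_C (a : A) : substHom ψ y hy hc (C a) = ψ a := by
  ext m
  rw [coeff_substHom, Finset.sum_eq_single 0]
  · simp
  · intro r _ hr; simp [coeff_C, hr]
  · simp

@[simp]
lemma substHom_X : substHom ψ y hy hc X = y := by
  ext m
  rw [coeff_substHom]
  cases m with
  | zero => simp [hy]
  | succ m =>
    rw [Finset.sum_eq_single 1]
    · simp
    · intro r _ hr; simp [coeff_X, hr]
    · simp

/-- A substitution is determined by its values at the constants and at `X`. -/
lemma powerSeries_hom_ext {φ φ' : PowerSeries A →+* PowerSeries B} (hC : ∀ a, φ (C a) = φ' (C a))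
    (hX : φ X = φ' X) (h0 : constantCoeff (φ X) = 0) (f : PowerSeries A) : φ f = φ' f := by
  obtain ⟨y, hy⟩ := eq_X_mul_of_constantCoeff h0
  -- Splitting off the constant term leaves a factor X, whose image has no constant term; so
  -- agreement below order n improves to agreement below order n + 1.
  have key : ∀ n (f : PowerSeries A), ∀ m < n, coeff m (φ f) = coeff m (φ' f) := by
    intro n
    induction n with
    | zero => intro f m hm; omega
    | succ n ih =>
      intro f m hm
      rw [PowerSeries.eq_X_mul_shift_add_const f, map_add φ, map_add φ', map_mul φ, map_mul φ',
        ← hX, hC, hy, mul_assoc, mul_assoc, map_add, map_add]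
      congr 1
      cases m with
      | zero => simp
      | succ m =>
        rw [coeff_succ_X_mul, coeff_succ_X_mul, coeff_mul, coeff_mul]
        refine Finset.sum_congr rfl fun p hp => ?_
        have hp := Finset.HasAntidiagonal.mem_antidiagonal.1 hp
        rw [ih _ p.2 (by omega)]
  ext m
  exact key (m + 1) f m (Nat.lt_succ_self m)

lemma constantCoeff_substHom (f : PowerSeries A) (hf : constantCoeff f = 0) :
    constantCoeff (substHom ψ y hy hc f) = 0 := by
  rw [← coeff_zero_eq_constantCoeff_apply, coeff_substHom]
  simp [hf]

end Subst

/-! ### Expansions of inverse linear functions. -/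

section invLin

variable {B : Type*} [CommRing B] [Algebra ℂ B]

/-- With X = u⁻¹ one has α u + s = (α + sX)/X. Identities between expansions are verified by
clearing the units α + sX. -/
lemma invLin_mul {α : ℂ} (hα : α ≠ 0) (s : B) :
    invLin α s * (C (algebraMap ℂ B α) + C s * X) = X := by
  ext m
  rw [mul_add, map_add, coeff_mul_C, ← mul_assoc]
  cases m with
  | zero => simp [invLin]
  | succ m =>
    rw [coeff_succ_mul_X, coeff_mul_C]
    cases m with
    | zero =>
      simp only [invLin, coeff_mk, pow_zero, zero_mul, add_zero]
      rw [Algebra.smul_def, mul_one, ← map_mul, zero_add, inv_mul_cancel₀ hα, map_one, coeff_X, if_pos rfl]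
    | succ m =>
      simp only [invLin, coeff_mk, coeff_X, Algebra.smul_def]
      rw [if_neg (by omega)]
      have : algebraMap ℂ B α⁻¹ * algebraMap ℂ B α = 1 := by
        rw [← map_mul, inv_mul_cancel₀ hα, map_one]
      rw [pow_succ]
      linear_combination (algebraMap ℂ B α⁻¹ * (-(algebraMap ℂ B α⁻¹ * s)) ^ m * (-s)) * this

lemma constantCoeff_invLin (α : ℂ) (s : B) : constantCoeff (invLin α s) = 0 := by
  simp [invLin, ← coeff_zero_eq_constantCoeff_apply]

end invLin

/-! ### The functional equation of g and the normalization of the R-matrix. -/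

section Normalization

/-- The substitution `u ↦ u + t` in power series in `u⁻¹`. -/
def shiftInv (t : ℂ) : PowerSeries ℂ →+* PowerSeries ℂ :=
  substHom C (invLin 1 t) (constantCoeff_invLin _ _) fun _ => Commute.all _ _

lemma coeff_shiftInv (t : ℂ) (f : PowerSeries ℂ) (m : ℕ) : coeff m (shiftInv t f) =
    ∑ r ∈ Finset.range (m + 1), coeff m ((invLin (B := ℂ) 1 t) ^ r) * coeff r f := by
  rw [shiftInv, coeff_substHom]
  refine Finset.sum_congr rfl fun r _ => ?_
  rw [coeff_C_mul, mul_comm]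

lemma shiftInv_X (t : ℂ) : shiftInv t X * (1 + C t * X) = X := by
  have := invLin_mul (B := ℂ) (α := 1) one_ne_zero t
  simpa [shiftInv] using this

lemma isUnit_one_add_mul {B : Type*} [CommRing B] (b : B) {z : PowerSeries B}
    (hz : constantCoeff z = 0) : IsUnit (1 + C b * z) := by
  rw [isUnit_iff_constantCoeff]
  simp [hz]

lemma shiftInv_shiftInv (s t : ℂ) (f : PowerSeries ℂ) :
    shiftInv s (shiftInv t f) = shiftInv (s + t) f := by
  refine powerSeries_hom_ext (φ := (shiftInv s).comp (shiftInv t)) (φ' := shiftInv (s + t))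
    (fun a => by simp [shiftInv]) ?_ ?_ f
  · have h1 := congrArg (shiftInv s) (shiftInv_X t)
    have h2 := shiftInv_X s
    have h3 := shiftInv_X (s + t)
    have hC : shiftInv s (C t) = C t := by simp [shiftInv]
    simp only [map_mul, map_add, map_one, hC] at h1 h3
    refine (isUnit_one_add_mul (s + t) (z := (X : PowerSeries ℂ)) (by simp)).mul_left_inj.1 ?_
    simp only [map_add, RingHom.comp_apply]
    rw [h3]
    linear_combination (1 + C s * X) * h1 + (1 - C t * shiftInv s (shiftInv t X)) * h2
  · simp only [RingHom.comp_apply, shiftInv]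
    exact constantCoeff_substHom _ (by rw [substHom_X]; exact constantCoeff_invLin _ _)

/-- If f starts with a term a u^{-r}, r ≥ 1, beyond its constant term, the shift changes the
coefficient of u^{-r-1} by -r a, so a = 0 in characteristic zero. -/
lemma eq_C_of_shiftInv {f : PowerSeries ℂ} (hf : shiftInv 1 f = f) : f = C (constantCoeff f) := by
  have key : ∀ r, coeff (r + 1) f = 0 := by
    intro r
    induction r using Nat.strongRecOn with
    | ind r ih =>
      have h1 := congrArg (coeff (r + 2)) hf
      rw [coeff_shiftInv, Finset.sum_range_succ, Finset.sum_range_succ, coeff_invLin_pow_self,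
        coeff_invLin_pow_succ, Finset.sum_eq_zero] at h1
      · have h2 : ((r : ℂ) + 1) ≠ 0 := Nat.cast_add_one_ne_zero r
        have h3 : ((r : ℂ) + 1) * coeff (r + 1) f = 0 := by
          push_cast at h1
          linear_combination -h1
        exact (mul_eq_zero.1 h3).resolve_left h2
      · intro s hs
        rw [Finset.mem_range] at hs
        cases s with
        | zero => simp [coeff_one]
        | succ s => rw [ih s (by omega), mul_zero]
  ext m
  cases m with
  | zero => simp
  | succ m => rw [key]; simp [coeff_C]

variable (N : ℕ) [NeZero N]

lemma gSeries_shift : shiftInv N (gSeries N) = gSeries N * (1 - X ^ 2) := by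
  have h := (existsUnique_g N).choose_spec.1.2
  change evalInv (fun r => coeff r (gSeries N)) _ = gSeries N * _ at h
  rw [← h]
  ext m
  rw [coeff_shiftInv, evalInv, coeff_mk]
  rfl

lemma constantCoeff_gSeries : constantCoeff (gSeries N) = 1 := (existsUnique_g N).choose_spec.1.1

lemma constantCoeff_shiftInv (t : ℂ) (f : PowerSeries ℂ) :
    constantCoeff (shiftInv t f) = constantCoeff f := by
  rw [← coeff_zero_eq_constantCoeff_apply, coeff_shiftInv]
  simp

/-- `∏ g(u + k) = (1 - u⁻¹)⁻¹`, where `k = 0, …, N - 1`. -/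
theorem prod_gSeries : (∏ k ∈ Finset.range N, shiftInv k (gSeries N)) * (1 - X) = 1 := by
  set g := gSeries N with hg
  set f := ∏ k ∈ Finset.range N, shiftInv k g with hf
  have ug : IsUnit g := by
    rw [isUnit_iff_constantCoeff, hg, constantCoeff_gSeries]; exact isUnit_one
  have h0 : shiftInv 0 g = g := by
    have := shiftInv_shiftInv 0 0 g
    ext m
    rw [coeff_shiftInv, Finset.sum_eq_single m]
    · rw [coeff_invLin_pow_self, one_mul]
    · intro r hr hrm
      rw [invLin_eq, mul_pow, coeff_X_pow_mul']
      rw [if_pos (by simp at hr; omega)]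
      have : (PowerSeries.mk fun m => (-(0 : ℂ)) ^ m) = 1 := by
        ext m; cases m <;> simp [coeff_one]
      rw [this, one_pow, coeff_one, if_neg (by simp at hr; omega), zero_mul]
    · simp
  -- Telescoping: f(u + 1) g(u) and f(u) g(u + N) are the same product of N + 1 values of g.
  have h1 : shiftInv 1 f * g = f * g * (1 - X ^ 2) := by
    have e1 : shiftInv 1 f = ∏ k ∈ Finset.range N, shiftInv ((k + 1 : ℕ) : ℂ) g := by
      rw [hf, map_prod]
      refine Finset.prod_congr rfl fun k _ => ?_
      rw [shiftInv_shiftInv]; push_cast; rw [add_comm]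
    have e2 := Finset.prod_range_succ' (fun k : ℕ => shiftInv (k : ℂ) g) N
    rw [Finset.prod_range_succ, gSeries_shift, Nat.cast_zero, h0] at e2
    rw [e1, ← e2, hf]; ring
  have h2 : shiftInv 1 f = f * (1 - X ^ 2) := by
    refine ug.mul_left_inj.1 ?_
    rw [h1]; ring
  -- The solution of f(u + 1) = f(u)(1 - u⁻²) is guessed from (1 - (u + 1)⁻¹)(1 - u⁻²) = 1 - u⁻¹,
  -- which makes f(u)(1 - u⁻¹) shift invariant, hence constant.
  have h3 : shiftInv 1 (f * (1 - X)) = f * (1 - X) := by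
    have hX := shiftInv_X 1
    rw [map_one, one_mul] at hX
    refine (isUnit_one_add_mul (1 : ℂ) (z := (X : PowerSeries ℂ)) (by simp)).mul_left_inj.1 ?_
    rw [map_mul, h2, map_sub, map_one, map_one, one_mul]
    linear_combination -(f * (1 - X ^ 2)) * hX
  rw [eq_C_of_shiftInv h3, map_mul, hf, map_prod]
  simp [constantCoeff_shiftInv, hg, constantCoeff_gSeries]

variable {B : Type*} [CommRing B] [Algebra K B]

/-- The series `g(x)` for the expansion `z` of `x⁻¹`. -/
def gEval (z : PowerSeries B) : PowerSeries B :=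
  evalInv (fun r => algebraMap K B (algebraMap ℂ K (coeff r (gSeries N)))) z

/-- The substitution of `z` in power series with complex coefficients. -/
def complexSubst (z : PowerSeries B) (hz : constantCoeff z = 0) :
    PowerSeries ℂ →+* PowerSeries B :=
  substHom (C.comp ((algebraMap K B).comp (algebraMap ℂ K))) z hz fun _ => Commute.all _ _

lemma gEval_eq {z : PowerSeries B} (hz : constantCoeff z = 0) :
    gEval N z = complexSubst z hz (gSeries N) := by
  ext m
  rw [gEval, evalInv, coeff_mk, complexSubst, coeff_substHom]
  refine Finset.sum_congr rfl fun r _ => ?_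
  rw [RingHom.comp_apply, coeff_C_mul, smul_eq_mul, mul_comm]
  rfl

/-- The hypothesis says 1/z = 1/ζ + k, so substituting z amounts to shifting the argument by k and
then substituting ζ. -/
lemma complexSubst_shiftInv {z ζ : PowerSeries B} (hz : constantCoeff z = 0)
    (hζ : constantCoeff ζ = 0) (k : ℕ) (hk : z * (1 + (k : PowerSeries B) * ζ) = ζ)
    (f : PowerSeries ℂ) : complexSubst z hz f = complexSubst ζ hζ (shiftInv k f) := by
  refine powerSeries_hom_ext (φ := complexSubst z hz)
    (φ' := (complexSubst ζ hζ).comp (shiftInv k)) (fun a => by simp [complexSubst, shiftInv])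
    ?_ ?_ f
  · have h1 := congrArg (complexSubst ζ hζ) (shiftInv_X k)
    have hX : complexSubst ζ hζ X = ζ := by simp [complexSubst]
    have hC : complexSubst ζ hζ (C (k : ℂ)) = (k : PowerSeries B) := by simp
    have hX' : complexSubst z hz X = z := by simp [complexSubst]
    have e : (k : PowerSeries B) = C (k : B) := by simp
    rw [map_mul, map_add, map_one, map_mul, hX, hC] at h1
    refine (isUnit_one_add_mul (k : B) hζ).mul_left_inj.1 ?_
    rw [hX', ← e, RingHom.comp_apply, h1]
    exact hk
  · simp [complexSubst, hz]

/-- The normalization of the `R`-matrix. -/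
theorem prod_gEval (z : Fin N → PowerSeries B) (hz : ∀ i, constantCoeff (z i) = 0)
    (hch : ∀ i j : Fin N, (j : ℕ) = i + 1 → z i * (1 + z j) = z j) :
    lastProd (fun i => gEval N (z i)) (fun i => gEval N (z i) * z i) = 1 := by
  obtain ⟨n, hn⟩ : ∃ n, N = n + 1 := ⟨N - 1, by have := NeZero.ne N; omega⟩
  set l : Fin N := ⟨n, by omega⟩ with hl
  set ζ := z l with hζ
  -- Iterating the chain relation gives 1/z_i = 1/ζ + (n - i): the arguments form a string of N
  -- consecutive shifts that starts at the last one.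
  have key : ∀ k : ℕ, ∀ i : Fin N, (i : ℕ) + k = n → z i * (1 + (k : PowerSeries B) * ζ) = ζ := by
    intro k
    induction k with
    | zero =>
      intro i hi
      have : i = l := Fin.ext (by simpa using hi)
      simp [this, hζ]
    | succ k ih =>
      intro i hi
      have h1 := ih ⟨i + 1, by omega⟩ (by simp; omega)
      have h2 := hch i ⟨i + 1, by omega⟩ rfl
      push_cast
      linear_combination (1 - z i) * h1 + (1 + (k : PowerSeries B) * ζ) * h2
  have e1 : ∀ i : Fin N, gEval N (z i) =
      complexSubst ζ (hz l) (shiftInv ((n - i : ℕ) : ℂ) (gSeries N)) := by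
    intro i
    rw [gEval_eq N (hz i), complexSubst_shiftInv (hz i) (hz l) (n - i) (key _ _ (by omega))]
  -- The exceptional last factor supplies 1 - ζ, which cancels the value (1 - ζ)⁻¹ of the product of
  -- the g.
  have e2 : lastProd (fun i => gEval N (z i)) (fun i => gEval N (z i) * z i) =
      (∏ i : Fin N, gEval N (z i)) * ∏ i : Fin N, (if i = l then 1 - z i else 1) := by
    rw [lastProd, ← Finset.prod_mul_distrib]
    refine Finset.prod_congr rfl fun i _ => ?_
    have : (i : ℕ) + 1 = N ↔ i = l := by rw [Fin.ext_iff, hl]; simp; omega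
    by_cases h : i = l
    · rw [if_pos (this.2 h), if_pos h]; ring
    · rw [if_neg (fun g => h (this.1 g)), if_neg h, mul_one]
  have e3 : (∏ i : Fin N, gEval N (z i)) =
      complexSubst ζ (hz l) (∏ k ∈ Finset.range N, shiftInv k (gSeries N)) := by
    rw [← Finset.prod_range_reflect, map_prod, Finset.prod_range]
    refine Finset.prod_congr rfl fun i _ => ?_
    rw [e1, show N - 1 - (i : ℕ) = n - i by omega]
  rw [e2, e3, Finset.prod_ite_eq' Finset.univ l, if_pos (Finset.mem_univ _)]
  have e4 : 1 - z l = complexSubst ζ (hz l) (1 - X) := by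
    rw [map_sub, map_one]; simp [complexSubst, hζ]
  rw [e4, ← map_mul, prod_gSeries, map_one]

theorem prod_gEval_reverse (z : Fin N → PowerSeries B) (hz : ∀ i, constantCoeff (z i) = 0)
    (hch : ∀ i j : Fin N, (j : ℕ) = i + 1 → z j * (1 + z i) = z i) :
    firstProd (fun i => gEval N (z i)) (fun i => gEval N (z i) * z i) = 1 := by
  rw [← prod_gEval N (fun i => z i.rev) (fun i => hz _) fun i j hij =>
    hch _ _ (by simp only [Fin.val_rev]; omega), firstProd, lastProd,
    ← Equiv.prod_comp Fin.revPerm]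
  refine Finset.prod_congr rfl fun i _ => ?_
  have : ((Fin.revPerm i : Fin N) : ℕ) = 0 ↔ (i : ℕ) + 1 = N := by
    simp only [Fin.revPerm_apply, Fin.val_rev]; omega
  simp only [this]
  rfl

end Normalization

/-! ### Power series as algebras over scalar series; cancellation. -/

section Scalars

variable {L A : Type*} [CommRing L] [Ring A] [Algebra L A]

lemma map_algebraMap_commutes (f : PowerSeries L) (x : PowerSeries A) :
    PowerSeries.map (algebraMap L A) f * x = x * PowerSeries.map (algebraMap L A) f := by
  ext m
  simp only [coeff_mul, coeff_map]
  rw [← Finset.Nat.sum_antidiagonal_swap]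
  refine Finset.sum_congr rfl fun p _ => ?_
  simp [Algebra.commutes]

instance powerSeriesAlgebra : Algebra (PowerSeries L) (PowerSeries A) :=
  (PowerSeries.map (algebraMap L A)).toAlgebra' map_algebraMap_commutes

lemma algebraMap_powerSeries (f : PowerSeries L) :
    algebraMap (PowerSeries L) (PowerSeries A) f = PowerSeries.map (algebraMap L A) f := rfl

lemma powerSeries_smul_def (f : PowerSeries L) (x : PowerSeries A) :
    f • x = PowerSeries.map (algebraMap L A) f * x := rfl

/-- The lowest nonvanishing coefficient of x would be annihilated by the constant term of the
scalar. -/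
lemma smul_eq_zero_of_constantCoeff {a : PowerSeries L}
    (ha : ∀ x : A, constantCoeff a • x = 0 → x = 0) (x : PowerSeries A) (hx : a • x = 0) :
    x = 0 := by
  ext m
  induction m using Nat.strongRecOn with
  | ind m ih =>
    apply ha
    have h1 := congrArg (coeff m) hx
    rw [powerSeries_smul_def, coeff_mul, Finset.sum_eq_single (0, m)] at h1
    · simpa [Algebra.smul_def] using h1
    · intro p hp hne
      have hp := Finset.HasAntidiagonal.mem_antidiagonal.1 hp
      rw [ih p.2, map_zero, mul_zero]
      by_contra hlt
      exact hne (Prod.ext (by simp; omega) (by simp; omega))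
    · simp

lemma smul_eq_zero_of_prod {ι : Type*} {s : Finset ι} {a : ι → L}
    (ha : ∀ i ∈ s, ∀ x : A, a i • x = 0 → x = 0) (x : A) (hx : (∏ i ∈ s, a i) • x = 0) : x = 0 := by
  classical
  induction s using Finset.induction_on with
  | empty => simpa using hx
  | insert i s hi ih =>
    rw [Finset.prod_insert hi, mul_smul] at hx
    exact ih (fun j hj => ha j (Finset.mem_insert_of_mem hj))
      (ha i (Finset.mem_insert_self _ _) _ hx)

lemma smul_eq_zero_of_isUnit {a : L} (ha : IsUnit a) (x : A) (hx : a • x = 0) : x = 0 :=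
  (IsUnit.smul_eq_zero ha).1 hx

/-- The defining relations come with cleared denominators; this cancels them again once the
multiplier acts injectively. -/
lemma RTT.of_smul {N : ℕ} {M M' : Matrix (Fin N) (Fin N) A} {α β α' β' : L} (a : L)
    (ha : ∀ x : A, a • x = 0 → x = 0) (hM : RTT M M' (a * α) (a * β) (a * α') (a * β')) :
    RTT M M' α β α' β' := by
  intro i j k l
  rw [← sub_eq_zero]
  apply ha
  have := sub_eq_zero.2 (hM i j k l)
  simp only [mul_smul] at this
  simpa only [smul_sub] using this

lemma RTT.congr {N : ℕ} {M M' : Matrix (Fin N) (Fin N) A} {α β α' β' : L} {γ δ γ' δ' : L}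
    (hM : RTT M M' α β α' β') (h1 : algebraMap L A α = algebraMap L A γ)
    (h2 : algebraMap L A β = algebraMap L A δ) (h3 : algebraMap L A α' = algebraMap L A γ')
    (h4 : algebraMap L A β' = algebraMap L A δ') : RTT M M' γ δ γ' δ' := by
  intro i j k l
  have := hM i j k l
  simpa only [Algebra.smul_def, h1, h2, h3, h4] using this

end Scalars

/-! ### Partial fractions for the expansions. -/

section invLin

variable {B : Type*} [CommRing B] [Algebra ℂ B]

lemma isUnit_linear {α : ℂ} (hα : α ≠ 0) (s : B) :
    IsUnit (C (algebraMap ℂ B α) + C s * X : PowerSeries B) := by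
  rw [isUnit_iff_constantCoeff]
  simpa using (IsUnit.mk0 α hα).map (algebraMap ℂ B)

/-- The resolvent identity. For arguments that differ by h it is the source of all chain conditions.
-/
lemma invLin_sub {α : ℂ} (hα : α ≠ 0) (s s' : B) :
    invLin α s - invLin α s' = C (s' - s) * (invLin α s * invLin α s') := by
  have h1 := invLin_mul hα s
  have h2 := invLin_mul hα s'
  refine (isUnit_linear hα s).mul_left_inj.1 ((isUnit_linear hα s').mul_left_inj.1 ?_)
  rw [map_sub]
  set x := invLin α s
  set y := invLin α s'
  linear_combination (C (algebraMap ℂ B α) + C s' * X - (C s' - C s) * y * (C (algebraMap ℂ B α) + C s' * X) ) * h1 +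
    (-(C (algebraMap ℂ B α) + C s * X) - (C s' - C s) * X) * h2

lemma eq_invLin {α : ℂ} (hα : α ≠ 0) {s : B} {y : PowerSeries B}
    (hy : y * (C (algebraMap ℂ B α) + C s * X) = X) : y = invLin α s :=
  (isUnit_linear hα s).mul_left_inj.1 (hy.trans (invLin_mul hα s).symm)

end invLin

/-! ### The defining relations under arbitrary evaluations. -/

section Relations

variable {N : ℕ} [NeZero N] {c : ℂ} {A : Type*} [Ring A] [Algebra K A]

lemma map_relTplus {A' : Type*} [Ring A'] [Algebra K A'] (φ : A →ₐ[K] A') (t : Gen N → A) :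
    (relTplus t).map (biMap φ) = relTplus (fun x => φ (t x)) := by
  simp only [relTplus, Matrix.map_sub _ (map_sub (biMap φ)), Matrix.map_mul, map_site1, map_site2,
    map_scalMat, map_Tplus]

lemma relTplus_eq_zero : relTplus (tGen (N := N) (c := c)) = 0 := by
  have := map_relTplus (toDY (N := N) (c := c)) (FreeAlgebra.ι K)
  rw [show (fun x => toDY (c := c) (FreeAlgebra.ι K x)) = tGen (N := N) (c := c) from rfl] at this
  rw [← this]
  ext a b m n
  rw [Matrix.map_apply, coeff_biMap, Matrix.zero_apply, map_zero, map_zero, toDY_eq_zero]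
  refine ⟨0, ?_⟩
  rw [pow_zero, one_smul]
  exact TwoSidedIdeal.subset_span ⟨_, a, b, m, n, Or.inr (Or.inl rfl), rfl⟩

lemma site1_mul_site2_apply (M M' : Matrix (Fin N) (Fin N) (PowerSeries A)) (a b : Fin N × Fin N) :
    (site1 M * site2 M') a b = PowerSeries.map C (M a.1 b.1) * C (M' a.2 b.2) := by
  rw [Matrix.mul_apply, Fintype.sum_prod_type]
  simp [site1, site2, Matrix.one_apply]

lemma site2_mul_site1_apply (M M' : Matrix (Fin N) (Fin N) (PowerSeries A)) (a b : Fin N × Fin N) :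
    (site2 M' * site1 M) a b = C (M' a.2 b.2) * PowerSeries.map C (M a.1 b.1) := by
  rw [Matrix.mul_apply, Fintype.sum_prod_type]
  simp [site1, site2, Matrix.one_apply]

variable {L R : Type*} [CommRing L] [Ring R] [Algebra L R]

/-- A relation between matrices of power series in two variables implies the relation between the
images of their entries. -/
lemma rtt_of_relation (Φ : Bi A →+* R) {M M' : Matrix (Fin N) (Fin N) (PowerSeries A)}
    {f g f' g' : Bi K}
    (hrel : (f • 1 - g • permMat (Bi K) : Matrix (Fin N × Fin N) (Fin N × Fin N) (Bi K)).map (scal A)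
      * site1 M * site2 M' - site2 M' * site1 M *
      (f' • 1 - g' • permMat (Bi K) : Matrix (Fin N × Fin N) (Fin N × Fin N) (Bi K)).map (scal A) = 0)
    {α β α' β' : L} (hα : algebraMap L R α = Φ (scal A f)) (hβ : algebraMap L R β = Φ (scal A g))
    (hα' : algebraMap L R α' = Φ (scal A f')) (hβ' : algebraMap L R β' = Φ (scal A g')) :
    RTT (M.map fun x => Φ (PowerSeries.map C x)) (M'.map fun x => Φ (C x)) α β α' β' := by
  intro i j k l
  have key := congrFun (congrFun hrel (i, k)) (j, l)
  rw [Matrix.sub_apply, Matrix.mul_assoc, permMat_map_mul, mul_permMat_map, scal_comm f',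
    scal_comm g', site1_mul_site2_apply, site1_mul_site2_apply, site2_mul_site1_apply,
    site2_mul_site1_apply, Matrix.zero_apply, sub_eq_zero] at key
  have := congrArg Φ key
  simpa only [map_sub, map_mul, Algebra.smul_def, hα, hβ, hα', hβ', Matrix.map_apply] using this

lemma rtt_Tmat (Φ : Bi (DY N c) →+* R) {α β : L}
    (hα : algebraMap L R α = Φ (scal _ (vb - va)))
    (hβ : algebraMap L R β = Φ (scal _ (va * vb * C (C h)))) :
    RTT ((Tmat tGen).map fun x => Φ (PowerSeries.map C x))
      ((Tmat tGen).map fun x => Φ (C x)) α β α β :=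
  rtt_of_relation Φ (relT_eq_zero (N := N) (c := c)) hα hβ hα hβ

lemma rtt_Tplus (Φ : Bi (DY N c) →+* R) {α β : L}
    (hα : algebraMap L R α = Φ (scal _ (va - vb)))
    (hβ : algebraMap L R β = Φ (scal _ (C (C h)))) :
    RTT ((Tplus tGen).map fun x => Φ (PowerSeries.map C x))
      ((Tplus tGen).map fun x => Φ (C x)) α β α β :=
  rtt_of_relation Φ (relTplus_eq_zero (N := N) (c := c)) hα hβ hα hβ

lemma Rbar_eq {B : Type*} [CommRing B] [Algebra K B] (y : PowerSeries B) :
    Rbar (N := N) y = gEval N (C (algebraMap K B h) * y) • 1 -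
      (gEval N (C (algebraMap K B h) * y) * (C (algebraMap K B h) * y)) •
        permMat (PowerSeries B) := by
  rw [Rbar, smul_sub, smul_smul]; rfl

lemma rtt_mixed (Φ : Bi (DY N c) →+* R) {γ ζ γ' ζ' : L}
    (hγ : algebraMap L R γ = Φ (scal _ (gEval N (hBi * invLin 1 (-X + C ((c / 2) • h))))))
    (hζ : algebraMap L R ζ = Φ (scal _ (hBi * invLin 1 (-X + C ((c / 2) • h)))))
    (hγ' : algebraMap L R γ' = Φ (scal _ (gEval N (hBi * invLin 1 (-X - C ((c / 2) • h))))))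
    (hζ' : algebraMap L R ζ' = Φ (scal _ (hBi * invLin 1 (-X - C ((c / 2) • h))))) :
    RTT ((Tmat tGen).map fun x => Φ (PowerSeries.map C x))
      ((Tplus tGen).map fun x => Φ (C x)) γ (γ * ζ) γ' (γ' * ζ') := by
  have h1 := relMixed_eq_zero (N := N) (c := c)
  unfold relMixed at h1
  rw [Rbar_eq, Rbar_eq] at h1
  refine rtt_of_relation Φ h1 hγ ?_ hγ' ?_
  · rw [map_mul, hγ, hζ, ← map_mul, ← map_mul]; rfl
  · rw [map_mul, hγ', hζ', ← map_mul, ← map_mul]; rfl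

end Relations

/-! ### Naturality of the values of g. -/

section Naturality

variable (N : ℕ) [NeZero N] {B R : Type*} [CommRing B] [Algebra K B] [Ring R]

/-- The value of `g` depends only on the image of the argument. -/
lemma gEval_natural {B' : Type*} [CommRing B'] [Algebra K B'] (φ : PowerSeries B →+* PowerSeries R)
    (φ' : PowerSeries B' →+* PowerSeries R) {z : PowerSeries B} {z' : PowerSeries B'}
    (hz : constantCoeff z = 0) (hz' : constantCoeff z' = 0)
    (hC : ∀ k : K, φ (C (algebraMap K B k)) = φ' (C (algebraMap K B' k))) (hzz : φ z = φ' z')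
    (h0 : constantCoeff (φ z) = 0) : φ (gEval N z) = φ' (gEval N z') := by
  rw [gEval_eq N hz, gEval_eq N hz']
  refine powerSeries_hom_ext (φ := φ.comp (complexSubst z hz)) (φ' := φ'.comp (complexSubst z' hz'))
    (fun a => ?_) ?_ ?_ _
  · simpa [complexSubst] using hC (algebraMap ℂ K a)
  · simpa [complexSubst] using hzz
  · simpa [complexSubst] using h0

end Naturality

/-! ### Eigenvectors under ring homomorphisms; quantum determinants. -/

section Transport

variable {N : ℕ} {R R' : Type*} [Ring R] [Ring R'] (φ : R →+* R')

lemma siteOp_map {ι : Type*} [Fintype ι] [DecidableEq ι] (k : ι) (M : Matrix (Fin N) (Fin N) R) :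
    (siteOp k M).map φ = siteOp k (M.map φ) := by
  ext I J
  simp only [siteOp, Matrix.map_apply, Matrix.of_apply]
  split_ifs <;> simp

lemma list_prod_map {ι κ : Type*} [Fintype ι] [DecidableEq ι] (l : List κ) (f : κ → Matrix ι ι R) :
    (l.map f).prod.map φ = (l.map fun k => (f k).map φ).prod := by
  have := map_list_prod φ.mapMatrix (l.map f)
  rw [List.map_map] at this
  exact this

lemma vecMul_altVec_map {Z : SiteOp (Fin N) N R} {d : R}
    (hZ : Matrix.vecMul (altVec N R) Z = d • altVec N R) :
    Matrix.vecMul (altVec N R') (Z.map φ) = φ d • altVec N R' := by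
  have e : φ ∘ altVec N R = altVec N R' := by
    ext J; simp [altVec]
  ext J
  rw [← e, ← RingHom.map_vecMul, hZ]
  simp

lemma vecMul_siteProd_map {T : Fin N → Matrix (Fin N) (Fin N) R} {d : R}
    (hd : Matrix.vecMul (altVec N R) ((List.finRange N).map fun i => siteOp i (T i)).prod =
      d • altVec N R) :
    Matrix.vecMul (altVec N R') ((List.finRange N).map fun i => siteOp i ((T i).map φ)).prod =
      φ d • altVec N R' := by
  have := vecMul_altVec_map φ hd
  rw [list_prod_map] at this
  simpa only [siteOp_map] using this

lemma eq_zero_of_add_self (hu : IsUnit (2 : R)) (x : R) (hx : x + x = 0) : x = 0 := by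
  rw [← two_mul] at hx
  exact (hu.mul_right_eq_zero).1 hx

/-- This is the quantum determinant: between neighbouring factors the R-matrix is 1 - P, which the
ordered product intertwines with 1 - P. -/
lemma exists_eigenvalue {L : Type*} [CommRing L] [Algebra L R] (hu : IsUnit (2 : R))
    (T : Fin N → Matrix (Fin N) (Fin N) R)
    (hT : ∀ i j : Fin N, (j : ℕ) = i + 1 → RTT (T i) (T j) (1 : L) 1 1 1) :
    ∃ d : R, Matrix.vecMul (altVec N R) ((List.finRange N).map fun i => siteOp i (T i)).prod =
      d • altVec N R := by
  refine vecMul_altVec (eq_zero_of_add_self hu) fun i j hij => ?_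
  obtain ⟨pre, post, hl⟩ := finRange_split hij
  have hnd := List.nodup_finRange N
  rw [hl] at hnd ⊢
  exact Fused.siteProd (eq_zero_of_add_self hu) T (by rintro rfl; omega) (hT i j hij) hnd

end Transport

/-! ### Commuting with the generators. -/

section Center

variable {N : ℕ} [NeZero N] {c : ℂ} {R : Type*} [Ring R]

/-- The entries of T and T⁺ only give h times the generators; since h is not a zero divisor in the
target, it can be cancelled in the commutators. -/
lemma commute_of_commute_coeff (ι : DY N c →+* R)
    (hh : ∀ z : R, ι (algebraMap K _ h) * z = 0 → z = 0) {d : R}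
    (hK : ∀ k : K, Commute d (ι (algebraMap K _ k)))
    (hT : ∀ i j r, Commute d (ι (coeff r (Tmat tGen i j))))
    (hTp : ∀ i j r, Commute d (ι (coeff r (Tplus tGen i j)))) (x : DY N c) : Commute d (ι x) := by
  have key : ∀ t : DY N c, Commute d (ι (h • t)) → Commute d (ι t) := by
    intro t ht
    rw [Algebra.smul_def, map_mul] at ht
    rw [commute_iff_eq, ← sub_eq_zero]
    apply hh
    rw [mul_sub, ← mul_assoc, ← (hK h).eq, mul_assoc, ht.eq, mul_assoc, sub_self]
  obtain ⟨x, rfl⟩ := toDY_surjective x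
  induction x using FreeAlgebra.induction with
  | grade0 k => rw [AlgHom.commutes]; exact hK k
  | grade1 x =>
    change Commute d (ι (tGen x))
    apply key
    cases x with
    | pos i j r => simpa [Tmat] using hT i j (r + 1)
    | neg i j r =>
      have h1 : Commute d (ι (if i = j ∧ r = 0 then 1 else 0)) := by
        split_ifs <;> simp
      have h2 := h1.sub_right (hTp i j r)
      rw [← map_sub] at h2
      simpa [Tplus] using h2
  | mul x y hx hy => rw [map_mul, map_mul]; exact hx.mul_right hy
  | add x y hx hy => rw [map_add, map_add]; exact hx.add_right hy

end Center

/-! ### Affine substitutions in series in u⁻¹. -/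

section Evaluation

variable {B A : Type*} [CommRing B] [Algebra ℂ B] [Ring A] [Algebra B A]

lemma commute_map_algebraMap (f : PowerSeries B) (x : PowerSeries A) :
    Commute (PowerSeries.map (algebraMap B A) f) x := map_algebraMap_commutes f x

/-- The substitution `u ↦ α u + s` in power series in `u⁻¹`. -/
def evLin (A : Type*) [Ring A] [Algebra B A] (α : ℂ) (s : B) : PowerSeries A →+* PowerSeries A :=
  substHom C (PowerSeries.map (algebraMap B A) (invLin α s))
    (by rw [← coeff_zero_eq_constantCoeff_apply, coeff_map, coeff_zero_eq_constantCoeff_apply,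
      constantCoeff_invLin, map_zero])
    (commute_map_algebraMap _)

@[simp]
lemma evLin_C (α : ℂ) (s : B) (a : A) : evLin A α s (C a) = C a := by simp [evLin]

@[simp]
lemma evLin_X (α : ℂ) (s : B) :
    evLin A α s X = PowerSeries.map (algebraMap B A) (invLin α s) := by simp [evLin]

lemma constantCoeff_map_invLin (α : ℂ) (s : B) :
    constantCoeff (PowerSeries.map (algebraMap B A) (invLin α s)) = 0 := by
  rw [← coeff_zero_eq_constantCoeff_apply, coeff_map, coeff_zero_eq_constantCoeff_apply,
      constantCoeff_invLin, map_zero]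

lemma evLin_map (α : ℂ) (s : B) (f : PowerSeries B) :
    evLin A α s (PowerSeries.map (algebraMap B A) f) =
      PowerSeries.map (algebraMap B A) (evLin B α s f) := by
  refine powerSeries_hom_ext (φ := (evLin A α s).comp (PowerSeries.map (algebraMap B A)))
    (φ' := (PowerSeries.map (algebraMap B A)).comp (evLin B α s)) (fun b => ?_) ?_ ?_ f
  · simp
  · simp
  · simp [constantCoeff_map_invLin]

lemma evLin_invLin {α α' : ℂ} (hα : α ≠ 0) (hα' : α' ≠ 0) (s t : B) :
    evLin B α s (invLin α' t) = invLin (α' * α) (α' • s + t) := by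
  apply eq_invLin (mul_ne_zero hα' hα)
  have h1 := congrArg (evLin B α s) (invLin_mul hα' t)
  have h2 := invLin_mul hα s
  have h3 : PowerSeries.map (RingHom.id B) (invLin α s) = invLin α s := by ext; simp
  simp only [map_mul, map_add, evLin_C, evLin_X, Algebra.algebraMap_self, h3] at h1
  simp only [Algebra.smul_def, map_add, map_mul]
  linear_combination (C (algebraMap ℂ B α) + C s * X) * h1 +
    (1 - C t * evLin B α s (invLin α' t)) * h2

lemma evLin_evLin {α α' : ℂ} (hα : α ≠ 0) (hα' : α' ≠ 0) (s t : B) (f : PowerSeries A) :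
    evLin A α s (evLin A α' t f) = evLin A (α' * α) (α' • s + t) f := by
  refine powerSeries_hom_ext (φ := (evLin A α s).comp (evLin A α' t))
    (φ' := evLin A (α' * α) (α' • s + t)) (fun b => ?_) ?_ ?_ f
  · simp
  · simp only [RingHom.comp_apply, evLin_X]
    rw [evLin_map, evLin_invLin hα hα']
  · simp only [RingHom.comp_apply, evLin_X]
    rw [evLin_map, evLin_invLin hα hα', constantCoeff_map_invLin]

lemma evalInv_eq_evLin (α : ℂ) (s : B) (f : PowerSeries A) :
    evalInv (fun r => coeff r f) (invLin α s) = evLin A α s f := by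
  ext m
  rw [evalInv, coeff_mk, evLin, coeff_substHom]
  refine Finset.sum_congr rfl fun r _ => ?_
  rw [← map_pow, coeff_C_mul, coeff_map, Algebra.smul_def, Algebra.commutes]

/-- The evaluation of a power series in two variables at `α u + s` and `α' u + s'`. -/
def evLin₂ (A : Type*) [Ring A] [Algebra B A] (α : ℂ) (s : B) (α' : ℂ) (s' : B) :
    Bi A →+* PowerSeries A :=
  substHom (evLin A α' s') (PowerSeries.map (algebraMap B A) (invLin α s))
    (constantCoeff_map_invLin _ _) (commute_map_algebraMap _)

@[simp]
lemma evLin₂_C (α : ℂ) (s : B) (α' : ℂ) (s' : B) (f : PowerSeries A) :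
    evLin₂ A α s α' s' (C f) = evLin A α' s' f := by simp [evLin₂]

@[simp]
lemma evLin₂_X (α : ℂ) (s : B) (α' : ℂ) (s' : B) :
    evLin₂ A α s α' s' X = PowerSeries.map (algebraMap B A) (invLin α s) := by simp [evLin₂]

lemma evLin₂_map (α : ℂ) (s : B) (α' : ℂ) (s' : B) (f : PowerSeries A) :
    evLin₂ A α s α' s' (PowerSeries.map C f) = evLin A α s f := by
  refine powerSeries_hom_ext (φ := (evLin₂ A α s α' s').comp (PowerSeries.map C))
    (φ' := evLin A α s) (fun b => ?_) ?_ ?_ f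
  · simp
  · simp
  · simp [constantCoeff_map_invLin]

end Evaluation

/-! ### Quantum determinants of T(u). -/

section NegativeHalf

lemma map_invLin {B B' : Type*} [CommRing B] [Algebra ℂ B] [CommRing B'] [Algebra ℂ B']
    (φ : B →+* B') (hφ : ∀ z : ℂ, φ (algebraMap ℂ B z) = algebraMap ℂ B' z) {α : ℂ} (hα : α ≠ 0)
    (s : B) : PowerSeries.map φ (invLin α s) = invLin α (φ s) := by
  apply eq_invLin hα
  have := congrArg (PowerSeries.map φ) (invLin_mul hα s)
  simpa [hφ] using this

variable {N : ℕ} [NeZero N] {c : ℂ}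

/-- The matrix `T(α u + s)`. -/
def negT (N : ℕ) [NeZero N] (c α : ℂ) (s : K) : Matrix (Fin N) (Fin N) (PowerSeries (DY N c)) :=
  (Tmat tGen).map (evLin (DY N c) α s)

lemma h_smul_powerSeries (x : PowerSeries (DY N c)) (hx : (C h : PowerSeries K) • x = 0) :
    x = 0 := by
  refine smul_eq_zero_of_constantCoeff (fun x hx => ?_) x hx
  simp only [constantCoeff_C] at hx
  exact h_smul_eq_zero hx

lemma X_smul_powerSeries {L A : Type*} [CommRing L] [Ring A] [Algebra L A] (x : PowerSeries A)
    (hx : (X : PowerSeries L) • x = 0) : x = 0 := by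
  rw [powerSeries_smul_def, PowerSeries.map_X] at hx
  ext m
  have := congrArg (coeff (m + 1)) hx
  rwa [coeff_succ_X_mul] at this

lemma invLin_smul_powerSeries {L A : Type*} [CommRing L] [Algebra ℂ L] [Ring A] [Algebra L A]
    {α : ℂ} (hα : α ≠ 0) (s : L) (x : PowerSeries A) (hx : invLin α s • x = 0) : x = 0 := by
  apply X_smul_powerSeries (L := L)
  rw [← invLin_mul hα s, mul_comm, mul_smul, hx, smul_zero]

lemma rtt_negT (α α' : ℂ) (s s' : K) :
    RTT (negT N c α s) (negT N c α' s') (invLin α' s' - invLin α s)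
      (invLin α s * invLin α' s' * C h) (invLin α' s' - invLin α s)
      (invLin α s * invLin α' s' * C h) := by
  have := rtt_Tmat (N := N) (c := c) (evLin₂ (DY N c) α s α' s')
    (α := invLin α' s' - invLin α s) (β := invLin α s * invLin α' s' * C h)
    (by simp [scal, algebraMap_powerSeries]) (by simp [scal, algebraMap_powerSeries])
  simp only [evLin₂_map, evLin₂_C] at this
  exact this

/-- The two arguments differ by h, so that R(h) = 1 - P after the nonzero divisor h/((αu + s)(αu +
s')) is cancelled. -/
lemma rtt_negT_adjacent {α : ℂ} (hα : α ≠ 0) {s s' : K} (hs : s - s' = h) :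
    RTT (negT N c α s) (negT N c α s') (1 : PowerSeries K) 1 1 1 := by
  have h1 := rtt_negT (N := N) (c := c) α α s s'
  have e : invLin α s' - invLin α s = invLin α s * invLin α s' * C h := by
    rw [invLin_sub hα, hs]; ring
  rw [e] at h1
  refine RTT.of_smul (invLin α s * invLin α s' * C h) (fun x hx => ?_) (by simpa using h1)
  rw [mul_smul, mul_smul] at hx
  exact h_smul_powerSeries x (invLin_smul_powerSeries hα _ _ (invLin_smul_powerSeries hα _ _ hx))

/-- The difference of the arguments -u + s and u + s' is -2u + s - s'; this relation carries Tᵗ past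
R̄ᵗ. -/
lemma rtt_negT_reflect (s s' : K) :
    RTT (negT N c (-1) s) (negT N c 1 s') (1 : PowerSeries K) (C h * invLin (-2) (s - s')) 1
      (C h * invLin (-2) (s - s')) := by
  have h1 := rtt_negT (N := N) (c := c) (-1) 1 s s'
  -- Partial fractions: 1/(u + s') - 1/(-u + s) = (-2u + s - s')/((u + s')(-u + s)), checked by
  -- clearing the three units.
  have e : (invLin 1 s' - invLin (-1) s) * invLin (-2) (s - s') = invLin (-1) s * invLin 1 s' := by
    have h0 : (-1 : ℂ) ≠ 0 := by norm_num
    have h2 : (-2 : ℂ) ≠ 0 := by norm_num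
    have e1 := invLin_mul (B := K) h0 s
    have e2 := invLin_mul (B := K) one_ne_zero s'
    have e3 := invLin_mul (B := K) h2 (s - s')
    refine (isUnit_linear h0 s).mul_left_inj.1 ((isUnit_linear one_ne_zero s').mul_left_inj.1
      ((isUnit_linear h2 (s - s')).mul_left_inj.1 ?_))
    simp only [map_neg, map_one, map_ofNat, map_sub] at e1 e2 e3 ⊢
    set a := invLin (B := K) (-1) s
    set b := invLin (B := K) 1 s'
    set x := invLin (B := K) (-2) (s - s')
    linear_combination ((b - a) * (-1 + C s * X) * (1 + C s' * X)) * e3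
      + ((-1 + C s * X) * X - X * (-2 + (C s - C s') * X)) * e2
      + (-((1 + C s' * X) * X) - b * (1 + C s' * X) * (-2 + (C s - C s') * X)) * e1
  refine RTT.of_smul (invLin 1 s' - invLin (-1) s) (fun x hx => ?_) (by
    have e' : (invLin 1 s' - invLin (-1) s) * (C h * invLin (-2) (s - s')) =
      invLin (-1) s * invLin 1 s' * C h := by rw [← e]; ring
    rw [mul_one, e']; exact h1)
  refine invLin_smul_powerSeries one_ne_zero s' x (invLin_smul_powerSeries (α := -1) (by norm_num) s _ ?_)
  rw [← mul_smul, ← e, mul_comm, mul_smul, hx, smul_zero]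

/-- The substitution `u ↦ α u + s` in the outer variable. -/
lemma evLin_map_C {α : ℂ} (hα : α ≠ 0) (s : K) (f : PowerSeries (DY N c)) :
    evLin (PowerSeries (DY N c)) α (C s) (PowerSeries.map C f) =
      PowerSeries.map C (evLin (DY N c) α s f) := by
  refine powerSeries_hom_ext
    (φ := (evLin (PowerSeries (DY N c)) α (C s)).comp (PowerSeries.map C))
    (φ' := (PowerSeries.map C).comp (evLin (DY N c) α s)) (fun b => ?_) ?_ ?_ f
  · simp
  · simp only [RingHom.comp_apply, PowerSeries.map_X, evLin_X]
    rw [← map_invLin (C : K →+* PowerSeries K) (fun z => PowerSeries.algebraMap_apply.symm) hα]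
    ext m n
    simp [algebraMap_powerSeries]
  · simp [constantCoeff_map_invLin]

/-- The series `h / (α u + s - v)`, expanded in negative powers of `u`. -/
def mixedZ (α : ℂ) (s : K) : Bi K := hBi * invLin α (C s - X)

lemma constantCoeff_mixedZ (α : ℂ) (s : K) : constantCoeff (mixedZ α s) = 0 := by
  simp [mixedZ, constantCoeff_invLin]

/-- 1/z and 1/z' differ by (s - s')/h = 1. -/
lemma mixedZ_chain {α : ℂ} (hα : α ≠ 0) {s s' : K} (hs : s - s' = h) :
    mixedZ α s * (1 + mixedZ α s') = mixedZ α s' := by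
  have h1 := invLin_sub (B := PowerSeries K) hα (C s' - X) (C s - X)
  have h2 : (C s - X - (C s' - X) : PowerSeries K) = C h := by rw [← hs, map_sub]; ring
  rw [h2] at h1
  simp only [mixedZ, hBi]
  linear_combination -(C (C h)) * h1

lemma evLin_scal_mixedZ {α : ℂ} (hα : α ≠ 0) (s t : K) :
    evLin (PowerSeries (DY N c)) α (C s) (scal _ (hBi * invLin 1 (-X + C t))) =
      scal (DY N c) (mixedZ α (s + t)) := by
  have e := evLin_map (B := PowerSeries K) (A := PowerSeries (DY N c)) α (C s)
    (hBi * invLin 1 (-X + C t))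
  have e2 : (C s + (-X + C t) : PowerSeries K) = C (s + t) - X := by rw [map_add]; ring
  rw [map_mul (evLin (PowerSeries K) α (C s)), evLin_invLin hα one_ne_zero, one_mul, one_smul, hBi,
    evLin_C, e2] at e
  exact e

lemma evLin_scal_gEval {α : ℂ} (hα : α ≠ 0) (s t : K) :
    evLin (PowerSeries (DY N c)) α (C s) (scal _ (gEval N (hBi * invLin 1 (-X + C t)))) =
      scal (DY N c) (gEval N (mixedZ α (s + t))) := by
  refine gEval_natural N ((evLin (PowerSeries (DY N c)) α (C s)).comp (scal _)) (scal (DY N c))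
    (by simp [constantCoeff_invLin]) (constantCoeff_mixedZ _ _) (fun k => ?_)
    (evLin_scal_mixedZ hα s t) ?_
  · simp [scal]
  · rw [RingHom.comp_apply, evLin_scal_mixedZ hα]
    have := constantCoeff_mixedZ α (s + t)
    rw [← coeff_zero_eq_constantCoeff_apply] at this ⊢
    rw [scal, coeff_map, this, map_zero]

lemma rtt_negT_mixed {α : ℂ} (hα : α ≠ 0) (s : K) :
    RTT ((negT N c α s).map (PowerSeries.map C)) ((Tplus tGen).map C)
      (gEval N (mixedZ α (s + (c / 2) • h)))
      (gEval N (mixedZ α (s + (c / 2) • h)) * mixedZ α (s + (c / 2) • h))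
      (gEval N (mixedZ α (s - (c / 2) • h)))
      (gEval N (mixedZ α (s - (c / 2) • h)) * mixedZ α (s - (c / 2) • h)) := by
  have e : (-X - C ((c / 2) • h) : PowerSeries K) = -X + C (-((c / 2) • h)) := by
    rw [map_neg, sub_eq_add_neg]
  have := rtt_mixed (N := N) (c := c) (evLin (PowerSeries (DY N c)) α (C s))
    (evLin_scal_gEval hα s _).symm (evLin_scal_mixedZ hα s _).symm
    (by rw [e]; exact (evLin_scal_gEval hα s _).symm)
    (by rw [e]; exact (evLin_scal_mixedZ hα s _).symm)
  simp only [evLin_map_C hα, evLin_C, ← sub_eq_add_neg] at this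
  exact this

lemma rtt_negT_outer {α : ℂ} (hα : α ≠ 0) (s : K) :
    RTT ((negT N c α s).map (PowerSeries.map C)) ((Tmat tGen).map C)
      (vb - PowerSeries.map C (invLin α s)) (PowerSeries.map C (invLin α s) * vb * C (C h))
      (vb - PowerSeries.map C (invLin α s)) (PowerSeries.map C (invLin α s) * vb * C (C h)) := by
  have e := map_invLin (C : K →+* PowerSeries K) (fun z => PowerSeries.algebraMap_apply.symm) hα s
  have := rtt_Tmat (N := N) (c := c) (evLin (PowerSeries (DY N c)) α (C s))
    (α := vb - PowerSeries.map C (invLin α s))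
    (β := PowerSeries.map C (invLin α s) * vb * C (C h))
    (by rw [e]; simp [scal, algebraMap_powerSeries])
    (by rw [e]; simp [scal, algebraMap_powerSeries])
  simp only [evLin_map_C hα, evLin_C] at this
  exact this

lemma commute_C_of_bi {A : Type*} [Ring A] {d f : PowerSeries A}
    (hd : PowerSeries.map C d * C f = C f * PowerSeries.map C d) (n : ℕ) :
    Commute d (C (coeff n f)) := by
  ext m
  have := congrArg (fun g => coeff n (coeff m g)) hd
  simpa only [coeff_mul_C, coeff_C_mul, coeff_map] using this

lemma outer_chain {α : ℂ} (hα : α ≠ 0) {s s' : K} (hs : s - s' = h) :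
    invLin α s' - invLin α s = C h * (invLin α s * invLin α s') := by
  rw [invLin_sub hα, hs, mul_comm (invLin α s)]

/-- As u → ∞ every factor tends to v⁻¹, and multiplication by v⁻¹ is injective on series in v⁻¹. So
the common scalar of the two sides can be cancelled. -/
lemma outer_regular (α : ℂ) (s : Fin N → K) (p : ℕ → Prop) [DecidablePred p]
    (x : Bi (DY N c)) (hx : (∏ i : Fin N, if p i then
      vb - PowerSeries.map C (invLin α (s i)) - PowerSeries.map C (invLin α (s i)) * vb * C (C h)
      else vb - PowerSeries.map C (invLin α (s i)) : Bi K) • x = 0) : x = 0 := by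
  refine smul_eq_zero_of_prod (fun i _ x hx => ?_) x hx
  refine smul_eq_zero_of_constantCoeff (fun x hx => ?_) x hx
  have h0 : constantCoeff (PowerSeries.map C (invLin α (s i)) : Bi K) = 0 := by
    rw [← coeff_zero_eq_constantCoeff_apply, coeff_map, coeff_zero_eq_constantCoeff_apply,
      constantCoeff_invLin, map_zero]
  apply X_smul_powerSeries (L := K)
  split_ifs at hx
  · simpa [h0] using hx
  · simpa [h0] using hx

lemma commute_C_algebraMap (d : PowerSeries (DY N c)) (k : K) :
    Commute d (C (algebraMap K (DY N c) k)) := by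
  ext m
  simp [Algebra.commutes]

/-- Centrality of the quantum determinant: carry an auxiliary T(v) or T⁺(v) through T_1 ⋯ T_N and
compare the scalars by which the R-matrices act on the alternating form. -/
lemma negT_eigenvalue_comm {α : ℂ} (hα : α ≠ 0) {s : Fin N → K}
    (hs : ∀ i j : Fin N, (j : ℕ) = i + 1 → s i - s j = h) {d : PowerSeries (DY N c)}
    (hd : Matrix.vecMul (altVec N _) ((List.finRange N).map fun i => siteOp i (negT N c α (s i))).prod
      = d • altVec N _) (x : DY N c) : Commute d (C x) := by
  have hd' := vecMul_siteProd_map (PowerSeries.map C) hd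
  refine commute_of_commute_coeff C (fun z hz => h_smul_powerSeries z ?_)
    (commute_C_algebraMap d) (fun a b r => commute_C_of_bi ?_ r)
    (fun a b r => commute_C_of_bi ?_ r) x
  · rw [← hz, powerSeries_smul_def]; simp
  -- For T against T the same R-matrices occur on both sides, hence the same scalar, which is not a
  -- zero divisor.
  · have := eigenvalue_mul_comm hd' _ _ _ _ _ (fun i => rtt_negT_outer hα (s i))
      (fun i j hij => ?_) (fun i j hij => ?_) a b
    · rw [← sub_eq_zero, ← smul_sub] at this
      exact sub_eq_zero.1 (outer_regular α s (fun i => i + 1 = N) _ this)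
    all_goals
      have e := congrArg (PowerSeries.map (C : K →+* PowerSeries K)) (outer_chain hα (hs i j hij))
      simp only [map_sub, map_mul, PowerSeries.map_C] at e
      linear_combination (-(vb * vb * C (C h)) : Bi K) * e
  -- For T against T⁺ the R-matrices on the two sides are shifted by +hc/2 and -hc/2. The shift does
  -- not affect the differences of consecutive arguments, so the normalization of g makes both
  -- scalars equal to 1.
  · have := eigenvalue_mul_comm hd' _ _ _ _ _ (fun i => rtt_negT_mixed hα (s i))
      (fun i j hij => ?_) (fun i j hij => ?_) a b
    · rw [prod_gEval, prod_gEval, one_smul, one_smul] at this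
      · exact this
      · exact fun i => constantCoeff_mixedZ _ _
      · exact fun i j hij => mixedZ_chain hα (by rw [← hs i j hij]; ring)
      · exact fun i => constantCoeff_mixedZ _ _
      · exact fun i j hij => mixedZ_chain hα (by rw [← hs i j hij]; ring)
    · have := mixedZ_chain hα (s := s i + (c / 2) • h) (s' := s j + (c / 2) • h)
        (by rw [← hs i j hij]; ring)
      linear_combination (gEval N (mixedZ α (s i + (c / 2) • h)) *
        gEval N (mixedZ α (s j + (c / 2) • h))) * this
    · have := mixedZ_chain hα (s := s i - (c / 2) • h) (s' := s j - (c / 2) • h)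
        (by rw [← hs i j hij]; ring)
      linear_combination (gEval N (mixedZ α (s i - (c / 2) • h)) *
        gEval N (mixedZ α (s j - (c / 2) • h))) * this

/-- Transposition reverses the relations, so the auxiliary matrix starts on the left and the
parameters have to increase with the index instead of decreasing. -/
lemma negT_transpose_eigenvalue_comm {α : ℂ} (hα : α ≠ 0) {s : Fin N → K}
    (hs : ∀ i j : Fin N, (j : ℕ) = i + 1 → s j - s i = h) {d : PowerSeries (DY N c)}
    (hd : Matrix.vecMul (altVec N _)
      ((List.finRange N).map fun i => siteOp i (negT N c α (s i)).transpose).prod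
      = d • altVec N _) (x : DY N c) : Commute d (C x) := by
  have hd' := vecMul_siteProd_map (PowerSeries.map C) hd
  refine commute_of_commute_coeff C (fun z hz => h_smul_powerSeries z ?_)
    (commute_C_algebraMap d) (fun a b r => commute_C_of_bi ?_ r)
    (fun a b r => commute_C_of_bi ?_ r) x
  · rw [← hz, powerSeries_smul_def]; simp
  · have := mul_eigenvalue_comm hd' _ _ _ _ _ (fun i => (rtt_negT_outer hα (s i)).transpose)
      (fun i j hij => ?_) (fun i j hij => ?_) b a
    · rw [← sub_eq_zero, ← smul_sub] at this
      exact (sub_eq_zero.1 (outer_regular α s (fun i => i = 0) _ this)).symm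
    all_goals
      have e := congrArg (PowerSeries.map (C : K →+* PowerSeries K)) (outer_chain hα (hs i j hij))
      simp only [map_sub, map_mul, PowerSeries.map_C] at e
      linear_combination (-(vb * vb * C (C h)) : Bi K) * e
  · have := mul_eigenvalue_comm hd' _ _ _ _ _ (fun i => (rtt_negT_mixed hα (s i)).transpose)
      (fun i j hij => ?_) (fun i j hij => ?_) b a
    · rw [prod_gEval_reverse, prod_gEval_reverse, one_smul, one_smul] at this
      · exact this.symm
      · exact fun i => constantCoeff_mixedZ _ _
      · exact fun i j hij => mixedZ_chain hα (by rw [← hs i j hij]; ring)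
      · exact fun i => constantCoeff_mixedZ _ _
      · exact fun i j hij => mixedZ_chain hα (by rw [← hs i j hij]; ring)
    · have := mixedZ_chain hα (s := s j - (c / 2) • h) (s' := s i - (c / 2) • h)
        (by rw [← hs i j hij]; ring)
      linear_combination (gEval N (mixedZ α (s i - (c / 2) • h)) *
        gEval N (mixedZ α (s j - (c / 2) • h))) * this
    · have := mixedZ_chain hα (s := s j + (c / 2) • h) (s' := s i + (c / 2) • h)
        (by rw [← hs i j hij]; ring)
      linear_combination (gEval N (mixedZ α (s i + (c / 2) • h)) *
        gEval N (mixedZ α (s j + (c / 2) • h))) * this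

end NegativeHalf

/-! ### The alternating form as an eigenvector of a bracket product. -/

section Eigenvalue

variable {N : ℕ} {L R : Type*} [CommRing L] [Ring R] [Algebra L R]

lemma rowProd_map {ι E E' : Type*} [Monoid E] [Monoid E'] (φ : E →* E') (S : ι → E)
    (Q : ι → ι → E) (l : List ι) :
    φ (rowProd S Q l) = rowProd (fun i => φ (S i)) (fun i j => φ (Q i j)) l := by
  induction l with
  | nil => simp [rowProd]
  | cons i l ih => simp [rowProd, ih, map_list_prod, Function.comp_def]

lemma reflR_map {ι : Type*} [Fintype ι] [DecidableEq ι] (γ η : ι → ι → L) (i j : ι) :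
    (reflR γ η i j : SiteOp ι N L).map (algebraMap L R) = reflR γ η i j := by
  ext I J
  simp only [reflR, Matrix.map_apply, Matrix.smul_apply, Matrix.sub_apply, capOp, Matrix.of_apply,
    Matrix.one_apply, smul_eq_mul]
  simp only [Algebra.smul_def, map_mul, map_sub]
  congr 2
  · split_ifs <;> simp
  · congr 1
    split_ifs <;> simp

lemma siteOp_mul {ι : Type*} [Fintype ι] [DecidableEq ι] (k : ι) (M M' : Matrix (Fin N) (Fin N) R) :
    siteOp k (M * M') = siteOp k M * siteOp k M' := by
  ext I J
  rw [siteOp_mul_apply]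
  simp only [siteOp, Matrix.of_apply, Function.update_self]
  by_cases h : ∀ m, m ≠ k → I m = J m
  · rw [if_pos h, Matrix.mul_apply]
    refine Finset.sum_congr rfl fun x _ => ?_
    rw [if_pos fun m hm => by rw [Function.update_of_ne hm, h m hm]]
  · rw [if_neg h, Finset.sum_eq_zero]
    intro x _
    rw [if_neg, mul_zero]
    intro g
    exact h fun m hm => by rw [← g m hm, Function.update_of_ne hm]

lemma rowProd_congr {ι E : Type*} [Monoid E] {S S' : ι → E}
    {Q Q' : ι → ι → E} {l : List ι} (hS : ∀ i ∈ l, S i = S' i)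
    (hQ : l.Pairwise fun i j => Q i j = Q' i j) : rowProd S Q l = rowProd S' Q' l := by
  induction l with
  | nil => rfl
  | cons i l ih =>
    rw [List.pairwise_cons] at hQ
    rw [rowProd, rowProd, hS i (by simp), List.map_congr_left hQ.1,
      ih (fun j hj => hS j (by simp [hj])) hQ.2]

/-- The alternating form is an eigenvector of the ordered product of the matrices `T i * G * U i`
and of the reflected `R`-matrices. -/
theorem rowProd_eigenvalue (hu : IsUnit (2 : L)) (G : Matrix (Fin N) (Fin N) L)
    (hG : G.transpose = G ∨ G.transpose = -G) (T U : Fin N → Matrix (Fin N) (Fin N) R)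
    (γ : Fin N → Fin N → L) (e : ℕ → L) (he : ∀ k, e k - e (k + 1) = e k * e (k + 1))
    (hT : ∀ i j : Fin N, (j : ℕ) = i + 1 → RTT (T i) (T j) (1 : L) 1 1 1)
    (hU : ∀ i j : Fin N, (j : ℕ) = i + 1 → RTT (U i) (U j) (1 : L) 1 1 1)
    (hTU : ∀ i j : Fin N, i < j → RTT (U i).transpose (T j) (1 : L) (e (i + j)) 1 (e (i + j))) :
    ∃ (d d' : R) (θ : L),
      Matrix.vecMul (altVec N R) ((List.finRange N).map fun i => siteOp i (T i)).prod =
        d • altVec N R ∧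
      Matrix.vecMul (altVec N R) ((List.finRange N).map fun i => siteOp i (U i)).prod =
        d' • altVec N R ∧
      Matrix.vecMul (altVec N R) (rowProd (fun i => siteOp i (T i * G.map (algebraMap L R) * U i))
        (reflR γ fun i j => e (i + j)) (List.finRange N)) =
        (d * algebraMap L R θ * d') • altVec N R := by
  have huR : IsUnit (2 : R) := by
    have := hu.map (algebraMap L R)
    rwa [map_ofNat] at this
  obtain ⟨d, hd⟩ := exists_eigenvalue (L := L) huR T hT
  obtain ⟨d', hd'⟩ := exists_eigenvalue (L := L) huR U hU
  -- The middle factor has entries in the commutative ring L; computed there and then transported,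
  -- its eigenvalue θ is a scalar.
  obtain ⟨θ, hθ⟩ : ∃ θ : L, Matrix.vecMul (altVec N L) (rowProd (fun i => siteOp i (G.map
      (algebraMap L L))) (reflR γ fun i j => e (i + j)) (List.finRange N)) = θ • altVec N L := by
    refine vecMul_altVec (eq_zero_of_add_self hu) fun i j hij => ?_
    obtain ⟨pre, post, hl⟩ := finRange_split hij
    have hnd := List.nodup_finRange N
    rw [hl] at hnd ⊢
    -- The parameters of R̄ᵗ depend on i + j only, so passing from a factor to its neighbour is one
    -- step of the chain e.
    refine Fused.rowProd (eq_zero_of_add_self hu) G hG (by rintro rfl; omega) (fun k _ _ => ?_)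
      (fun k _ _ => ?_) hnd
    · have := he (k + i)
      rw [hij, ← add_assoc]; exact this
    · have := he (i + k)
      rw [hij, show (i : ℕ) + 1 + k = i + k + 1 by ring]; exact this
  refine ⟨d, d', θ, hd, hd', ?_⟩
  have e1 := rowProd_factor G T U γ (fun i j => e (i + j)) (List.finRange N) (List.nodup_finRange N)
    (List.Pairwise.imp (fun h => hTU _ _ h) (List.pairwise_lt_finRange N))
  have e2 := vecMul_altVec_map (algebraMap L R) hθ
  have e3 := rowProd_map ((algebraMap L R).mapMatrix (m := Fin N → Fin N)).toMonoidHom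
    (fun i => siteOp i (G.map (algebraMap L L))) (reflR γ fun i j => e (i + j)) (List.finRange N)
  have e4 : (fun i => siteOp i (T i * G.map (algebraMap L R) * U i)) =
      fun i : Fin N => siteOp i (T i) * siteOp i (G.map (algebraMap L R)) * siteOp i (U i) := by
    funext i
    rw [siteOp_mul, siteOp_mul]
  rw [e4, e1, ← Matrix.vecMul_vecMul, ← Matrix.vecMul_vecMul, hd]
  have e5 : rowProd (fun i => siteOp i (G.map (algebraMap L R))) (reflR γ fun i j => e (i + j))
      (List.finRange N) = (rowProd (fun i => siteOp i (G.map (algebraMap L L)))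
        (reflR γ fun i j => e (i + j)) (List.finRange N) : SiteOp (Fin N) N L).map (algebraMap L R) := by
    refine Eq.trans (rowProd_congr (fun i _ => ?_) ?_) e3.symm
    · exact (siteOp_map (algebraMap L R) i _).symm
    · exact List.pairwise_of_forall fun i j => (reflR_map _ _ _ _).symm
  rw [Matrix.smul_vecMul, e5, e2, smul_smul, Matrix.smul_vecMul, hd', smul_smul]

end Eigenvalue

/-! ### The partially transposed R-matrix as a cap operator. -/

section Reflected

variable {N : ℕ} [NeZero N] {B R : Type*} [CommRing B] [Algebra K B] [Ring R]
  [Algebra (PowerSeries B) R]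

/-- Transposing one factor turns P into the cap; the identity and the scalar normalization are
unaffected. -/
lemma atSites_Rbar_map {i j : Fin N} (hij : i ≠ j) (y : PowerSeries B) :
    (atSites i j (partialTranspose (Rbar y))).map (algebraMap (PowerSeries B) R) =
      gEval N (C (algebraMap K B h) * y) • (1 - (C (algebraMap K B h) * y) • capOp i j) := by
  ext I J
  simp only [Matrix.map_apply, atSites, Matrix.of_apply, partialTranspose, Rbar, Matrix.smul_apply,
    Matrix.sub_apply, permMat, capOp, Matrix.one_apply, Prod.mk.injEq, smul_eq_mul]
  by_cases h : ∀ m, m ≠ i → m ≠ j → I m = J m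
  · have h1 : (J i = I i ∧ I j = J j) ↔ I = J := by
      constructor
      · rintro ⟨h1, h2⟩
        funext m
        by_cases hi : m = i
        · rw [hi, h1]
        · by_cases hj : m = j
          · rw [hj, h2]
          · exact h m hi hj
      · rintro rfl; simp
    have h2 : (J i = J j ∧ I j = I i) ↔ ((∀ m, m ≠ i → m ≠ j → I m = J m) ∧ I i = I j ∧ J i = J j) := by
      constructor
      · rintro ⟨h1, h2⟩; exact ⟨h, h2.symm, h1⟩
      · rintro ⟨_, h1, h2⟩; exact ⟨h2, h1.symm⟩
    rw [if_pos h]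
    simp only [h1, h2, Algebra.smul_def, map_mul, map_sub]
    congr 2
    · split_ifs <;> simp
    · congr 1
      split_ifs <;> simp
  · rw [if_neg h, map_zero, if_neg, if_neg]
    · simp
    · exact fun g => h g.1
    · rintro rfl; exact h fun _ _ _ => rfl

end Reflected

/-! ### The product S_{[N]}(u_- + hc/2). -/

section Sbracket

variable {N : ℕ} [NeZero N] {c : ℂ} {G : Matrix (Fin N) (Fin N) ℂ}

/-- A complex matrix as a matrix of constant scalar series. -/
def scalMat (G : Matrix (Fin N) (Fin N) ℂ) : Matrix (Fin N) (Fin N) (PowerSeries K) :=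
  G.map fun z => C (algebraMap ℂ K z)

lemma substInv_Sminus (s : K) :
    substInv (Sminus c G) (invLin 1 s) = negT N c 1 (s + c • h) *
      (scalMat G).map (algebraMap (PowerSeries K) (PowerSeries (DY N c))) *
        (negT N c (-1) (-s)).transpose := by
  have e : ∀ M : Matrix (Fin N) (Fin N) (PowerSeries (DY N c)), ∀ (α : ℂ) (s : K),
      substInv M (invLin α s) = M.map (evLin (DY N c) α s) := by
    intro M α s
    refine Matrix.ext fun i j => ?_
    simp only [substInv, Matrix.map_apply]
    exact evalInv_eq_evLin (B := K) (A := DY N c) α s (M i j)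
  rw [e (Sminus c G), Sminus, e (Tmat tGen), e (Tmat tGen), Matrix.map_mul, Matrix.map_mul]
  congr 2
  · ext i j : 2
    simp only [negT, Matrix.map_apply]
    rw [evLin_evLin one_ne_zero one_ne_zero, one_mul, one_smul]
  · ext i j : 2
    simp [constMat, scalMat, algebraMap_powerSeries]
  · ext i j : 2
    simp only [negT, Matrix.map_apply, Matrix.transpose_apply]
    rw [evLin_evLin one_ne_zero (by norm_num), mul_one, add_zero, neg_one_smul]

lemma atSite_eq_siteOp {R : Type*} [Ring R] (k : Fin N) (M : Matrix (Fin N) (Fin N) R) :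
    atSite k M = siteOp k M := by
  ext I J
  simp only [atSite, siteOp, Matrix.of_apply]
  congr

lemma isUnit_two_of_algebra {B : Type*} [CommRing B] [Algebra ℂ B] : IsUnit (2 : B) := by
  have : IsUnit (2 : ℂ) := IsUnit.mk0 _ two_ne_zero
  have := this.map (algebraMap ℂ B)
  rwa [map_ofNat] at this

lemma scalMat_symm (hG : G.transpose = G ∨ G.transpose = -G) :
    (scalMat G).transpose = scalMat G ∨ (scalMat G).transpose = -scalMat G := by
  rcases hG with hG | hG
  · left
    rw [scalMat, ← Matrix.transpose_map, hG]
  · right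
    rw [scalMat, ← Matrix.transpose_map, hG]
    ext i j : 2
    simp

/-- With u_i = u - ih, the argument of T in S(u_i + hc/2) is u_i + hc/2 + hc = u + (3c/2 - i)h and
that of Tᵗ is -u_i - hc/2 = -u + (i - c/2)h. -/
lemma Sbracket_eq : Sbracket c G = rowProd (fun i : Fin N => siteOp i
      (negT N c 1 ((3 * c / 2 - (i : ℕ)) • h) *
      (scalMat G).map (algebraMap (PowerSeries K) (PowerSeries (DY N c))) *
        (negT N c (-1) (((i : ℕ) - c / 2 : ℂ) • h)).transpose))
      (reflR (fun i j => gEval N (C h * invLin (-2) (((i + j : ℕ) - 2 * c : ℂ) • h)))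
        fun i j => C h * invLin (-2) (((i + j : ℕ) - 2 * c : ℂ) • h)) (List.finRange N) := by
  rw [Sbracket, rowProd_eq _ _ _ (List.pairwise_lt_finRange N)]
  refine rowProd_congr (fun i _ => ?_) (List.Pairwise.imp (fun {i j} hij => ?_)
    (List.pairwise_lt_finRange N))
  · rw [substInv_Sminus]
    have e1 : ((c / 2 - (i : ℕ) : ℂ) • h + c • h : K) = (3 * c / 2 - (i : ℕ) : ℂ) • h := by
      rw [← add_smul]; congr 1; ring
    have e2 : -((c / 2 - (i : ℕ) : ℂ) • h : K) = ((i : ℕ) - c / 2 : ℂ) • h := by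
      rw [← neg_smul]; congr 1; ring
    rw [e1, e2, atSite_eq_siteOp]
  · have := atSites_Rbar_map (R := PowerSeries (DY N c)) (ne_of_lt hij)
      (invLin (-2) (((i : ℕ) + (j : ℕ) - 2 * c : ℂ) • h) : PowerSeries K)
    rw [reflR, Nat.cast_add]
    exact this

/-- The alternating form is an eigenvector of `S_{[N]}(u_- + hc/2)`, with a central eigenvalue. -/
theorem Sbracket_eigenvalue (hG : G.transpose = G ∨ G.transpose = -G) :
    ∃ y : PowerSeries (DY N c),
      Matrix.vecMul (altVec N _) (Sbracket c G) = y • altVec N _ ∧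
      ∀ x : DY N c, Commute y (C x) := by
  have hs : ∀ i j : Fin N, (j : ℕ) = i + 1 →
      ((3 * c / 2 - (i : ℕ)) • h - (3 * c / 2 - (j : ℕ)) • h : K) = h := by
    intro i j hij
    rw [← sub_smul, hij]
    push_cast
    rw [show (3 * c / 2 - (i : ℕ) - (3 * c / 2 - ((i : ℕ) + 1)) : ℂ) = 1 by ring, one_smul]
  have hs' : ∀ i j : Fin N, (j : ℕ) = i + 1 →
      (((j : ℕ) - c / 2 : ℂ) • h - ((i : ℕ) - c / 2 : ℂ) • h : K) = h := by
    intro i j hij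
    rw [← sub_smul, hij]
    push_cast
    rw [show (((i : ℕ) + 1 - c / 2 - ((i : ℕ) - c / 2)) : ℂ) = 1 by ring, one_smul]
  have h1 : (-1 : ℂ) ≠ 0 := by norm_num
  obtain ⟨d, d', θ, hd, hd', H⟩ := rowProd_eigenvalue (R := PowerSeries (DY N c))
    isUnit_two_of_algebra (scalMat G) (scalMat_symm hG)
    (fun i => negT N c 1 ((3 * c / 2 - (i : ℕ)) • h))
    (fun i => (negT N c (-1) (((i : ℕ) - c / 2 : ℂ) • h)).transpose)
    (fun i j => gEval N (C h * invLin (-2) (((i + j : ℕ) - 2 * c : ℂ) • h)))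
    (fun k => C h * invLin (-2) (((k : ℂ) - 2 * c) • h)) (fun k => by
      have e := invLin_sub (B := K) (α := -2) (by norm_num) (((k : ℂ) - 2 * c) • h)
        ((((k + 1 : ℕ) : ℂ) - 2 * c) • h)
      rw [← sub_smul, show (((k + 1 : ℕ) : ℂ) - 2 * c - ((k : ℂ) - 2 * c)) = 1 by push_cast; ring,
        one_smul] at e
      linear_combination C h * e)
    (fun i j hij => rtt_negT_adjacent one_ne_zero (hs i j hij))
    (fun i j hij => (rtt_negT_adjacent h1 (hs' i j hij)).transpose)
    -- The difference (i - c/2) - (3c/2 - j) is i + j - 2c: the extra -2hc in the argument of R̄ᵗ is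
    -- what the reflected relation requires.
    (fun i j hij => by
      have e := rtt_negT_reflect (N := N) (c := c) (((i : ℕ) - c / 2 : ℂ) • h)
        ((3 * c / 2 - (j : ℕ)) • h)
      rw [← sub_smul, show ((i : ℕ) - c / 2 - (3 * c / 2 - (j : ℕ)) : ℂ) =
        (i + j : ℕ) - 2 * c by push_cast; ring] at e
      exact e)
  rw [← Sbracket_eq] at H
  refine ⟨_, H, fun x => ?_⟩
  refine ((negT_eigenvalue_comm one_ne_zero hs hd x).mul_left ?_).mul_left
    (negT_transpose_eigenvalue_comm h1 hs' hd' x)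
  exact Algebra.commutes _ _

end Sbracket

/-! ### Series in u and w with uw = h. -/

section Laurent

variable (A : Type*) [Ring A] [Algebra K A]

/-- The ideal generated by `u w - h`, where `u` is the outer and `w` the inner variable. -/
def lauIdeal : Ideal (Bi A) := Ideal.span {scal A (va * vb - hBi)}

instance : (lauIdeal A).IsTwoSided where
  mul_mem_of_left := by
    intro x b hx
    obtain ⟨z, rfl⟩ := Ideal.mem_span_singleton'.1 hx
    rw [mul_assoc, ← scal_comm, ← mul_assoc]
    exact Ideal.mul_mem_left _ _ (Ideal.mem_span_singleton_self _)

/-- The ring of series in `u` and `w = h u⁻¹`. -/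
def Lau : Type _ := Bi A ⧸ lauIdeal A

instance : Ring (Lau A) := inferInstanceAs (Ring (Bi A ⧸ lauIdeal A))

/-- The class of a series in `u` and `w`. -/
def toLau : Bi A →+* Lau A := Ideal.Quotient.mk (lauIdeal A)

lemma toLau_surjective : Function.Surjective (toLau A) := Ideal.Quotient.mk_surjective

variable {A} in
lemma toLau_eq_zero {x : Bi A} : toLau A x = 0 ↔ ∃ z, z * scal A (va * vb - hBi) = x :=
  Ideal.Quotient.eq_zero_iff_mem.trans Ideal.mem_span_singleton'

instance : Algebra (Bi K) (Lau A) :=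
  ((toLau A).comp (scal A)).toAlgebra' fun f x => by
    obtain ⟨x, rfl⟩ := toLau_surjective A x
    rw [RingHom.comp_apply, ← map_mul, ← map_mul, scal_comm]

lemma algebraMap_lau (f : Bi K) : algebraMap (Bi K) (Lau A) f = toLau A (scal A f) := rfl

lemma algebraMap_lau_h : algebraMap (Bi K) (Lau A) hBi = algebraMap (Bi K) (Lau A) (va * vb) := by
  symm
  rw [← sub_eq_zero, ← map_sub, algebraMap_lau, toLau_eq_zero]
  exact ⟨1, one_mul _⟩

/-- Constant series. -/
def constLau : A →+* Lau A := (toLau A).comp ((C : PowerSeries A →+* Bi A).comp C)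

variable {N : ℕ} [NeZero N] {c : ℂ}

/-- If ux = z(uw - h), then setting u = 0 gives h z_0 = 0. Without h-torsion z is divisible by u,
and u cancels. -/
lemma lau_va_smul (x : Lau (DY N c)) (hx : (va : Bi K) • x = 0) : x = 0 := by
  obtain ⟨x, rfl⟩ := toLau_surjective _ x
  rw [Algebra.smul_def, algebraMap_lau, ← map_mul, toLau_eq_zero] at hx
  obtain ⟨z, hz⟩ := hx
  have h0 : constantCoeff z = 0 := by
    have h1 := congrArg constantCoeff hz
    simp only [map_mul, map_sub, scal, va, vb, hBi, PowerSeries.map_X, PowerSeries.map_C,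
      constantCoeff_X, constantCoeff_C, zero_mul, zero_sub, mul_neg, neg_eq_zero] at h1
    refine h_smul_powerSeries _ ?_
    rw [powerSeries_smul_def, map_algebraMap_commutes, PowerSeries.map_C]
    exact h1
  obtain ⟨z', rfl⟩ := eq_X_mul_of_constantCoeff h0
  rw [toLau_eq_zero]
  refine ⟨z', ?_⟩
  apply PowerSeries.ext
  intro m
  have := congrArg (coeff (m + 1)) hz
  rw [mul_assoc, coeff_succ_X_mul] at this
  rw [this]
  simp only [scal, va, PowerSeries.map_X]
  rw [coeff_succ_X_mul]

/-- If hx = z(uw - h), then uw z = h(x + z), so every coefficient of z is a multiple of h, and h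
cancels coefficientwise. -/
lemma lau_h_smul (x : Lau (DY N c)) (hx : hBi • x = 0) : x = 0 := by
  obtain ⟨x, rfl⟩ := toLau_surjective _ x
  rw [Algebra.smul_def, algebraMap_lau, ← map_mul, toLau_eq_zero] at hx
  obtain ⟨z, hz⟩ := hx
  have h1 : scal _ (va * vb) * z = scal _ hBi * (x + z) := by
    rw [mul_add, ← hz, map_sub, mul_sub, scal_comm, scal_comm]; abel
  have h2 : ∀ m n, coeff n (coeff m z) = h • coeff (n + 1) (coeff (m + 1) (x + z)) := by
    intro m n
    have := congrArg (fun f => coeff (n + 1) (coeff (m + 1) f)) h1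
    simp only [map_mul (scal _), mul_assoc, coeff_scal_va, coeff_scal_vb, coeff_scal_h] at this
    exact this
  set z' : Bi (DY N c) := PowerSeries.mk fun m => PowerSeries.mk fun n =>
    coeff (n + 1) (coeff (m + 1) (x + z)) with hz'
  have h3 : z = scal _ hBi * z' := by
    ext m n
    rw [coeff_scal_h, h2, hz', coeff_mk, coeff_mk]
  have hreg : ∀ f g : Bi (DY N c), scal _ hBi * f = scal _ hBi * g → f = g := by
    intro f g hfg
    ext m n
    have := congrArg (fun f => coeff n (coeff m f)) hfg
    simp only [coeff_scal_h] at this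
    exact h_smul_injective this
  rw [toLau_eq_zero]
  refine ⟨z', hreg _ _ ?_⟩
  rw [← hz, h3, mul_assoc]

end Laurent

/-! ### Substitution of u p(w) in series in u. -/

section PositiveEvaluation

variable (A : Type*) [Ring A] [Algebra K A]

lemma commute_scal (f : Bi K) (x : Bi A) : Commute (scal A f) x := (scal_comm f x).symm

lemma constantCoeff_scal_va_mul (f : Bi K) : constantCoeff (scal A (va * f)) = 0 := by
  simp [scal]

/-- The substitution of `u p(w)` in power series. -/
def posEv (p : PowerSeries K) : PowerSeries A →+* Bi A :=
  substHom ((C : PowerSeries A →+* Bi A).comp C) (scal A (va * C p))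
    (constantCoeff_scal_va_mul A _) (commute_scal A _)

@[simp]
lemma posEv_C (p : PowerSeries K) (a : A) : posEv A p (C a) = C (C a) := by simp [posEv]

@[simp]
lemma posEv_X (p : PowerSeries K) : posEv A p X = scal A (va * C p) := by simp [posEv]

/-- The substitution of `u p(w)` and `u p'(w)` in power series in two variables. -/
def posEv₂ (p p' : PowerSeries K) : Bi A →+* Bi A :=
  substHom (posEv A p') (scal A (va * C p)) (constantCoeff_scal_va_mul A _) (commute_scal A _)

@[simp]
lemma posEv₂_C (p p' : PowerSeries K) (f : PowerSeries A) :
    posEv₂ A p p' (C f) = posEv A p' f := by simp [posEv₂]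

@[simp]
lemma posEv₂_X (p p' : PowerSeries K) : posEv₂ A p p' X = scal A (va * C p) := by simp [posEv₂]

lemma posEv₂_map (p p' : PowerSeries K) (f : PowerSeries A) :
    posEv₂ A p p' (PowerSeries.map C f) = posEv A p f := by
  refine powerSeries_hom_ext (φ := (posEv₂ A p p').comp (PowerSeries.map C))
    (φ' := posEv A p) (fun b => ?_) ?_ ?_ f
  · simp
  · simp
  · simp [scal]

lemma posEv_map (p : PowerSeries K) (f : PowerSeries K) :
    posEv A p (PowerSeries.map (algebraMap K A) f) = scal A (posEv K p f) := by
  refine powerSeries_hom_ext (φ := (posEv A p).comp (PowerSeries.map (algebraMap K A)))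
    (φ' := (scal A).comp (posEv K p)) (fun b => ?_) ?_ ?_ f
  · simp [scal]
  · simp [scal]
  · simp [scal]

end PositiveEvaluation

/-! ### Quantum determinants of T⁺(u) and the product S⁺_{[N]}(u_-). -/

section PositiveHalf

variable {N : ℕ} [NeZero N] {c : ℂ}

/-- The matrix `T⁺(u p(w))`. -/
def posT (N : ℕ) [NeZero N] (c : ℂ) (p : PowerSeries K) : Matrix (Fin N) (Fin N) (Lau (DY N c)) :=
  (Tplus tGen).map fun f => toLau _ (posEv (DY N c) p f)

lemma rtt_posT (p p' : PowerSeries K) :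
    RTT (posT N c p) (posT N c p') (va * C (p - p')) hBi (va * C (p - p')) hBi := by
  have := rtt_Tplus (N := N) (c := c) ((toLau _).comp (posEv₂ (DY N c) p p'))
    (α := va * C (p - p')) (β := hBi)
    (by rw [algebraMap_lau]; simp [scal, mul_sub]) (by rw [algebraMap_lau]; simp [scal])
  simp only [RingHom.comp_apply, posEv₂_map, posEv₂_C] at this
  exact this

/-- The arguments differ by uw = h, so the R-matrix is h(1 - P) before h is cancelled. -/
lemma rtt_posT_adjacent {p p' : PowerSeries K} (hp : p - p' = X) :
    RTT (posT N c p) (posT N c p') (1 : Bi K) 1 1 1 := by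
  have h1 := rtt_posT (N := N) (c := c) p p'
  rw [hp] at h1
  refine RTT.of_smul hBi lau_h_smul ?_
  rw [mul_one]
  exact h1.congr (algebraMap_lau_h _).symm rfl (algebraMap_lau_h _).symm rfl

/-- The difference of the arguments is u times the unit p - p', and h = uw turns h/(u(p - p')) into
w/(p - p') = e, a series in w alone. This is why the ring of series in u and w is suited to R̄ᵗ. -/
lemma rtt_posT_reflect {p p' e : PowerSeries K} (hp : IsUnit (p - p')) (he : (p - p') * e = X) :
    RTT (posT N c p) (posT N c p') (1 : Bi K) (C e) 1 (C e) := by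
  have h1 := rtt_posT (N := N) (c := c) p p'
  refine RTT.of_smul (va * C (p - p')) (fun x hx => ?_) ?_
  · rw [mul_smul] at hx
    exact smul_eq_zero_of_isUnit (hp.map C) _ (lau_va_smul _ hx)
  · have e1 : va * C (p - p') * C e = (va * vb : Bi K) := by rw [mul_assoc, ← map_mul, he]
    rw [mul_one, e1]
    exact h1.congr rfl (algebraMap_lau_h _) rfl (algebraMap_lau_h _)

/-- The series `h / (v - u p(w) + t)`, expanded in negative powers of `v`. -/
def posZ (p : PowerSeries K) (t : K) : PowerSeries (Bi K) :=
  C (va * vb) * invLin 1 (-(va * C p) + C (C t))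

lemma constantCoeff_posZ (p : PowerSeries K) (t : K) : constantCoeff (posZ p t) = 0 := by
  simp [posZ, constantCoeff_invLin]

/-- With the numerator written as uw instead of h, the chain relation already holds before passing
to the quotient by uw - h. -/
lemma posZ_chain {p p' : PowerSeries K} (hp : p - p' = X) (t : K) :
    posZ p' t * (1 + posZ p t) = posZ p t := by
  have h1 := invLin_sub (B := Bi K) one_ne_zero (-(va * C p) + C (C t)) (-(va * C p') + C (C t))
  have h2 : (-(va * C p') + C (C t) - (-(va * C p) + C (C t)) : Bi K) = va * vb := by
    rw [vb, ← hp, map_sub]; ring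
  rw [h2] at h1
  simp only [posZ]
  linear_combination -(C (va * vb)) * h1

lemma map_posEv_scal (p : PowerSeries K) (f : Bi K) :
    PowerSeries.map ((toLau _).comp (posEv (DY N c) p)) (scal _ f) =
      PowerSeries.map (algebraMap (Bi K) (Lau (DY N c))) (PowerSeries.map (posEv K p) f) := by
  apply PowerSeries.ext
  intro m
  simp only [scal, coeff_map, RingHom.comp_apply]
  rw [posEv_map]
  rfl

lemma map_posEv_posZ (p : PowerSeries K) (t : K) :
    PowerSeries.map ((toLau _).comp (posEv (DY N c) p)) (scal _ (hBi * invLin 1 (-X + C t))) =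
      PowerSeries.map (algebraMap (Bi K) (Lau (DY N c))) (posZ p t) := by
  rw [map_posEv_scal, map_mul, map_invLin (posEv K p)
    (fun z => by rw [PowerSeries.algebraMap_apply, posEv_C, PowerSeries.algebraMap_apply,
      PowerSeries.algebraMap_apply]) one_ne_zero, posZ, map_mul, map_mul]
  congr 1
  · rw [PowerSeries.map_C, PowerSeries.map_C, PowerSeries.map_C, posEv_C]
    congr 1
    exact algebraMap_lau_h _
  · congr 2
    simp [scal]

lemma map_posEv_gEval (p : PowerSeries K) (t : K) :
    PowerSeries.map ((toLau _).comp (posEv (DY N c) p))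
      (scal _ (gEval N (hBi * invLin 1 (-X + C t)))) =
      PowerSeries.map (algebraMap (Bi K) (Lau (DY N c))) (gEval N (posZ p t)) := by
  refine gEval_natural N ((PowerSeries.map ((toLau _).comp (posEv (DY N c) p))).comp (scal _))
    (PowerSeries.map (algebraMap (Bi K) (Lau (DY N c))))
    (by simp [constantCoeff_invLin]) (constantCoeff_posZ _ _) (fun k => ?_)
    (map_posEv_posZ p t) ?_
  · rw [RingHom.comp_apply, map_posEv_scal]
    congr 1
    simp [PowerSeries.algebraMap_apply]
  · rw [RingHom.comp_apply, map_posEv_posZ]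
    have := constantCoeff_posZ p t
    rw [← coeff_zero_eq_constantCoeff_apply] at this ⊢
    rw [coeff_map, this, map_zero]

lemma map_posEv_map_C (p : PowerSeries K) (f : PowerSeries (DY N c)) :
    PowerSeries.map ((toLau _).comp (posEv (DY N c) p)) (PowerSeries.map C f) =
      PowerSeries.map (constLau _) f := by
  apply PowerSeries.ext
  intro m
  simp [constLau]

lemma rtt_posT_mixed (p : PowerSeries K) :
    RTT ((Tmat tGen).map (PowerSeries.map (constLau _))) ((posT N c p).map C)
      (gEval N (posZ p ((c / 2) • h)))
      (gEval N (posZ p ((c / 2) • h)) * posZ p ((c / 2) • h))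
      (gEval N (posZ p (-((c / 2) • h))))
      (gEval N (posZ p (-((c / 2) • h))) * posZ p (-((c / 2) • h))) := by
  have e : (-X - C ((c / 2) • h) : PowerSeries K) = -X + C (-((c / 2) • h)) := by
    rw [map_neg, sub_eq_add_neg]
  have := rtt_mixed (N := N) (c := c) (PowerSeries.map ((toLau _).comp (posEv (DY N c) p)))
    (map_posEv_gEval p _).symm (map_posEv_posZ p _).symm
    (by rw [e]; exact (map_posEv_gEval p _).symm)
    (by rw [e]; exact (map_posEv_posZ p _).symm)
  simp only [map_posEv_map_C, PowerSeries.map_C] at this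
  exact this

lemma rtt_posT_outer (p : PowerSeries K) :
    RTT ((Tplus tGen).map (PowerSeries.map (constLau _))) ((posT N c p).map C)
      (X - C (va * C p) : PowerSeries (Bi K)) (C (va * vb)) (X - C (va * C p)) (C (va * vb)) := by
  have := rtt_Tplus (N := N) (c := c) (PowerSeries.map ((toLau _).comp (posEv (DY N c) p)))
    (α := (X - C (va * C p) : PowerSeries (Bi K))) (β := C (va * vb))
    (by rw [map_posEv_scal, algebraMap_powerSeries]; congr 1; simp [scal])
    (by
      rw [map_posEv_scal, algebraMap_powerSeries, PowerSeries.map_C, PowerSeries.map_C,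
        PowerSeries.map_C, posEv_C]
      congr 1
      exact (algebraMap_lau_h _).symm)
  simp only [map_posEv_map_C, PowerSeries.map_C] at this
  exact this

/-- At v = 0 each factor becomes -u p or -u (p + w). Since p has an invertible constant term, both
are a unit times u, which is not a zero divisor. -/
lemma pos_outer_regular {p : Fin N → PowerSeries K} (hp : ∀ i, IsUnit (constantCoeff (p i)))
    (q : ℕ → Prop) [DecidablePred q] (x : PowerSeries (Lau (DY N c)))
    (hx : (∏ i : Fin N, if q i then X - C (va * C (p i)) - C (va * vb) else X - C (va * C (p i))
      : PowerSeries (Bi K)) • x = 0) : x = 0 := by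
  refine smul_eq_zero_of_prod (fun i _ x hx => ?_) x hx
  refine smul_eq_zero_of_constantCoeff (fun x hx => ?_) x hx
  split_ifs at hx
  · have e : constantCoeff (X - C (va * C (p i)) - C (va * vb) : PowerSeries (Bi K)) =
        va * C (-(p i + X)) := by
      simp only [map_sub, constantCoeff_X, constantCoeff_C, map_neg, map_add]; ring
    rw [e, mul_smul] at hx
    refine smul_eq_zero_of_isUnit (IsUnit.map C (IsUnit.neg ?_)) _ (lau_va_smul _ hx)
    rw [isUnit_iff_constantCoeff]
    simpa using hp i
  · have e : constantCoeff (X - C (va * C (p i)) : PowerSeries (Bi K)) = va * C (-p i) := by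
      simp only [map_sub, constantCoeff_X, constantCoeff_C, map_neg]; ring
    rw [e, mul_smul] at hx
    refine smul_eq_zero_of_isUnit (IsUnit.map C (IsUnit.neg ?_)) _ (lau_va_smul _ hx)
    rw [isUnit_iff_constantCoeff]
    exact hp i

lemma commute_constLau_of_power {d : Lau (DY N c)} {f : PowerSeries (DY N c)}
    (hd : C d * PowerSeries.map (constLau _) f = PowerSeries.map (constLau _) f * C d) (n : ℕ) :
    Commute d (constLau _ (coeff n f)) := by
  have := congrArg (coeff n) hd
  rw [coeff_mul_C, coeff_C_mul, coeff_map] at this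
  exact this

lemma constLau_algebraMap (k : K) :
    constLau (DY N c) (algebraMap K _ k) = algebraMap (Bi K) (Lau (DY N c)) (C (C k)) := by
  rw [algebraMap_lau, constLau]; simp [scal]

lemma commute_constLau_of_T {d : Lau (DY N c)}
    (hT : ∀ i j, C d * (Tmat tGen).map (PowerSeries.map (constLau _)) i j =
      (Tmat tGen).map (PowerSeries.map (constLau _)) i j * C d)
    (hTp : ∀ i j, C d * (Tplus tGen).map (PowerSeries.map (constLau _)) i j =
      (Tplus tGen).map (PowerSeries.map (constLau _)) i j * C d) (x : DY N c) :
    Commute d (constLau _ x) := by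
  refine commute_of_commute_coeff (constLau _) (fun z hz => lau_h_smul z ?_)
    (fun k => ?_) (fun a b r => commute_constLau_of_power (hT a b) r)
    (fun a b r => commute_constLau_of_power (hTp a b) r) x
  · rw [constLau_algebraMap] at hz
    rwa [Algebra.smul_def]
  · rw [constLau_algebraMap]
    exact (Algebra.commutes _ _).symm

/-- As for T(u): the relation among the T⁺ has equal scalars on its two sides, and in the mixed
relation both are 1. In the given relations the auxiliary matrix stands to the left of T⁺, so the
version with reversed order applies. -/
lemma posT_eigenvalue_comm {p : Fin N → PowerSeries K} (hp0 : ∀ i, IsUnit (constantCoeff (p i)))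
    (hp : ∀ i j : Fin N, (j : ℕ) = i + 1 → p i - p j = X) {d : Lau (DY N c)}
    (hd : Matrix.vecMul (altVec N _) ((List.finRange N).map fun i => siteOp i (posT N c (p i))).prod
      = d • altVec N _) (x : DY N c) : Commute d (constLau _ x) := by
  have hd' := vecMul_siteProd_map (C : Lau (DY N c) →+* _) hd
  refine commute_constLau_of_T (fun a b => ?_) (fun a b => ?_) x
  · have := mul_eigenvalue_comm hd' _ _ _ _ _ (fun i => rtt_posT_mixed (p i))
      (fun i j hij => ?_) (fun i j hij => ?_) a b
    · rw [prod_gEval_reverse, prod_gEval_reverse, one_smul, one_smul] at this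
      · exact this.symm
      · exact fun i => constantCoeff_posZ _ _
      · exact fun i j hij => posZ_chain (hp i j hij) _
      · exact fun i => constantCoeff_posZ _ _
      · exact fun i j hij => posZ_chain (hp i j hij) _
    · have := posZ_chain (hp i j hij) ((c / 2) • h)
      linear_combination (gEval N (posZ (p i) ((c / 2) • h)) *
        gEval N (posZ (p j) ((c / 2) • h))) * this
    · have := posZ_chain (hp i j hij) (-((c / 2) • h))
      linear_combination (gEval N (posZ (p i) (-((c / 2) • h))) *
        gEval N (posZ (p j) (-((c / 2) • h)))) * this
  · have := mul_eigenvalue_comm hd' _ _ _ _ _ (fun i => rtt_posT_outer (p i))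
      (fun i j hij => ?_) (fun i j hij => ?_) a b
    · rw [← sub_eq_zero, ← smul_sub] at this
      exact (sub_eq_zero.1 (pos_outer_regular hp0 (fun i => i = 0) _ this)).symm
    all_goals
      have e : p i = p j + X := by rw [← hp i j hij]; ring
      rw [e]
      simp only [map_mul, map_add]
      ring

lemma posT_transpose_eigenvalue_comm {p : Fin N → PowerSeries K}
    (hp0 : ∀ i, IsUnit (constantCoeff (p i)))
    (hp : ∀ i j : Fin N, (j : ℕ) = i + 1 → p j - p i = X) {d : Lau (DY N c)}
    (hd : Matrix.vecMul (altVec N _)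
      ((List.finRange N).map fun i => siteOp i (posT N c (p i)).transpose).prod
      = d • altVec N _) (x : DY N c) : Commute d (constLau _ x) := by
  have hd' := vecMul_siteProd_map (C : Lau (DY N c) →+* _) hd
  refine commute_constLau_of_T (fun a b => ?_) (fun a b => ?_) x
  · have := eigenvalue_mul_comm hd' _ _ _ _ _ (fun i => (rtt_posT_mixed (p i)).transpose)
      (fun i j hij => ?_) (fun i j hij => ?_) b a
    · rw [prod_gEval, prod_gEval, one_smul, one_smul] at this
      · exact this
      · exact fun i => constantCoeff_posZ _ _
      · exact fun i j hij => posZ_chain (hp i j hij) _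
      · exact fun i => constantCoeff_posZ _ _
      · exact fun i j hij => posZ_chain (hp i j hij) _
    · have := posZ_chain (hp i j hij) (-((c / 2) • h))
      linear_combination (gEval N (posZ (p i) (-((c / 2) • h))) *
        gEval N (posZ (p j) (-((c / 2) • h)))) * this
    · have := posZ_chain (hp i j hij) ((c / 2) • h)
      linear_combination (gEval N (posZ (p i) ((c / 2) • h)) *
        gEval N (posZ (p j) ((c / 2) • h))) * this
  · have := eigenvalue_mul_comm hd' _ _ _ _ _ (fun i => (rtt_posT_outer (p i)).transpose)
      (fun i j hij => ?_) (fun i j hij => ?_) b a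
    · rw [← sub_eq_zero, ← smul_sub] at this
      exact sub_eq_zero.1 (pos_outer_regular hp0 (fun i => i + 1 = N) _ this)
    all_goals
      have e : p j = p i + X := by rw [← hp i j hij]; ring
      rw [e]
      simp only [map_mul, map_add]
      ring

variable {G : Matrix (Fin N) (Fin N) ℂ}

/-- The scalar `1 - i w`. -/
def shiftP (i : ℕ) : PowerSeries K := 1 - C (i : K) * X

/-- The product `S⁺_{[N]}(u_-)` in the ring of series in `u` and `w = h u⁻¹`. -/
def posBracket (c : ℂ) (G : Matrix (Fin N) (Fin N) ℂ) : SiteOp (Fin N) N (Lau (DY N c)) :=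
  rowProd (fun i => siteOp i (posT N c (shiftP i) *
      ((scalMat G).map C).map (algebraMap (Bi K) (Lau (DY N c))) *
        (posT N c (-shiftP i)).transpose))
      (reflR (fun i j => C (gEval N (invLin (-2) ((i + j : ℕ) : K))))
        fun i j => C (invLin (-2) ((i + j : ℕ) : K))) (List.finRange N)

/-- The alternating form is an eigenvector of `S⁺_{[N]}(u_-)`, with a central eigenvalue. -/
theorem posBracket_eigenvalue (hG : G.transpose = G ∨ G.transpose = -G) :
    ∃ y : Lau (DY N c),
      Matrix.vecMul (altVec N _) (posBracket c G) = y • altVec N _ ∧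
      ∀ x : DY N c, Commute y (constLau _ x) := by
  have hp : ∀ i j : Fin N, (j : ℕ) = i + 1 → shiftP (i : ℕ) - shiftP (j : ℕ) = X := by
    intro i j hij
    simp only [shiftP, hij]
    push_cast
    rw [map_add, map_one]
    ring
  have hp' : ∀ i j : Fin N, (j : ℕ) = i + 1 → -shiftP (j : ℕ) - -shiftP (i : ℕ) = X := by
    intro i j hij
    rw [← hp i j hij]; ring
  have hu : ∀ i : ℕ, IsUnit (constantCoeff (shiftP i)) := by
    intro i; simp [shiftP]
  have hu' : ∀ i : ℕ, IsUnit (constantCoeff (-shiftP i)) := by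
    intro i; rw [map_neg]; exact (hu i).neg
  have hG' : ((scalMat G).map (C : PowerSeries K →+* Bi K)).transpose = (scalMat G).map C ∨
      ((scalMat G).map (C : PowerSeries K →+* Bi K)).transpose = -(scalMat G).map C := by
    rcases scalMat_symm hG with h1 | h1
    · left; rw [← Matrix.transpose_map, h1]
    · right; rw [← Matrix.transpose_map, h1]; ext i j : 2; simp
  obtain ⟨d, d', θ, hd, hd', H⟩ := rowProd_eigenvalue (R := Lau (DY N c))
    isUnit_two_of_algebra ((scalMat G).map C) hG'
    (fun i => posT N c (shiftP i)) (fun i => (posT N c (-shiftP i)).transpose)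
    (fun i j => C (gEval N (invLin (-2) ((i + j : ℕ) : K))))
    (fun k => C (invLin (-2) (k : K))) (fun k => by
      have e := invLin_sub (B := K) (α := -2) (by norm_num) (k : K) ((k + 1 : ℕ) : K)
      rw [show (((k + 1 : ℕ) : K) - (k : K)) = 1 by push_cast; ring, map_one, one_mul] at e
      rw [← map_sub, e, map_mul])
    (fun i j hij => rtt_posT_adjacent (hp i j hij))
    (fun i j hij => (rtt_posT_adjacent (hp' i j hij)).transpose)
    (fun i j hij => by
      have e := invLin_mul (B := K) (α := -2) (by norm_num) ((i + j : ℕ) : K)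
      -- Multiplied by u this is -2u + (i + j)h, the argument of R̄ᵗ_ij in S⁺_{[N]}(u_-).
      have e2 : -shiftP i - shiftP j =
          C (algebraMap ℂ K (-2)) + C (((i + j : ℕ) : K)) * X := by
        simp only [shiftP, map_neg, map_ofNat]
        push_cast
        rw [map_add]
        ring
      refine rtt_posT_reflect ?_ ?_
      · rw [e2]; exact isUnit_linear (by norm_num) _
      · rw [e2, mul_comm]; exact e)
  refine ⟨_, H, fun x => ?_⟩
  refine ((posT_eigenvalue_comm (fun i => hu i) hp hd x).mul_left ?_).mul_left
    (posT_transpose_eigenvalue_comm (fun i => hu' i) hp' hd' x)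
  exact Algebra.commutes _ _

end PositiveHalf

/-! ### Convolution of series in a topology given by left ideals. -/

section LinearTopology

open Filter Topology

/-- A basis of neighbourhoods of zero of a `K`-algebra that consists of left ideals and is coarser
than the `h`-adic topology. -/
structure LinTop (E : Type*) [Ring E] [Algebra K E] [TopologicalSpace E] where
  U : ℕ → Ideal E
  basis : (𝓝 (0 : E)).HasBasis (fun _ => True) fun n => (U n : Set E)
  smul_mem : ∀ n (z : E), h ^ n • z ∈ U n

variable {E : Type*} [Ring E] [Algebra K E] [UniformSpace E] [IsUniformAddGroup E]
  [IsTopologicalRing E] [CompleteSpace E] [T2Space E] (τ : LinTop E)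

lemma LinTop.nonarchimedean (τ : LinTop E) : NonarchimedeanAddGroup E where
  is_nonarchimedean := by
    intro V hV
    obtain ⟨n, -, hn⟩ := τ.basis.mem_iff.1 hV
    exact ⟨⟨(τ.U n).toAddSubgroup,
      AddSubgroup.isOpen_of_mem_nhds _ (τ.basis.mem_of_mem (i := n) trivial)⟩, hn⟩

lemma LinTop.summable {ι : Type*} {f : ι → E} (hf : ∀ n, {i | f i ∉ τ.U n}.Finite) :
    Summable f := by
  have := τ.nonarchimedean
  apply NonarchimedeanAddGroup.summable_of_tendsto_cofinite_zero
  rw [τ.basis.tendsto_right_iff]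
  intro n _
  exact hf n

/-- The values at `e → -∞` tend to zero `h`-adically. -/
def IsGood (F : ℤ → E) : Prop := ∀ n : ℕ, ∃ q : ℤ, ∀ e < q, ∃ w, F e = h ^ n • w

/-- The values at `e → -∞` tend to zero. -/
def IsNull (Z : ℤ → E) : Prop := ∀ n : ℕ, ∃ q : ℤ, ∀ e < q, Z e ∈ τ.U n

/-- The product of the coefficients with the exponents `e` of the series in the list. -/
def termProd (l : List (ℤ → E)) (e : Fin l.length → ℤ) : E :=
  (List.ofFn fun j => l.get j (e j)).prod

lemma termProd_cons (F : ℤ → E) (l : List (ℤ → E)) (e : Fin (F :: l).length → ℤ) :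
    termProd (F :: l) e = F (e 0) * termProd l fun j => e j.succ := by
  rw [termProd]
  refine (congrArg List.prod (List.ofFn_succ (n := l.length))).trans ?_
  rw [List.prod_cons]
  rfl

/-- The coefficients of the product of two series. -/
def conv (F Z : ℤ → E) (k : ℤ) : E := ∑' e, F e * Z (k - e)

variable {τ}

lemma finite_of_lower_bounds {ι : Type*} [Fintype ι] (k q : ℤ) :
    {e : {e : ι → ℤ // ∑ j, e j = k} | ∀ j, q ≤ e.1 j}.Finite := by
  classical
  -- If all entries are at least q and their sum is k, a single entry is at most k minus q for each
  -- of the others.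
  set B : ℤ := k - (Fintype.card ι : ℤ) * q + q with hB
  have h1 : (Set.Icc (fun _ : ι => q) (fun _ : ι => B)).Finite := Set.finite_Icc _ _
  refine (h1.preimage (Subtype.val_injective.injOn)).subset ?_
  rintro ⟨e, he⟩ hq
  refine ⟨fun j => hq j, fun j => ?_⟩
  have h2 : ∑ i, (e i - q) = k - (Fintype.card ι : ℤ) * q := by
    rw [Finset.sum_sub_distrib, he]; simp
  have h3 := Finset.single_le_sum (f := fun i => e i - q)
    (fun i _ => sub_nonneg.2 (hq i)) (Finset.mem_univ j)
  rw [h2] at h3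
  simp only [hB]
  linarith

/-- The two factors play different roles. F becomes divisible by powers of the central element h,
which helps on either side; Z only enters left ideals, and these absorb the factor F on its left. -/
lemma summable_conv {F Z : ℤ → E} (hF : IsGood F) (hZ : IsNull τ Z) (k : ℤ) :
    Summable fun e => F e * Z (k - e) := by
  refine τ.summable fun n => ?_
  obtain ⟨q, hq⟩ := hF n
  obtain ⟨q', hq'⟩ := hZ n
  refine (Set.finite_Icc q (k - q')).subset fun e he => ?_
  refine ⟨?_, ?_⟩
  · by_contra hlt
    obtain ⟨w, hw⟩ := hq e (not_le.1 hlt)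
    exact he (by rw [hw, smul_mul_assoc]; exact τ.smul_mem _ _)
  · by_contra hlt
    exact he (Ideal.mul_mem_left _ _ (hq' _ (by linarith [not_le.1 hlt])))

lemma IsGood.isNull {τ : LinTop E} {F : ℤ → E} (hF : IsGood F) : IsNull τ F := fun n => by
  obtain ⟨q, hq⟩ := hF n
  refine ⟨q, fun e he => ?_⟩
  obtain ⟨w, hw⟩ := hq e he
  rw [hw]
  exact τ.smul_mem _ _

/-- Modulo each left ideal of the basis only finitely many pairs of exponents contribute to the
triple product, so the double series converges unconditionally and the summations may be exchanged.
-/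
lemma conv_assoc {F F' Z : ℤ → E} (hF : IsGood F) (hF' : IsGood F') (hZ : IsNull τ Z) (k : ℤ) :
    conv F (conv F' Z) k = conv (conv F F') Z k := by
  have hs : Summable (Function.uncurry fun e m : ℤ => F e * F' (m - e) * Z (k - m)) := by
    refine τ.summable fun n => ?_
    obtain ⟨q, hq⟩ := hF n
    obtain ⟨q', hq'⟩ := hF' n
    obtain ⟨q'', hq''⟩ := hZ n
    refine (Set.finite_Icc ((q, q + q') : ℤ × ℤ) ((k - q'' - q', k - q'') : ℤ × ℤ)).subset
      fun ⟨e, m⟩ he => ?_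
    have h1 : q ≤ e := by
      by_contra hlt
      obtain ⟨w, hw⟩ := hq e (not_le.1 hlt)
      refine he ?_
      simp only [Function.uncurry, hw, smul_mul_assoc]
      exact τ.smul_mem _ _
    have h2 : q' ≤ m - e := by
      by_contra hlt
      obtain ⟨w, hw⟩ := hq' (m - e) (not_le.1 hlt)
      refine he ?_
      simp only [Function.uncurry, hw, smul_mul_assoc, mul_smul_comm]
      exact τ.smul_mem _ _
    have h3 : q'' ≤ k - m := by
      by_contra hlt
      exact he (Ideal.mul_mem_left _ _ (hq'' _ (not_le.1 hlt)))
    exact ⟨⟨h1, by simp only; linarith⟩, ⟨by simp only; linarith, by simp only; linarith⟩⟩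
  have e1 : ∀ e, F e * conv F' Z (k - e) = ∑' m, F e * F' (m - e) * Z (k - m) := by
    intro e
    rw [conv, ← Summable.tsum_mul_left _ (summable_conv hF' hZ (k - e)),
      ← (Equiv.subRight e).tsum_eq]
    refine tsum_congr fun m => ?_
    simp only [Equiv.subRight_apply, mul_assoc]
    congr 3
    ring
  have e2 : ∀ m, conv F F' m * Z (k - m) = ∑' e, F e * F' (m - e) * Z (k - m) := by
    intro m
    rw [conv, ← Summable.tsum_mul_right _ (summable_conv hF (hF'.isNull (τ := τ)) m)]
  rw [conv, conv]
  simp only [e1, e2]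
  exact hs.tsum_comm.symm

lemma LinTop.tsum_mem {ι : Type*} {f : ι → E} {n : ℕ} (hf : ∀ i, f i ∈ τ.U n) :
    ∑' i, f i ∈ τ.U n := by
  have ho : IsOpen ((τ.U n).toAddSubgroup : Set E) :=
    AddSubgroup.isOpen_of_mem_nhds _ (τ.basis.mem_of_mem (i := n) trivial)
  have hc : IsClosed ((τ.U n).toAddSubgroup : Set E) := AddSubgroup.isClosed_of_isOpen _ ho
  by_cases hs : Summable f
  · exact hc.mem_of_tendsto hs.hasSum (Filter.Eventually.of_forall fun s => sum_mem fun i _ => hf i)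
  · rw [tsum_eq_zero_of_not_summable hs]; exact zero_mem _

lemma IsNull.conv {F Z : ℤ → E} (hF : IsGood F) (hZ : IsNull τ Z) : IsNull τ (conv F Z) := by
  intro n
  obtain ⟨q, hq⟩ := hF n
  obtain ⟨q', hq'⟩ := hZ n
  refine ⟨q + q', fun e he => LinTop.tsum_mem fun e1 => ?_⟩
  by_cases h1 : e1 < q
  · obtain ⟨w, hw⟩ := hq e1 h1
    rw [hw, smul_mul_assoc]
    exact τ.smul_mem _ _
  · exact Ideal.mul_mem_left _ _ (hq' _ (by linarith [not_lt.1 h1]))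

/-- Lists of series with a well defined product, together with the product. -/
inductive IsFactorList (τ : LinTop E) : List (ℤ → E) → (ℤ → E) → Prop
  | single {Z : ℤ → E} (hZ : IsNull τ Z) : IsFactorList τ [Z] Z
  | cons {F : ℤ → E} {l : List (ℤ → E)} {W : ℤ → E} (hF : IsGood F) (hl : IsFactorList τ l W) :
      IsFactorList τ (F :: l) (conv F W)

lemma IsFactorList.isNull {l : List (ℤ → E)} {W : ℤ → E} (hl : IsFactorList τ l W) :
    IsNull τ W := by
  induction hl with
  | single hZ => exact hZ
  | cons hF _ ih => exact ih.conv hF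

/-- One very negative exponent already makes the whole product small: in a good factor it produces a
power of the central h, in the last factor a member of the left ideal, which survives multiplication
from the left. -/
lemma IsFactorList.termProd_mem {l : List (ℤ → E)} {W : ℤ → E} (hl : IsFactorList τ l W) (n : ℕ) :
    ∃ q : ℤ, ∀ e : Fin l.length → ℤ, (∃ j, e j < q) → termProd l e ∈ τ.U n := by
  induction hl with
  | single hZ =>
    obtain ⟨q, hq⟩ := hZ n
    refine ⟨q, fun e ⟨j, hj⟩ => ?_⟩
    have h0 : j = 0 := Fin.ext (by have := j.2; simp at this ⊢)
    subst h0
    rw [termProd_cons]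
    have : termProd ([] : List (ℤ → E)) (fun j => e j.succ) = 1 := rfl
    rw [this, mul_one]
    exact hq _ hj
  | @cons F l W hF hl ih =>
    obtain ⟨q, hq⟩ := hF n
    obtain ⟨q', hq'⟩ := ih
    refine ⟨min q q', fun e ⟨j, hj⟩ => ?_⟩
    rw [termProd_cons]
    by_cases h0 : e 0 < q
    · obtain ⟨w, hw⟩ := hq _ h0
      rw [hw, smul_mul_assoc]
      exact τ.smul_mem _ _
    · refine Ideal.mul_mem_left _ _ (hq' _ ?_)
      obtain rfl | ⟨j, rfl⟩ := Fin.eq_zero_or_eq_succ (n := l.length) j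
      · exact absurd (lt_of_lt_of_le hj (min_le_left _ _)) h0
      · exact ⟨j, lt_of_lt_of_le hj (min_le_right _ _)⟩

lemma IsFactorList.summable {l : List (ℤ → E)} {W : ℤ → E} (hl : IsFactorList τ l W) (k : ℤ) :
    Summable fun e : {e : Fin l.length → ℤ // ∑ j, e j = k} => termProd l e.1 := by
  refine τ.summable fun n => ?_
  obtain ⟨q, hq⟩ := hl.termProd_mem n
  refine (finite_of_lower_bounds k q).subset fun e he j => ?_
  by_contra hj
  exact he (hq _ ⟨j, not_le.1 hj⟩)

/-- The sum of the products of coefficients is the iterated convolution. -/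
lemma IsFactorList.hasSum {l : List (ℤ → E)} {W : ℤ → E} (hl : IsFactorList τ l W) (k : ℤ) :
    HasSum (fun e : {e : Fin l.length → ℤ // ∑ j, e j = k} => termProd l e.1) (W k) := by
  induction hl generalizing k with
  | @single Z hZ =>
    have key : ∀ e : {e : Fin [Z].length → ℤ // ∑ j, e j = k}, e.1 0 = k := by
      rintro ⟨e, he⟩
      exact (Fin.sum_univ_one (f := e)).symm.trans he
    have e1 : ∀ e : {e : Fin [Z].length → ℤ // ∑ j, e j = k}, termProd [Z] e.1 = Z k := by
      intro e
      rw [termProd_cons, key e]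
      exact mul_one _
    let e0 : {e : Fin [Z].length → ℤ // ∑ j, e j = k} :=
      ⟨fun _ => k, Fin.sum_univ_one (f := fun _ => k)⟩
    have h1 := hasSum_single (f := fun e : {e : Fin [Z].length → ℤ // ∑ j, e j = k} =>
      termProd [Z] e.1) e0 (fun e he => by
        refine absurd (Subtype.ext (funext fun j => ?_)) he
        have h0 : j = 0 := Fin.ext (by have := j.2; simp at this ⊢)
        rw [h0]
        exact key e)
    rw [e1] at h1
    exact h1
  | @cons F l W hF hl ih =>
    -- Separate the exponent of the first factor; the rest is an exponent vector of the shorter list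
    -- with the complementary sum.
    let ε : (Σ e0 : ℤ, {e : Fin l.length → ℤ // ∑ j, e j = k - e0}) ≃
        {e : Fin (F :: l).length → ℤ // ∑ j, e j = k} :=
      { toFun := fun x => ⟨Fin.cons (α := fun _ => ℤ) x.1 x.2.1, by
          refine (Fin.sum_univ_succ (n := l.length) _).trans ?_
          simp [x.2.2]⟩
        invFun := fun e => ⟨e.1 0, fun j => e.1 j.succ, by
          have : e.1 0 + ∑ j : Fin l.length, e.1 j.succ = k :=
            (Fin.sum_univ_succ (n := l.length) e.1).symm.trans e.2
          linarith⟩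
        left_inv := fun x => rfl
        right_inv := fun e => Subtype.ext (Fin.cons_self_tail (α := fun _ => ℤ) e.1) }
    rw [← ε.hasSum_iff]
    have hterm : ∀ x, termProd (F :: l) (ε x).1 = F x.1 * termProd l x.2.1 := by
      intro x
      rw [termProd_cons]
      rfl
    refine HasSum.sigma_of_hasSum (g := fun e => F e * W (k - e)) ?_ ?_ ?_
    · exact (summable_conv hF hl.isNull k).hasSum
    · intro e
      simp only [Function.comp_def, hterm]
      exact (ih (k - e)).mul_left _
    · exact (ε.summable_iff).2 ((IsFactorList.cons hF hl).summable k)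

lemma IsFactorList.of_append {l : List (ℤ → E)} (hl : ∀ F ∈ l, IsGood F) {Z : ℤ → E}
    (hZ : IsNull τ Z) : IsFactorList τ (l ++ [Z]) (l.foldr TwistedYangian.conv Z) := by
  induction l with
  | nil => exact .single hZ
  | cons F l ih => exact .cons (hl F (by simp)) (ih fun F hF => hl F (by simp [hF]))

end LinearTopology

/-! ### The linear topologies of the completed double Yangian and of matrices over it. -/

section CompletionTopology

open Filter Topology

variable {N : ℕ} [NeZero N] {c : ℂ}

lemma denseRange_toDYc : DenseRange (toDYc (N := N) c) :=
  UniformSpace.Completion.denseRange_coe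

lemma nhds_zero_DY :
    (𝓝 (0 : DY N c)).HasBasis (fun _ => True) fun n => (nbhd N c n n : Set (DY N c)) := by
  refine ((nbhd_basis N c).hasBasis_nhds_zero).to_hasBasis (fun i _ => ?_) fun n _ => ?_
  · exact ⟨max i.1 i.2, trivial, nbhd_anti (le_max_left _ _) (le_max_right _ _)⟩
  · exact ⟨(n, n), trivial, subset_rfl⟩

variable (N c) in
/-- The closures of the left ideals `I_n + h ^ n DY_c(gl_N)`. -/
def closedNbhd (n : ℕ) : Ideal (DYc N c) where
  carrier := closure (toDYc c '' (nbhd N c n n : Set (DY N c)))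
  zero_mem' := subset_closure ⟨0, zero_mem _, map_zero _⟩
  add_mem' := fun {x y} hx hy => map_mem_closure₂ continuous_add hx hy (by
    rintro _ ⟨x, hx, rfl⟩ _ ⟨y, hy, rfl⟩
    exact ⟨x + y, add_mem hx hy, map_add _ _ _⟩)
  smul_mem' := fun a {x} hx => map_mem_closure₂ (f := fun a x : DYc N c => a * x) continuous_mul
    (s := Set.range (toDYc c)) (denseRange_toDYc a) hx (by
      rintro _ ⟨a, rfl⟩ _ ⟨x, hx, rfl⟩
      exact ⟨a * x, Ideal.mul_mem_left _ _ hx, map_mul _ _ _⟩)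

lemma toDYc_mem_closedNbhd {n : ℕ} {x : DY N c} (hx : x ∈ nbhd N c n n) :
    toDYc c x ∈ closedNbhd N c n := subset_closure ⟨x, hx, rfl⟩

variable (N c) in
/-- The topology of the completed double Yangian is linear. -/
def linTopDYc : LinTop (DYc N c) where
  U := closedNbhd N c
  basis := by
    have h1 := nhds_zero_DY.hasBasis_of_isDenseInducing
      (UniformSpace.Completion.isDenseInducing_coe (α := DY N c))
    rw [UniformSpace.Completion.coe_zero] at h1
    exact h1
  smul_mem := fun n z => by
    refine map_mem_closure (s := Set.range (toDYc c)) (f := fun z : DYc N c => h ^ n • z)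
      (continuous_const_smul _) (denseRange_toDYc z) ?_
    rintro _ ⟨x, rfl⟩
    exact ⟨h ^ n • x, smul_mem_nbhd _ _ _ dvd_rfl, map_smul _ _ _⟩

variable {E : Type*} [Ring E] [Algebra K E] [TopologicalSpace E]

/-- The linear topology of the ring of matrices. -/
def LinTop.matrix (τ : LinTop E) (ι : Type*) [Fintype ι] [DecidableEq ι] :
    LinTop (Matrix ι ι E) where
  U := fun n => (τ.U n).matrix ι
  basis := by
    have h1 : (𝓝 (0 : ι → ι → E)).HasBasis (fun _ => True)
        fun n => {M : ι → ι → E | ∀ i j, M i j ∈ τ.U n} := by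
      refine ⟨fun t => ⟨fun ht => ?_, ?_⟩⟩
      · rw [nhds_pi] at ht
        have e : ∀ i : ι, 𝓝 ((0 : ι → ι → E) i) = Filter.pi fun _ : ι => 𝓝 (0 : E) :=
          fun i => nhds_pi
        simp only [e] at ht
        obtain ⟨⟨I, J, n⟩, ⟨hI, hJ, -⟩, hsub⟩ := τ.basis.pi_self.pi_self.mem_iff.1 ht
        exact ⟨n, trivial, fun M hM => hsub fun i _ j _ => hM i j⟩
      · rintro ⟨n, -, hn⟩
        refine mem_of_superset ?_ hn
        have h2 : ∀ i j, ∀ᶠ M : ι → ι → E in 𝓝 0, M i j ∈ τ.U n := by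
          intro i j
          have hc : Tendsto (fun M : ι → ι → E => M i j) (𝓝 0) (𝓝 0) :=
            ((continuous_apply j).comp (continuous_apply i)).tendsto 0
          exact hc (τ.basis.mem_of_mem (i := n) trivial)
        exact eventually_all.2 fun i => eventually_all.2 fun j => h2 i j
    exact h1
  smul_mem := fun n z => (Ideal.mem_matrix _ _ _).2 fun i j => τ.smul_mem n (z i j)

end CompletionTopology

/-! ### Laurent coefficients of series in u and w = h/u. -/

section LaurentCoefficients

variable {N : ℕ} [NeZero N] {c : ℂ}

lemma LinTop.smul_mem_of_le {E : Type*} [Ring E] [Algebra K E] [TopologicalSpace E] (τ : LinTop E)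
    {m n : ℕ} (hmn : n ≤ m) (z : E) : h ^ m • z ∈ τ.U n := by
  obtain ⟨d, rfl⟩ := Nat.exists_eq_add_of_le hmn
  rw [pow_add, mul_smul]
  exact τ.smul_mem _ _

/-- The coefficient of `u ^ m w ^ b`. -/
def biCoeff {A : Type*} [Ring A] (f : Bi A) (m : ℤ) (b : ℕ) : A :=
  if 0 ≤ m then coeff b (coeff m.toNat f) else 0

lemma biCoeff_nat {A : Type*} [Ring A] (f : Bi A) (m b : ℕ) :
    biCoeff f m b = coeff b (coeff m f) := by
  simp [biCoeff]

lemma biCoeff_neg {A : Type*} [Ring A] (f : Bi A) {m : ℤ} (hm : m < 0) (b : ℕ) :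
    biCoeff f m b = 0 := if_neg (not_le.2 hm)

lemma biCoeff_add {A : Type*} [Ring A] (f g : Bi A) (m : ℤ) (b : ℕ) :
    biCoeff (f + g) m b = biCoeff f m b + biCoeff g m b := by
  simp only [biCoeff]; split_ifs <;> simp

/-- The summands of the coefficient of `u ^ k` in `f`, where `w = h u⁻¹`. -/
def rhoTerm (k : ℤ) (f : Bi (DY N c)) (b : ℕ) : DYc N c := h ^ b • toDYc c (biCoeff f (k + b) b)

lemma summable_smul (j : ℕ → ℕ) (hj : ∀ n, {b | j b < n}.Finite) (x : ℕ → DYc N c) :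
    Summable fun b => h ^ j b • x b := by
  refine (linTopDYc N c).summable fun n => (hj n).subset fun b hb => ?_
  by_contra hlt
  exact hb ((linTopDYc N c).smul_mem_of_le (not_lt.1 hlt) _)

lemma summable_rhoTerm (k : ℤ) (f : Bi (DY N c)) : Summable (rhoTerm k f) :=
  summable_smul (fun b => b) (fun n => Set.finite_lt_nat n) _

/-- The coefficient of `u ^ k` in `f`, where `w = h u⁻¹`. -/
def rhoBi (k : ℤ) : Bi (DY N c) →+ DYc N c where
  toFun f := ∑' b, rhoTerm k f b
  map_zero' := by
    have : ∀ b, rhoTerm k (0 : Bi (DY N c)) b = 0 := fun b => by simp [rhoTerm, biCoeff]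
    simp [this]
  map_add' f g := by
    rw [← (summable_rhoTerm k f).tsum_add (summable_rhoTerm k g)]
    refine tsum_congr fun b => ?_
    rw [rhoTerm, biCoeff_add, map_add, smul_add]
    rfl

lemma rhoBi_apply (k : ℤ) (f : Bi (DY N c)) : rhoBi k f = ∑' b, rhoTerm k f b := rfl

lemma rhoBi_h (k : ℤ) (f : Bi (DY N c)) : rhoBi k (scal _ hBi * f) = h • rhoBi k f := by
  rw [rhoBi_apply, rhoBi_apply, ← (summable_rhoTerm k f).tsum_const_smul]
  refine tsum_congr fun b => ?_
  have : biCoeff (scal _ hBi * f) (k + b) b = h • biCoeff f (k + b) b := by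
    simp only [biCoeff]
    split_ifs
    · exact coeff_scal_h f _ _
    · simp
  rw [rhoTerm, rhoTerm, this, map_smul, smul_comm]

/-- Multiplication by uw shifts both exponents by one, which leaves the power u^k unchanged and
costs one further factor h. Hence the coefficient functional kills uw - h. -/
lemma rhoBi_uw (k : ℤ) (f : Bi (DY N c)) : rhoBi k (scal _ (va * vb) * f) = h • rhoBi k f := by
  rw [rhoBi_apply, rhoBi_apply, (summable_rhoTerm k _).tsum_eq_zero_add,
    ← (summable_rhoTerm k f).tsum_const_smul, map_mul, mul_assoc]
  have e0 : rhoTerm k (scal _ va * (scal _ vb * f)) 0 = 0 := by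
    have : biCoeff (scal _ va * (scal _ vb * f)) (k + (0 : ℕ)) 0 = 0 := by
      simp only [biCoeff]
      split_ifs
      · rw [← mul_assoc, ← map_mul (scal _), mul_comm va vb, map_mul (scal _), mul_assoc,
          coeff_scal_vb_zero]
      · rfl
    rw [rhoTerm, this, map_zero, smul_zero]
  rw [e0, zero_add]
  refine tsum_congr fun b => ?_
  have : biCoeff (scal _ va * (scal _ vb * f)) (k + (b + 1 : ℕ)) (b + 1) = biCoeff f (k + b) b := by
    rcases lt_or_ge (k + b) 0 with hk | hk
    · rw [biCoeff_neg _ hk]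
      rcases lt_or_ge (k + (b + 1 : ℕ)) 0 with hk' | hk'
      · rw [biCoeff_neg _ hk']
      · have h0 : k + (b + 1 : ℕ) = ((0 : ℕ) : ℤ) := by push_cast at hk' ⊢; omega
        rw [h0, biCoeff_nat]
        simp [scal]
    · obtain ⟨m, hm⟩ := Int.eq_ofNat_of_zero_le hk
      have h0 : k + (b + 1 : ℕ) = ((m + 1 : ℕ) : ℤ) := by push_cast; omega
      rw [h0, hm, biCoeff_nat, biCoeff_nat, coeff_scal_va, coeff_scal_vb]
  rw [rhoTerm, rhoTerm, this, pow_succ', mul_smul]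

/-- The coefficient of `u ^ k`. -/
def rho (k : ℤ) : Lau (DY N c) →+ DYc N c :=
  QuotientAddGroup.lift (lauIdeal (DY N c)).toAddSubgroup (rhoBi k) (by
    intro x hx
    obtain ⟨z, rfl⟩ := Ideal.mem_span_singleton'.1 hx
    rw [AddMonoidHom.mem_ker, scal_comm, map_sub, sub_mul, map_sub, rhoBi_uw, rhoBi_h, sub_self])

@[simp]
lemma rho_toLau (k : ℤ) (f : Bi (DY N c)) : rho k (toLau _ f) = rhoBi k f := rfl

/-- A monomial u^m w^b contributes to u^k only if k = m - b, so k < -n forces b > n, and a factor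
h^n can be pulled out of the sum. -/
lemma isGood_rho (x : Lau (DY N c)) : IsGood fun k => rho k x := by
  obtain ⟨f, rfl⟩ := toLau_surjective _ x
  intro n
  refine ⟨-n, fun e he => ⟨∑' b : ℕ, h ^ (b - n) • toDYc c (biCoeff f (e + b) b), ?_⟩⟩
  change rho e (toLau _ f) = _
  rw [rho_toLau, rhoBi_apply, ← Summable.tsum_const_smul]
  · refine tsum_congr fun b => ?_
    rcases le_or_gt n b with hb | hb
    · rw [rhoTerm, smul_smul, ← pow_add, Nat.add_sub_cancel' hb]
    · rw [rhoTerm, biCoeff_neg _ (by omega), map_zero, smul_zero, smul_zero, smul_zero]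
  · refine summable_smul (fun b => b - n) (fun m => (Set.finite_lt_nat (m + n)).subset ?_) _
    intro b hb
    simp only [Set.mem_setOf_eq] at hb ⊢
    omega

lemma rho_constLau_mul (k : ℤ) (g : DY N c) (x : Lau (DY N c)) :
    rho k (constLau _ g * x) = toDYc c g * rho k x := by
  obtain ⟨f, rfl⟩ := toLau_surjective _ x
  have : constLau _ g * toLau _ f = toLau _ (C (C g) * f) := (map_mul (toLau _) _ _).symm
  rw [this, rho_toLau, rho_toLau, rhoBi_apply, rhoBi_apply,
    ← (summable_rhoTerm k f).tsum_mul_left]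
  refine tsum_congr fun b => ?_
  have : biCoeff (C (C g) * f) (k + b) b = g * biCoeff f (k + b) b := by
    simp only [biCoeff]
    split_ifs <;> simp
  rw [rhoTerm, rhoTerm, this, map_mul, mul_smul_comm]

lemma rho_mul_constLau (k : ℤ) (g : DY N c) (x : Lau (DY N c)) :
    rho k (x * constLau _ g) = rho k x * toDYc c g := by
  obtain ⟨f, rfl⟩ := toLau_surjective _ x
  have : toLau _ f * constLau _ g = toLau _ (f * C (C g)) := (map_mul (toLau _) _ _).symm
  rw [this, rho_toLau, rho_toLau, rhoBi_apply, rhoBi_apply,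
    ← (summable_rhoTerm k f).tsum_mul_right]
  refine tsum_congr fun b => ?_
  have : biCoeff (f * C (C g)) (k + b) b = biCoeff f (k + b) b * g := by
    simp only [biCoeff]
    split_ifs <;> simp
  rw [rhoTerm, rhoTerm, this, map_mul, smul_mul_assoc]

/-- For fixed degrees in w only finitely many e have both exponents of u nonnegative; the sum is
then the Cauchy product in u. -/
lemma tsum_rhoTerm_mul (k : ℤ) (f g : Bi (DY N c)) (b b' : ℕ) :
    ∑' e : ℤ, rhoTerm e f b * rhoTerm (k - e) g b' =
      h ^ (b + b') • toDYc c (if 0 ≤ k + b + b' then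
        ∑ p ∈ Finset.HasAntidiagonal.antidiagonal (k + b + b').toNat,
          coeff b (coeff p.1 f) * coeff b' (coeff p.2 g) else 0) := by
  have e1 : ∀ e : ℤ, rhoTerm e f b * rhoTerm (k - e) g b' =
      h ^ (b + b') • toDYc c (biCoeff f (e + b) b * biCoeff g (k - e + b') b') := by
    intro e
    rw [rhoTerm, rhoTerm, smul_mul_smul_comm, ← pow_add, ← map_mul]
  simp only [e1]
  rcases lt_or_ge (k + b + b') 0 with hk | hk
  · rw [if_neg (not_le.2 hk), map_zero, smul_zero]
    have : ∀ e : ℤ, h ^ (b + b') • toDYc c (biCoeff f (e + b) b * biCoeff g (k - e + b') b') = 0 := by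
      intro e
      rcases lt_or_ge (e + b) 0 with he | he
      · rw [biCoeff_neg _ he, zero_mul, map_zero, smul_zero]
      · rw [biCoeff_neg g (by omega), mul_zero, map_zero, smul_zero]
    simp only [this, tsum_zero]
  · rw [if_pos hk]
    obtain ⟨M, hM⟩ := Int.eq_ofNat_of_zero_le hk
    rw [hM]
    have inj : Function.Injective fun m : ℕ => (m : ℤ) - b := fun x y hxy => by
      simp only at hxy; omega
    rw [tsum_eq_sum (s := (Finset.range (M + 1)).map ⟨_, inj⟩), Finset.sum_map,
      Int.toNat_natCast, Finset.Nat.sum_antidiagonal_eq_sum_range_succ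
        (fun i j => coeff b (coeff i f) * coeff b' (coeff j g)), map_sum, Finset.smul_sum]
    · refine Finset.sum_congr rfl fun m hm => ?_
      rw [Finset.mem_range] at hm
      simp only [Function.Embedding.coeFn_mk]
      have h1 : (m : ℤ) - b + b = (m : ℕ) := by ring
      have h2 : k - ((m : ℤ) - b) + b' = ((M - m : ℕ) : ℤ) := by omega
      rw [h1, h2, biCoeff_nat, biCoeff_nat]
    · intro e he
      rcases lt_or_ge (e + b) 0 with h1 | h1
      · rw [biCoeff_neg _ h1, zero_mul, map_zero, smul_zero]
      · rcases lt_or_ge (k - e + b') 0 with h2 | h2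
        · rw [biCoeff_neg g h2, mul_zero, map_zero, smul_zero]
        · refine absurd ?_ he
          rw [Finset.mem_map]
          refine ⟨(e + b).toNat, ?_, ?_⟩
          · rw [Finset.mem_range]; omega
          · simp only [Function.Embedding.coeFn_mk]; omega

/-- The coefficients of a product are the convolutions of the coefficients. -/
theorem rho_mul (k : ℤ) (x y : Lau (DY N c)) :
    rho k (x * y) = conv (fun e => rho e x) (fun e => rho e y) k := by
  obtain ⟨f, rfl⟩ := toLau_surjective _ x
  obtain ⟨g, rfl⟩ := toLau_surjective _ y
  -- Modulo the n-th ideal both exponents of w are below n, and the nonnegative exponents of u then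
  -- confine e to a finite interval.
  have hs : Summable (Function.uncurry fun (e : ℤ) (p : ℕ × ℕ) =>
      rhoTerm e f p.1 * rhoTerm (k - e) g p.2) := by
    refine (linTopDYc N c).summable fun n => ?_
    refine ((Set.finite_Icc (-(n : ℤ)) (k + n)).prod
      ((Set.finite_lt_nat n).prod (Set.finite_lt_nat n))).subset fun ⟨e, b, b'⟩ he => ?_
    have h1 : b < n := by
      by_contra hlt
      refine he ?_
      simp only [Function.uncurry, rhoTerm, smul_mul_assoc]
      exact (linTopDYc N c).smul_mem_of_le (not_lt.1 hlt) _
    have h2 : b' < n := by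
      by_contra hlt
      refine he ?_
      simp only [Function.uncurry, rhoTerm, mul_smul_comm]
      exact (linTopDYc N c).smul_mem_of_le (not_lt.1 hlt) _
    have h3 : 0 ≤ e + b := by
      by_contra hlt
      refine he ?_
      simp only [Function.uncurry, rhoTerm, biCoeff_neg f (not_le.1 hlt), map_zero, smul_zero,
        zero_mul]
      exact zero_mem _
    have h4 : 0 ≤ k - e + b' := by
      by_contra hlt
      refine he ?_
      simp only [Function.uncurry, rhoTerm, biCoeff_neg g (not_le.1 hlt), map_zero, smul_zero,
        mul_zero]
      exact zero_mem _
    refine ⟨⟨?_, ?_⟩, h1, h2⟩ <;> simp only <;> omega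
  have e1 : conv (fun e => rho e (toLau _ f)) (fun e => rho e (toLau _ g)) k =
      ∑' (e : ℤ) (p : ℕ × ℕ), rhoTerm e f p.1 * rhoTerm (k - e) g p.2 := by
    rw [conv]
    refine tsum_congr fun e => ?_
    rw [rho_toLau, rho_toLau, rhoBi_apply, rhoBi_apply]
    exact (summable_rhoTerm e f).tsum_mul_tsum (summable_rhoTerm (k - e) g) (hs.prod_factor e)
  rw [e1, ← hs.tsum_comm, ← map_mul, rho_toLau, rhoBi_apply]
  have hs' : Summable fun p : ℕ × ℕ => ∑' e : ℤ, rhoTerm e f p.1 * rhoTerm (k - e) g p.2 :=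
    hs.prod_symm.prod
  -- Group the pairs of exponents of w by their sum, which is the exponent of w in the product.
  have hσ := ((Finset.HasAntidiagonal.sigmaAntidiagonalEquivProd.summable_iff).2 hs').tsum_sigma'
    (fun n => (hasSum_fintype _).summable)
  simp only [Function.comp_apply] at hσ
  rw [← Finset.HasAntidiagonal.sigmaAntidiagonalEquivProd.tsum_eq, hσ]
  refine tsum_congr fun b => ?_
  rw [tsum_fintype]
  have e2 : ∀ p : Finset.HasAntidiagonal.antidiagonal b,
      ∑' e : ℤ, rhoTerm e f (Finset.HasAntidiagonal.sigmaAntidiagonalEquivProd ⟨b, p⟩).1 *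
        rhoTerm (k - e) g (Finset.HasAntidiagonal.sigmaAntidiagonalEquivProd ⟨b, p⟩).2 =
      h ^ b • toDYc c (if 0 ≤ k + b then
        ∑ q ∈ Finset.HasAntidiagonal.antidiagonal (k + b).toNat,
          coeff p.1.1 (coeff q.1 f) * coeff p.1.2 (coeff q.2 g) else 0) := by
    rintro ⟨⟨b1, b2⟩, hp⟩
    have hp := Finset.HasAntidiagonal.mem_antidiagonal.1 hp
    simp only at hp
    subst hp
    refine (tsum_rhoTerm_mul k f g b1 b2).trans ?_
    rw [show k + (b1 : ℤ) + b2 = k + ((b1 + b2 : ℕ) : ℤ) by push_cast; ring]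
  simp only [e2]
  rw [← Finset.smul_sum, ← map_sum, rhoTerm]
  congr 2
  rw [Finset.sum_coe_sort (Finset.HasAntidiagonal.antidiagonal b) (fun p => if 0 ≤ k + (b : ℤ) then
        ∑ q ∈ Finset.HasAntidiagonal.antidiagonal (k + b).toNat,
          coeff p.1 (coeff q.1 f) * coeff p.2 (coeff q.2 g) else 0)]
  simp only [biCoeff]
  split_ifs
  · rw [coeff_mul, map_sum, Finset.sum_comm]
    refine Finset.sum_congr rfl fun q _ => ?_
    rw [coeff_mul]
  · simp

/-- A series in w = h/u contributes to u^k only through w^(-k), with the weight h^(-k). -/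
lemma rho_scalar (k : ℤ) (p : PowerSeries K) :
    rho k (algebraMap (Bi K) (Lau (DY N c)) (C p)) =
      algebraMap K (DYc N c) (if k ≤ 0 then h ^ (-k).toNat * coeff (-k).toNat p else 0) := by
  rw [algebraMap_lau, rho_toLau, rhoBi_apply]
  have e : ∀ b : ℕ, rhoTerm k (scal (DY N c) (C p)) b =
      if k + b = 0 then algebraMap K (DYc N c) (h ^ b * coeff b p) else 0 := by
    intro b
    rw [rhoTerm]
    split_ifs with hb
    · rw [hb, show (0 : ℤ) = ((0 : ℕ) : ℤ) by rfl, biCoeff_nat]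
      simp only [scal, PowerSeries.map_C, coeff_zero_C, coeff_map, AlgHom.commutes]
      rw [Algebra.smul_def, ← map_mul]
    · rcases lt_or_ge (k + b) 0 with hk | hk
      · rw [biCoeff_neg _ hk, map_zero, smul_zero]
      · obtain ⟨m, hm⟩ := Int.eq_ofNat_of_zero_le hk
        rw [hm, biCoeff_nat]
        have : m ≠ 0 := by omega
        simp [scal, coeff_C, this]
  simp only [e]
  split_ifs with hk
  · rw [tsum_eq_single (-k).toNat]
    · rw [if_pos (by omega)]
    · intro b hb
      rw [if_neg (by omega)]
  · rw [map_zero]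
    have : ∀ b : ℕ, ¬ (k + b = 0) := fun b => by omega
    simp [this]

lemma coeff_posEv (p : PowerSeries K) (f : PowerSeries (DY N c)) (m b : ℕ) :
    coeff b (coeff m (posEv _ p f)) = coeff b (p ^ m) • coeff m f := by
  rw [posEv, coeff_substHom]
  have e : ∀ r, ((C : PowerSeries (DY N c) →+* Bi (DY N c)).comp C) (coeff r f) * scal (DY N c) (va * C p) ^ r =
      X ^ r * C (C (coeff r f) * PowerSeries.map (algebraMap K (DY N c)) (p ^ r)) := by
    intro r
    rw [← map_pow, mul_pow, map_mul (scal _), ← mul_assoc, scal_comm (va ^ r), mul_assoc, map_pow, va, scal,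
      PowerSeries.map_X, ← map_pow, PowerSeries.map_C, RingHom.comp_apply, ← map_mul]
  simp only [e]
  rw [Finset.sum_eq_single m]
  · rw [coeff_X_pow_mul', if_pos le_rfl, Nat.sub_self, coeff_zero_C, coeff_C_mul, coeff_map,
      Algebra.smul_def, Algebra.commutes]
  · intro r hr hrm
    rw [Finset.mem_range] at hr
    rw [coeff_X_pow_mul', if_pos (by omega), coeff_C, if_neg (by omega)]
  · simp

lemma coeff_shiftP_pow (i m b : ℕ) :
    coeff b (shiftP i ^ m) = ((m.choose b : ℂ) • (-(i : ℂ)) ^ b • (1 : K)) := by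
  have e : shiftP i = 1 + C (-(i : K)) * X := by rw [shiftP, map_neg]; ring
  rw [e, add_comm, (Commute.all _ _).add_pow, map_sum]
  have e2 : ∀ r, coeff b ((C (-(i : K)) * X : PowerSeries K) ^ r * 1 ^ (m - r) * (m.choose r : PowerSeries K)) =
      if b = r then (-(i : K)) ^ r * (m.choose r : K) else 0 := by
    intro r
    rw [one_pow, mul_one, mul_pow, ← map_pow, show ((m.choose r : ℕ) : PowerSeries K) =
      C ((m.choose r : ℕ) : K) by simp, coeff_mul_C, coeff_C_mul, coeff_X_pow]
    split_ifs <;> simp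
  simp only [e2]
  rw [Finset.sum_ite_eq]
  have e3 : ((m.choose b : ℂ) • (-(i : ℂ)) ^ b • (1 : K)) = (-(i : K)) ^ b * (m.choose b : K) := by
    rw [Algebra.smul_def, Algebra.smul_def]
    simp [mul_comm]
  rw [e3]
  split_ifs with hb
  · rfl
  · rw [Nat.choose_eq_zero_of_lt (by simpa using hb)]; simp

/-- The binomial expansion of u^(m+l) (1 - iw)^(m+l): its term of degree l in w lands on u^m with
the factor (-ih)^l. Thus the formal substitution agrees with the h-adically convergent one. -/
lemma rho_posEv_shiftP (i : ℕ) (f : PowerSeries (DY N c)) (m : ℕ) :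
    rho m (toLau _ (posEv _ (shiftP i) f)) = ∑' l : ℕ, toDYc c
      ((((m + l).choose l : ℂ) • (-(i : ℕ) : ℂ) ^ l • h ^ l : K) • coeff (m + l) f) := by
  rw [rho_toLau, rhoBi_apply]
  refine tsum_congr fun l => ?_
  rw [rhoTerm, ← Nat.cast_add, biCoeff_nat, coeff_posEv, coeff_shiftP_pow, ← map_smul, smul_smul]
  congr 2
  simp only [mul_smul_comm, mul_one]

lemma rho_posEv_shiftP_neg (i : ℕ) (f : PowerSeries (DY N c)) {k : ℤ} (hk : k < 0) :
    rho k (toLau _ (posEv _ (shiftP i) f)) = 0 := by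
  rw [rho_toLau, rhoBi_apply]
  have : ∀ b, rhoTerm k (posEv _ (shiftP i) f) b = 0 := by
    intro b
    rw [rhoTerm]
    rcases lt_or_ge (k + b) 0 with hb | hb
    · rw [biCoeff_neg _ hb, map_zero, smul_zero]
    · obtain ⟨m, hm⟩ := Int.eq_ofNat_of_zero_le hb
      rw [hm, biCoeff_nat, coeff_posEv, coeff_shiftP_pow, Nat.choose_eq_zero_of_lt (by omega)]
      simp
  simp [this]

end LaurentCoefficients

/-! ### Matrices of series as series of matrices. -/

section MatrixSeries

variable (ι : Type*) [Fintype ι] [DecidableEq ι] (R : Type*) [Ring R]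

/-- Matrices of power series are power series with matrix coefficients. -/
def matSeries : Matrix ι ι (PowerSeries R) ≃+* PowerSeries (Matrix ι ι R) where
  toFun M := PowerSeries.mk fun m => M.map (coeff m)
  invFun f := Matrix.of fun i j => PowerSeries.mk fun m => coeff m f i j
  left_inv M := by ext i j m; simp
  right_inv f := by ext m i j; simp
  map_mul' M M' := by
    ext m i j
    rw [coeff_mul, Matrix.sum_apply, coeff_mk, Matrix.map_apply, Matrix.mul_apply, map_sum]
    simp only [coeff_mul, Matrix.mul_apply, coeff_mk, Matrix.map_apply]
    rw [Finset.sum_comm]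
  map_add' M M' := by ext m i j; simp

variable {ι R}

lemma coeff_matSeries (M : Matrix ι ι (PowerSeries R)) (m : ℕ) :
    coeff m (matSeries ι R M) = M.map (coeff m) := by simp [matSeries]

end MatrixSeries

/-! ### Coefficients of an inverse power series. -/

section Inverse

variable {R : Type*} [Ring R] {M Z : PowerSeries R} {u : R}

lemma coeff_inv_succ (hMZ : M * Z = 1) (hu : u * coeff 0 M = 1) (m : ℕ) :
    coeff (m + 1) Z = -(u * ∑ p ∈ Finset.HasAntidiagonal.antidiagonal m,
      coeff (p.1 + 1) M * coeff p.2 Z) := by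
  have h1 := congrArg (coeff (m + 1)) hMZ
  rw [coeff_mul, Finset.Nat.sum_antidiagonal_succ, coeff_one, if_neg (Nat.succ_ne_zero m)] at h1
  have h2 := congrArg (u * ·) h1
  simp only [mul_add, ← mul_assoc, hu, one_mul, mul_zero] at h2
  exact eq_neg_of_add_eq_zero_left h2

lemma coeff_inv_zero (hMZ : M * Z = 1) (hu : u * coeff 0 M = 1) : coeff 0 Z = u := by
  have h1 := congrArg (coeff 0) hMZ
  rw [coeff_mul, Finset.Nat.antidiagonal_zero, Finset.sum_singleton, coeff_one, if_pos rfl] at h1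
  calc coeff 0 Z = u * coeff 0 M * coeff 0 Z := by rw [hu, one_mul]
    _ = u := by rw [mul_assoc, h1, mul_one]

lemma coeff_inv_mem (S : Subring R) (hMZ : M * Z = 1) (hu : u * coeff 0 M = 1) (huS : u ∈ S)
    (hM : ∀ m, coeff m M ∈ S) (m : ℕ) : coeff m Z ∈ S := by
  induction m using Nat.strongRecOn with
  | ind m ih =>
    cases m with
    | zero => rw [coeff_inv_zero hMZ hu]; exact huS
    | succ m =>
      rw [coeff_inv_succ hMZ hu]
      refine neg_mem (mul_mem huS (sum_mem fun p hp => mul_mem (hM _) (ih _ ?_)))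
      have hp := Finset.HasAntidiagonal.mem_antidiagonal.1 hp
      omega

/-- Induction on n along the recursion for Z. A coefficient of M with large index is already small
and stays so after multiplication by Z on the right; a coefficient with small positive index carries
a factor θ, here multiplication by h, and is paired with a late coefficient of Z, which gains one
step. -/
lemma coeff_inv_eventually (S : Subring R) (I : ℕ → Ideal R) (h0 : I 0 = ⊤)
    (hI : ∀ n, ∀ x ∈ I n, ∀ y ∈ S, x * y ∈ I n) (θ : R → R)
    (hθ : ∀ n x y, y ∈ I n → θ x * y ∈ I (n + 1))
    (hMZ : M * Z = 1) (hu : u * coeff 0 M = 1) (hZ : ∀ m, coeff m Z ∈ S)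
    (hM : ∀ n, ∃ q, ∀ m, q ≤ m → coeff m M ∈ I n) (hM1 : ∀ m, ∃ x, coeff (m + 1) M = θ x) (n : ℕ) :
    ∃ q, ∀ m, q ≤ m → coeff m Z ∈ I n := by
  induction n with
  | zero => exact ⟨0, fun m _ => by rw [h0]; trivial⟩
  | succ n ih =>
    obtain ⟨q, hq⟩ := ih
    obtain ⟨q', hq'⟩ := hM (n + 1)
    refine ⟨q + q' + 1, fun m hm => ?_⟩
    obtain ⟨m, rfl⟩ : ∃ m', m = m' + 1 := ⟨m - 1, by omega⟩
    rw [coeff_inv_succ hMZ hu]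
    refine neg_mem (Ideal.mul_mem_left _ _ (sum_mem fun p hp => ?_))
    have hp := Finset.HasAntidiagonal.mem_antidiagonal.1 hp
    rcases le_or_gt q' (p.1 + 1) with h1 | h1
    · exact hI _ _ (hq' _ h1) _ (hZ _)
    · obtain ⟨x, hx⟩ := hM1 p.1
      rw [hx]
      exact hθ _ _ _ (hq _ (by omega))

end Inverse

/-! ### Invertibility of S_{[N]} and decay of the coefficients of its inverse. -/

section Decay

variable {N : ℕ} [NeZero N] {c : ℂ}

variable (N c) in
/-- The subalgebra generated by the `t_ij^{(r)}`, `r ≥ 1`. -/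
def posAlg : Subalgebra K (DY N c) :=
  Algebra.adjoin K {x | ∃ (i j : Fin N) (r : ℕ), x = tGen (.pos i j r)}

/-- The left ideals I_p are in addition stable under right multiplication by the Yangian half, by
its commutation relations. This controls products of series in u⁻¹ in either order. -/
lemma leftIdeal_mul_posAlg {p : ℕ} {x : DY N c} (hx : x ∈ posAlg N c) :
    ∀ y ∈ leftIdeal N c p, y * x ∈ leftIdeal N c p := by
  induction hx using Algebra.adjoin_induction with
  | mem x hx =>
    obtain ⟨k, l, n, rfl⟩ := hx
    exact span_mul_mem fun i j s hs => pos_mul_pos_mem p k l n i j s hs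
  | algebraMap k =>
    intro y hy
    rw [← Algebra.commutes]
    exact Ideal.mul_mem_left _ _ hy
  | add x y _ _ hx hy => intro z hz; rw [mul_add]; exact add_mem (hx z hz) (hy z hz)
  | mul x y _ _ hx hy => intro z hz; rw [← mul_assoc]; exact hy _ (hx z hz)

lemma nbhd_mul_posAlg {p n : ℕ} {x y : DY N c} (hx : x ∈ posAlg N c) (hy : y ∈ nbhd N c p n) :
    y * x ∈ nbhd N c p n := by
  obtain ⟨w, hw, v, rfl⟩ := mem_nbhd hy
  rw [add_mul, smul_mul_assoc]
  exact add_mem (leftIdeal_le_nbhd _ _ (leftIdeal_mul_posAlg hx w hw)) (smul_mem_nbhd _ _ _ dvd_rfl)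

variable (N c) in
/-- The power series in `u⁻¹` with coefficients in the Yangian that tend to zero and are divisible by
`h`, except for the constant term. -/
def decaySeries : Subring (PowerSeries (DY N c)) where
  carrier := {f | (∀ m, coeff m f ∈ posAlg N c) ∧
    (∀ p n, ∃ q, ∀ m, q ≤ m → coeff m f ∈ nbhd N c p n) ∧ ∀ m, ∃ x, coeff (m + 1) f = h • x}
  zero_mem' := ⟨fun m => by simp, fun p n => ⟨0, fun m _ => by simp⟩, fun m => ⟨0, by simp⟩⟩
  one_mem' := by
    refine ⟨fun m => ?_, fun p n => ⟨1, fun m hm => ?_⟩, fun m => ⟨0, ?_⟩⟩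
    · rw [coeff_one]; split_ifs
      exacts [one_mem _, zero_mem _]
    · rw [coeff_one, if_neg (by omega)]; exact zero_mem _
    · rw [coeff_one, if_neg (by omega), smul_zero]
  add_mem' := by
    rintro f g ⟨hf, hf', hf''⟩ ⟨hg, hg', hg''⟩
    refine ⟨fun m => ?_, fun p n => ?_, fun m => ?_⟩
    · rw [map_add]; exact add_mem (hf m) (hg m)
    · obtain ⟨q, hq⟩ := hf' p n
      obtain ⟨q', hq'⟩ := hg' p n
      exact ⟨max q q', fun m hm => by
        rw [map_add]
        exact add_mem (hq m (le_trans (le_max_left _ _) hm)) (hq' m (le_trans (le_max_right _ _) hm))⟩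
    · obtain ⟨x, hx⟩ := hf'' m
      obtain ⟨y, hy⟩ := hg'' m
      exact ⟨x + y, by rw [map_add, hx, hy, smul_add]⟩
  neg_mem' := by
    rintro f ⟨hf, hf', hf''⟩
    refine ⟨fun m => ?_, fun p n => ?_, fun m => ?_⟩
    · rw [map_neg]; exact neg_mem (hf m)
    · obtain ⟨q, hq⟩ := hf' p n
      exact ⟨q, fun m hm => by rw [map_neg]; exact neg_mem (hq m hm)⟩
    · obtain ⟨x, hx⟩ := hf'' m
      exact ⟨-x, by rw [map_neg, hx, smul_neg]⟩
  mul_mem' := by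
    rintro f g ⟨hf, hf', hf''⟩ ⟨hg, hg', hg''⟩
    refine ⟨fun m => ?_, fun p n => ?_, fun m => ?_⟩
    · rw [coeff_mul]; exact sum_mem fun p _ => mul_mem (hf _) (hg _)
    · obtain ⟨q, hq⟩ := hf' p n
      obtain ⟨q', hq'⟩ := hg' p n
      refine ⟨q + q', fun m hm => ?_⟩
      rw [coeff_mul]
      refine sum_mem fun r hr => ?_
      have hr := Finset.HasAntidiagonal.mem_antidiagonal.1 hr
      rcases le_or_gt q r.1 with h1 | h1
      · exact nbhd_mul_posAlg (hg _) (hq _ h1)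
      · exact Ideal.mul_mem_left _ _ (hq' _ (by omega))
    · choose a ha using hf''
      choose b hb using hg''
      rw [coeff_mul, Finset.Nat.sum_antidiagonal_succ]
      refine ⟨coeff 0 f * b m + ∑ p ∈ Finset.HasAntidiagonal.antidiagonal m, a p.1 * coeff p.2 g, ?_⟩
      rw [smul_add, Finset.smul_sum, hb, mul_smul_comm]
      congr 1
      refine Finset.sum_congr rfl fun p _ => ?_
      rw [ha, smul_mul_assoc]

lemma scalar_mem_decaySeries {f : PowerSeries K} (hf : ∀ m, h ^ m ∣ coeff m f) :
    PowerSeries.map (algebraMap K (DY N c)) f ∈ decaySeries N c := by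
  refine ⟨fun m => ?_, fun p n => ⟨n, fun m hm => ?_⟩, fun m => ?_⟩
  · rw [coeff_map]; exact Subalgebra.algebraMap_mem _ _
  · rw [coeff_map, Algebra.algebraMap_eq_smul_one]
    exact smul_mem_nbhd _ _ _ ((pow_dvd_pow _ hm).trans (hf m))
  · obtain ⟨k, hk⟩ := hf (m + 1)
    refine ⟨algebraMap K _ (h ^ m * k), ?_⟩
    rw [coeff_map, hk, Algebra.smul_def, ← map_mul, pow_succ', mul_assoc]

lemma C_mem_decaySeries (k : K) : C (algebraMap K (DY N c) k) ∈ decaySeries N c := by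
  have := scalar_mem_decaySeries (N := N) (c := c) (f := C k) (fun m => by
    cases m with
    | zero => simp
    | succ m => simp [coeff_C])
  rwa [PowerSeries.map_C] at this

/-- h/(αu + σh) is homogeneous: it is a series in h/u with complex coefficients. -/
lemma h_mul_invLin (α : ℂ) (hα : α ≠ 0) (σ : ℂ) :
    C h * invLin α (σ • h) = rescale h (invLin α (algebraMap ℂ K σ)) := by
  have h1 := invLin_mul (B := K) hα (σ • h)
  have h2 := congrArg (rescale h) (invLin_mul (B := K) hα (algebraMap ℂ K σ))
  have e : ∀ a : K, rescale h (C a) = C a := by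
    intro a; ext m; rw [coeff_rescale]; cases m <;> simp [coeff_C]
  have e' : rescale h (X : PowerSeries K) = C h * X := by
    ext m; rw [coeff_rescale, coeff_C_mul, coeff_X]; split_ifs with hm <;> simp [hm]
  simp only [map_mul, map_add, e, e'] at h2
  refine (isUnit_linear hα (σ • h : K)).mul_left_inj.1 ?_
  rw [mul_assoc, h1, Algebra.smul_def, map_mul, mul_assoc, h2]

lemma rescale_gEval {z : PowerSeries K} (hz : constantCoeff z = 0) :
    rescale h (gEval N z) = gEval N (rescale h z) := by
  have hz' : constantCoeff (rescale h z) = 0 := by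
    rw [← coeff_zero_eq_constantCoeff_apply, coeff_rescale, coeff_zero_eq_constantCoeff_apply, hz,
      mul_zero]
  refine gEval_natural N (rescale h) (RingHom.id _) hz hz' (fun k => ?_) rfl hz'
  ext m
  rw [coeff_rescale]
  cases m <;> simp [coeff_C]

lemma dvd_coeff_rescale (f : PowerSeries K) (m : ℕ) : h ^ m ∣ coeff m (rescale h f) := by
  rw [coeff_rescale]; exact dvd_mul_right _ _

/-- By homogeneity h^r (αu + σh)^(-r) is a series in h/u, so its coefficient of u^(-m) is divisible
by h^m; cancel h^r. -/
lemma dvd_coeff_invLin_pow {α : ℂ} (hα : α ≠ 0) (σ : ℂ) (m r : ℕ) :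
    h ^ (m - r) ∣ coeff m (invLin α (σ • h : K) ^ r) := by
  have h1 : C h ^ r * invLin α (σ • h : K) ^ r = rescale h (invLin α (algebraMap ℂ K σ) ^ r) := by
    rw [← mul_pow, h_mul_invLin α hα, map_pow]
  have h2 := dvd_coeff_rescale (invLin α (algebraMap ℂ K σ) ^ r) m
  rw [← h1, ← map_pow, coeff_C_mul] at h2
  rcases le_or_gt r m with hr | hr
  · rw [← Nat.add_sub_cancel' hr, pow_add, Nat.add_sub_cancel' hr] at h2
    exact (mul_dvd_mul_iff_left (pow_ne_zero r h_ne_zero)).1 h2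
  · rw [Nat.sub_eq_zero_of_le hr.le, pow_zero]
    exact one_dvd _

lemma coeff_evLin (α : ℂ) (s : K) (f : PowerSeries (DY N c)) (m : ℕ) :
    coeff m (evLin (DY N c) α s f) =
      ∑ r ∈ Finset.range (m + 1), coeff m (invLin α s ^ r) • coeff r f := by
  rw [← evalInv_eq_evLin, evalInv, coeff_mk]

/-- The coefficient of u^(-m) is a sum over r of terms of T of index r with weights divisible by
h^(m-r). For m ≥ p + n, either m - r ≥ n and h^n appears, or r > p and the generator lies in I_p. -/
lemma negT_mem_decaySeries {α : ℂ} (hα : α ≠ 0) (σ : ℂ) (i j : Fin N) :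
    negT N c α (σ • h) i j ∈ decaySeries N c := by
  have hT : ∀ r, ∃ x, coeff (r + 1) (Tmat (tGen (N := N) (c := c)) i j) = h • x ∧
      x ∈ posAlg N c ∧ ∀ p, p ≤ r + 1 → x ∈ leftIdeal N c p := fun r =>
    ⟨tGen (.pos i j r), by simp [Tmat], Algebra.subset_adjoin ⟨i, j, r, rfl⟩, fun p hp =>
      gen_mem_leftIdeal hp i j⟩
  have hT0 : coeff 0 (Tmat (tGen (N := N) (c := c)) i j) ∈ posAlg N c := by
    simp only [Tmat, Matrix.of_apply, coeff_mk]
    split_ifs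
    exacts [one_mem _, zero_mem _]
  refine ⟨fun m => ?_, fun p n => ⟨p + n, fun m hm => ?_⟩, fun m => ?_⟩
  · rw [negT, Matrix.map_apply, coeff_evLin]
    refine sum_mem fun r _ => Subalgebra.smul_mem _ ?_ _
    cases r with
    | zero => exact hT0
    | succ r =>
      obtain ⟨x, hx, hx', -⟩ := hT r
      rw [hx]; exact Subalgebra.smul_mem _ hx' _
  · rw [negT, Matrix.map_apply, coeff_evLin]
    refine sum_mem fun r hr => ?_
    rw [Finset.mem_range] at hr
    rcases le_or_gt n (m - r) with h1 | h1
    · exact smul_mem_nbhd _ _ _ ((pow_dvd_pow _ h1).trans (dvd_coeff_invLin_pow hα _ _ _))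
    · cases r with
      | zero => omega
      | succ r =>
        obtain ⟨x, hx, -, hx'⟩ := hT r
        rw [hx, smul_smul]
        exact smul_mem_ideal _ _ (leftIdeal_le_nbhd _ _ (hx' p (by omega)))
  · choose x hx using fun r => (hT r)
    refine ⟨∑ r ∈ Finset.range (m + 1), coeff (m + 1) (invLin α (σ • h : K) ^ (r + 1)) • x r, ?_⟩
    rw [negT, Matrix.map_apply, coeff_evLin, Finset.sum_range_succ', pow_zero, coeff_one,
      if_neg (by omega), zero_smul, add_zero, Finset.smul_sum]
    refine Finset.sum_congr rfl fun r _ => ?_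
    rw [(hx r).1, smul_comm]

lemma rowProd_mem {ι E : Type*} [Monoid E] (S : Submonoid E) {F : ι → E}
    {Q : ι → ι → E} {l : List ι} (hF : ∀ i, F i ∈ S) (hQ : ∀ i j, Q i j ∈ S) :
    rowProd F Q l ∈ S := by
  induction l with
  | nil => exact one_mem _
  | cons i l ih =>
    rw [rowProd]
    refine mul_mem (mul_mem (hF i) (list_prod_mem fun x hx => ?_)) ih
    obtain ⟨j, -, rfl⟩ := List.mem_map.1 hx
    exact hQ i j

lemma siteOp_mem {R : Type*} [Ring R] (S : Subring R) {k : Fin N} {M : Matrix (Fin N) (Fin N) R}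
    (hM : ∀ i j, M i j ∈ S) : siteOp k M ∈ S.matrix (n := Fin N → Fin N) := by
  intro I J
  simp only [siteOp, Matrix.of_apply]
  split_ifs
  exacts [hM _ _, zero_mem _]

lemma matrix_mul_mem {R : Type*} [Ring R] (S : Subring R) {M M' : Matrix (Fin N) (Fin N) R}
    (hM : ∀ i j, M i j ∈ S) (hM' : ∀ i j, M' i j ∈ S) (i j : Fin N) : (M * M') i j ∈ S := by
  rw [Matrix.mul_apply]
  exact sum_mem fun k _ => mul_mem (hM _ _) (hM' _ _)

variable (G : Matrix (Fin N) (Fin N) ℂ)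

lemma scalMat_mem_decaySeries (a b : Fin N) :
    (scalMat G).map (algebraMap (PowerSeries K) (PowerSeries (DY N c))) a b ∈ decaySeries N c := by
  rw [Matrix.map_apply, scalMat, Matrix.map_apply, algebraMap_powerSeries, PowerSeries.map_C]
  exact C_mem_decaySeries _

lemma reflR_mem {ι R : Type*} [Fintype ι] [DecidableEq ι] [Ring R] {L : Type*} [CommRing L] [Algebra L R]
    (S : Subring R) {γ ζ : ι → ι → L} {i j : ι} (h1 : algebraMap L R (γ i j) ∈ S)
    (h2 : algebraMap L R (ζ i j) ∈ S) (I J : ι → Fin N) : reflR (R := R) γ ζ i j I J ∈ S := by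
  rw [reflR, Matrix.smul_apply, Matrix.sub_apply, Matrix.smul_apply, Algebra.smul_def,
    Algebra.smul_def]
  refine mul_mem h1 (sub_mem ?_ (mul_mem h2 ?_))
  · rw [Matrix.one_apply]; split_ifs
    exacts [one_mem _, zero_mem _]
  · simp only [capOp, Matrix.of_apply]; split_ifs
    exacts [one_mem _, zero_mem _]

lemma h_mul_invLin_mem_decaySeries (σ : ℂ) : algebraMap (PowerSeries K) (PowerSeries (DY N c))
    (C h * invLin (-2) (σ • h)) ∈ decaySeries N c := by
  rw [h_mul_invLin (-2) (by norm_num) σ]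
  exact scalar_mem_decaySeries (dvd_coeff_rescale _)

lemma gEval_mem_decaySeries (σ : ℂ) : algebraMap (PowerSeries K) (PowerSeries (DY N c))
    (gEval N (C h * invLin (-2) (σ • h))) ∈ decaySeries N c := by
  rw [h_mul_invLin (-2) (by norm_num) σ, ← rescale_gEval (constantCoeff_invLin _ _)]
  exact scalar_mem_decaySeries (dvd_coeff_rescale _)

set_option maxHeartbeats 400000 in
lemma Sbracket_mem_decaySeries : Sbracket c G ∈ (decaySeries N c).matrix (n := Idx N) := by
  rw [Sbracket_eq]
  refine rowProd_mem (((decaySeries N c).matrix (n := Fin N → Fin N)).toSubmonoid) (fun i => ?_)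
    fun i j I J => reflR_mem (decaySeries N c)
      (γ := fun i j : Fin N => gEval N (C h * invLin (-2) (((i + j : ℕ) - 2 * c : ℂ) • h)))
      (gEval_mem_decaySeries ((i + j : ℕ) - 2 * c : ℂ))
      (h_mul_invLin_mem_decaySeries ((i + j : ℕ) - 2 * c : ℂ)) I J
  refine siteOp_mem (decaySeries N c) (matrix_mul_mem (decaySeries N c)
    (matrix_mul_mem (decaySeries N c) (fun a b => ?_) fun a b => ?_) fun a b => ?_)
  · exact negT_mem_decaySeries (α := 1) one_ne_zero (3 * c / 2 - (i : ℕ)) a b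
  · exact scalMat_mem_decaySeries G a b
  · have h1 : (-1 : ℂ) ≠ 0 := by norm_num
    rw [Matrix.transpose_apply]
    exact negT_mem_decaySeries h1 ((i : ℕ) - c / 2) b a

/-- The operator `G ⊗ … ⊗ G`. -/
def tensorPow (G : Matrix (Fin N) (Fin N) ℂ) : SiteOp (Fin N) N ℂ :=
  ((List.finRange N).map fun i => siteOp i G).prod

lemma siteOp_one {R : Type*} [Ring R] (k : Fin N) :
    siteOp k (1 : Matrix (Fin N) (Fin N) R) = 1 := by
  ext I J
  simp only [siteOp, Matrix.of_apply, Matrix.one_apply]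
  by_cases hIJ : I = J
  · subst hIJ; simp
  · rw [if_neg hIJ]
    split_ifs with h1 h2
    · refine absurd (funext fun m => ?_) hIJ
      by_cases hm : m = k
      · rw [hm, h2]
      · exact h1 m hm
    · rfl
    · rfl

lemma isUnit_tensorPow (hG : IsUnit G.det) : IsUnit (tensorPow G) := by
  rw [tensorPow]
  refine (List.prod_isUnit fun x hx => ?_)
  obtain ⟨i, -, rfl⟩ := List.mem_map.1 hx
  obtain ⟨u, hu⟩ := (Matrix.isUnit_iff_isUnit_det G).2 hG
  refine ⟨⟨siteOp i G, siteOp i (↑u⁻¹ : Matrix (Fin N) (Fin N) ℂ), ?_, ?_⟩, rfl⟩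
  · rw [← siteOp_mul, ← hu, Units.mul_inv, siteOp_one]
  · rw [← siteOp_mul, ← hu, Units.inv_mul, siteOp_one]

lemma rowProd_one {ι E : Type*} [Monoid E] (F : ι → E) (l : List ι) :
    rowProd F (fun _ _ => 1) l = (l.map F).prod := by
  induction l with
  | nil => rfl
  | cons i l ih => simp [rowProd, ih]

variable (N c) in
/-- The embedding of the complex numbers. -/
def complexDY : ℂ →+* DY N c := (algebraMap K (DY N c)).comp (algebraMap ℂ K)

lemma constantCoeff_negT (α : ℂ) (s : K) :
    (negT N c α s).map (constantCoeff (R := DY N c)) = 1 := by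
  ext i j
  rw [Matrix.map_apply, ← coeff_zero_eq_constantCoeff_apply, negT, Matrix.map_apply, coeff_evLin]
  simp [Tmat, Matrix.one_apply]

lemma constantCoeff_gEval {z : PowerSeries K} : constantCoeff (gEval N z) = 1 := by
  rw [← coeff_zero_eq_constantCoeff_apply, gEval, evalInv, coeff_mk]
  simp [coeff_gSeries_zero, constantCoeff_gSeries]

/-- At u = ∞ both T and R̄ᵗ become the identity; only the matrices G remain. -/
lemma constantCoeff_Sbracket :
    (Sbracket c G).map (coeff 0) = (tensorPow G).map (complexDY N c) := by
  have e := rowProd_map ((constantCoeff (R := DY N c)).mapMatrix (m := Fin N → Fin N)).toMonoidHom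
    (fun i : Fin N => siteOp i
      (negT N c 1 ((3 * c / 2 - (i : ℕ)) • h) *
      (scalMat G).map (algebraMap (PowerSeries K) (PowerSeries (DY N c))) *
        (negT N c (-1) (((i : ℕ) - c / 2 : ℂ) • h)).transpose))
      (reflR (fun i j => gEval N (C h * invLin (-2) (((i + j : ℕ) - 2 * c : ℂ) • h)))
        fun i j => C h * invLin (-2) (((i + j : ℕ) - 2 * c : ℂ) • h)) (List.finRange N)
  rw [← Sbracket_eq] at e
  have e1 : (Sbracket c G).map (coeff 0) = (Sbracket c G).map (constantCoeff (R := DY N c)) := by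
    ext I J; simp
  rw [e1, tensorPow, list_prod_map, ← rowProd_one]
  refine e.trans (rowProd_congr (fun i _ => ?_) (List.pairwise_of_forall fun i j => ?_))
  · refine (siteOp_map _ _ _).trans ?_
    rw [siteOp_map, Matrix.map_mul, Matrix.map_mul, Matrix.transpose_map, constantCoeff_negT,
      constantCoeff_negT, Matrix.transpose_one, Matrix.mul_one, Matrix.one_mul]
    congr 1
  · refine Matrix.ext fun I J => ?_
    simp only [RingHom.toMonoidHom_eq_coe, MonoidHom.coe_coe, RingHom.mapMatrix_apply,
      Matrix.map_apply]
    rw [reflR, Matrix.smul_apply, Matrix.sub_apply, Matrix.smul_apply, powerSeries_smul_def,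
      powerSeries_smul_def]
    have h1 : ∀ f : PowerSeries K, constantCoeff (PowerSeries.map (algebraMap K (DY N c)) f) =
        algebraMap K (DY N c) (constantCoeff f) := fun f => by
      rw [← coeff_zero_eq_constantCoeff_apply, coeff_map, coeff_zero_eq_constantCoeff_apply]
    rw [map_mul, h1, constantCoeff_gEval, map_sub, map_mul, h1, map_mul, constantCoeff_invLin]
    rw [mul_zero, map_zero, zero_mul, sub_zero, map_one, one_mul, Matrix.one_apply, Matrix.one_apply]
    split_ifs <;> simp

variable {G}

lemma exists_tensorPow_inv (hG : IsUnit G.det) : ∃ Γ : SiteOp (Fin N) N ℂ,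
    Γ.map (complexDY N c) * (Sbracket c G).map (coeff 0) = 1 ∧
    (Sbracket c G).map (coeff 0) * Γ.map (complexDY N c) = 1 := by
  obtain ⟨u, hu⟩ := isUnit_tensorPow G hG
  have h1 : ∀ M M' : SiteOp (Fin N) N ℂ, M * M' = 1 →
      M.map (complexDY N c) * M'.map (complexDY N c) = 1 := by
    intro M M' h
    rw [← Matrix.map_mul, h]
    exact Matrix.map_one _ (map_zero _) (map_one _)
  refine ⟨(↑u⁻¹ : SiteOp (Fin N) N ℂ), ?_, ?_⟩
  · rw [constantCoeff_Sbracket]; exact h1 _ _ (by rw [← hu, Units.inv_mul])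
  · rw [constantCoeff_Sbracket]; exact h1 _ _ (by rw [← hu, Units.mul_inv])

theorem isUnit_Sbracket (hG : IsUnit G.det) : IsUnit (Sbracket c G) := by
  obtain ⟨Γ, h1, h2⟩ := exists_tensorPow_inv (c := c) hG
  have h3 : IsUnit (matSeries (Idx N) (DY N c) (Sbracket c G)) := by
    rw [PowerSeries.isUnit_iff_constantCoeff, ← coeff_zero_eq_constantCoeff_apply, coeff_matSeries]
    exact ⟨⟨_, _, h2, h1⟩, rfl⟩
  exact (MulEquiv.isUnit_map (matSeries (Idx N) (DY N c))).1 h3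

lemma matSeries_inverse (hG : IsUnit G.det) :
    matSeries (Idx N) (DY N c) (Sbracket c G) *
      matSeries (Idx N) (DY N c) (Ring.inverse (Sbracket c G)) = 1 := by
  rw [← map_mul, Ring.mul_inverse_cancel _ (isUnit_Sbracket hG), map_one]

lemma coeff_inverse_mem (hG : IsUnit G.det) (S : Subalgebra K (DY N c))
    (hS : ∀ m I J, coeff m (Sbracket c G I J) ∈ S) (m : ℕ) (I J : Idx N) :
    coeff m (Ring.inverse (Sbracket c G) I J) ∈ S := by
  obtain ⟨Γ, h1, -⟩ := exists_tensorPow_inv (c := c) hG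
  have := coeff_inv_mem (S.toSubring.matrix (n := Idx N)) (matSeries_inverse (c := c) hG)
    (u := Γ.map (complexDY N c)) (by rw [coeff_matSeries]; exact h1)
    (fun I J => Subalgebra.algebraMap_mem S _) (fun m => by
      rw [coeff_matSeries]; exact fun I J => hS m I J) m
  rw [coeff_matSeries] at this
  exact this I J

/-- The recursion for the inverse is applied to the ideals I_n + h^k DY with n fixed: each step of
the induction raises only the exponent k of h, up to k = n. -/
lemma coeff_inverse_mem_nbhd (hG : IsUnit G.det) (n : ℕ) :
    ∃ q, ∀ m, q ≤ m → ∀ I J, coeff m (Ring.inverse (Sbracket c G) I J) ∈ nbhd N c n n := by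
  obtain ⟨Γ, h1, -⟩ := exists_tensorPow_inv (c := c) hG
  have hS := Sbracket_mem_decaySeries (c := c) G
  obtain ⟨q, hq⟩ := coeff_inv_eventually ((posAlg N c).toSubring.matrix (n := Idx N))
    (fun k => (nbhd N c n k).matrix (Idx N)) (by
      rw [eq_top_iff]
      intro M _
      rw [Ideal.mem_matrix]
      intro I J
      rw [← one_smul K (M I J)]
      exact smul_mem_nbhd _ _ _ (by simp))
    (fun k x hx y hy => by
      rw [Ideal.mem_matrix] at hx ⊢
      intro I J
      rw [Matrix.mul_apply]
      exact sum_mem fun l _ => nbhd_mul_posAlg (hy _ _) (hx _ _))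
    (fun x => h • x) (fun k x y hy => by
      rw [Ideal.mem_matrix] at hy ⊢
      intro I J
      rw [smul_mul_assoc, Matrix.smul_apply, Matrix.mul_apply]
      exact h_smul_mem_nbhd (sum_mem fun l _ => Ideal.mul_mem_left _ _ (hy _ _)))
    (matSeries_inverse (c := c) hG) (u := Γ.map (complexDY N c))
    (by rw [coeff_matSeries]; exact h1)
    (fun m => by
      rw [coeff_matSeries]
      exact fun I J => coeff_inverse_mem hG (posAlg N c) (fun m I J => (hS I J).1 m) m I J)
    (fun k => by
      choose q hq using fun I J => (hS I J).2.1 n k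
      refine ⟨∑ I, ∑ J, q I J, fun m hm => ?_⟩
      rw [coeff_matSeries, Ideal.mem_matrix]
      intro I J
      refine hq I J m (le_trans ?_ hm)
      exact (Finset.single_le_sum (f := fun J => q I J) (fun _ _ => Nat.zero_le _)
        (Finset.mem_univ J)).trans (Finset.single_le_sum (f := fun I => ∑ J, q I J)
        (fun _ _ => Nat.zero_le _) (Finset.mem_univ I)))
    (fun m => by
      choose x hx using fun I J => (hS I J).2.2 m
      refine ⟨Matrix.of x, ?_⟩
      rw [coeff_matSeries]
      ext I J
      simpa using hx I J) n
  refine ⟨q, fun m hm I J => ?_⟩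
  have := hq m hm
  rw [coeff_matSeries, Ideal.mem_matrix] at this
  exact this I J

end Decay

/-! ### Convolution of matrix series. -/

section MatrixConv

variable {E : Type*} [Ring E] [Algebra K E] [UniformSpace E] [IsUniformAddGroup E]
  [IsTopologicalRing E] [CompleteSpace E] [T2Space E] {τ : LinTop E}
  {ι : Type*} [Fintype ι] [DecidableEq ι]

lemma isGood_matrix {F : ℤ → Matrix ι ι E} (hF : ∀ i j, IsGood fun k => F k i j) : IsGood F := by
  intro n
  choose q hq using fun i j => hF i j n
  refine ⟨-∑ i, ∑ j, |q i j|, fun e he => ?_⟩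
  have h1 : ∀ i j, ∃ w, F e i j = h ^ n • w := by
    intro i j
    refine hq i j e (lt_of_lt_of_le he ?_)
    have h2 := (Finset.single_le_sum (f := fun j => |q i j|) (fun _ _ => abs_nonneg _)
      (Finset.mem_univ j)).trans (Finset.single_le_sum (f := fun i => ∑ j, |q i j|)
      (fun _ _ => Finset.sum_nonneg fun _ _ => abs_nonneg _) (Finset.mem_univ i))
    have h3 := neg_abs_le (q i j)
    linarith
  choose w hw using h1
  exact ⟨Matrix.of w, Matrix.ext fun i j => hw i j⟩

lemma conv_matrix_apply {F Z : ℤ → Matrix ι ι E} (hF : ∀ i j, IsGood fun k => F k i j)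
    (hZ : ∀ i j, IsNull τ fun k => Z k i j) (k : ℤ) (i j : ι) :
    conv F Z k i j = ∑ l, conv (fun e => F e i l) (fun e => Z e l j) k := by
  have h1 : HasSum (fun e => F e * Z (k - e))
      (Matrix.of fun i j => ∑ l, conv (fun e => F e i l) (fun e => Z e l j) k) := by
    refine Pi.hasSum.2 fun i => Pi.hasSum.2 fun j => ?_
    simp only [Matrix.mul_apply, Matrix.of_apply]
    exact hasSum_sum fun l _ => (summable_conv (hF i l) (hZ l j) k).hasSum
  rw [conv, h1.tsum_eq, Matrix.of_apply]

lemma conv_one (Z : ℤ → E) (k : ℤ) : conv (fun e => if e = 0 then 1 else 0) Z k = Z k := by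
  rw [conv, tsum_eq_single 0 fun e he => by rw [if_neg he, zero_mul]]
  simp

end MatrixConv

/-! ### The factors of 𝔸(u) as coefficients of series in u and w. -/

section Factors

variable {N : ℕ} [NeZero N] {c : ℂ}

/-- The coefficients of a matrix of series. -/
def rhoMat (k : ℤ) (Φ : SiteOp (Fin N) N (Lau (DY N c))) : Matrix (Idx N) (Idx N) (DYc N c) :=
  Φ.map (rho k)

lemma isGood_rhoMat (Φ : SiteOp (Fin N) N (Lau (DY N c))) : IsGood fun k => rhoMat k Φ :=
  isGood_matrix fun I J => isGood_rho (Φ I J)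

lemma rhoMat_mul (k : ℤ) (Φ Ψ : SiteOp (Fin N) N (Lau (DY N c))) :
    rhoMat k (Φ * Ψ) = conv (fun e => rhoMat e Φ) (fun e => rhoMat e Ψ) k := by
  refine Matrix.ext fun I J => ?_
  rw [conv_matrix_apply (τ := linTopDYc N c) (F := fun e => rhoMat e Φ) (Z := fun e => rhoMat e Ψ)
    (fun I J => isGood_rho (Φ I J)) (fun I J => (isGood_rho (Ψ I J)).isNull), rhoMat, Matrix.map_apply, Matrix.mul_apply, map_sum]
  exact Finset.sum_congr rfl fun l _ => rho_mul _ _ _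

lemma rho_one (k : ℤ) : rho k (1 : Lau (DY N c)) = if k = 0 then 1 else 0 := by
  have h1 := rho_scalar (N := N) (c := c) k 1
  rw [map_one, map_one] at h1
  rw [h1]
  rcases lt_trichotomy k 0 with hk | rfl | hk
  · rw [if_pos hk.le, coeff_one, if_neg (by omega), if_neg hk.ne, mul_zero, map_zero]
  · simp
  · rw [if_neg (not_le.2 hk), if_neg hk.ne', map_zero]

lemma rhoMat_one (k : ℤ) :
    rhoMat k (1 : SiteOp (Fin N) N (Lau (DY N c))) = if k = 0 then 1 else 0 := by
  refine Matrix.ext fun I J => ?_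
  rw [rhoMat, Matrix.map_apply, Matrix.one_apply]
  by_cases hIJ : I = J
  · rw [if_pos hIJ, rho_one]
    split_ifs
    · rw [hIJ, Matrix.one_apply_eq]
    · rfl
  · rw [if_neg hIJ, map_zero]
    split_ifs
    · rw [Matrix.one_apply_ne hIJ]
    · rfl

/-- The convolutions are nested towards the rightmost factor, the only one that is merely null;
associativity collects all the others into one product in the ring of series in u and w. -/
lemma foldr_conv_rhoMat (L : List (SiteOp (Fin N) N (Lau (DY N c))))
    {Z : ℤ → Matrix (Idx N) (Idx N) (DYc N c)}
    (hZ : IsNull ((linTopDYc N c).matrix (Idx N)) Z) :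
    (L.map fun Φ k => rhoMat k Φ).foldr conv Z = conv (fun k => rhoMat k L.prod) Z := by
  induction L with
  | nil =>
    funext k
    simp only [List.map_nil, List.foldr_nil, List.prod_nil, rhoMat_one]
    exact (conv_one Z k).symm
  | cons Φ L ih =>
    funext k
    simp only [List.map_cons, List.foldr_cons, List.prod_cons]
    rw [ih, conv_assoc (isGood_rhoMat Φ) (isGood_rhoMat L.prod) hZ]
    simp only [rhoMat_mul]

variable (c) (G : Matrix (Fin N) (Fin N) ℂ)

/-- `S⁺(u - ih)`. -/
def posS (i : ℕ) : Matrix (Fin N) (Fin N) (Lau (DY N c)) :=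
  (Splus c G).map fun f => toLau _ (posEv _ (shiftP i) f)

lemma posEv_neg (p : PowerSeries K) (f : PowerSeries (DY N c)) :
    posEv (DY N c) p (PowerSeries.mk fun m => (-1) ^ m * coeff m f) = posEv (DY N c) (-p) f := by
  ext m b
  rw [coeff_posEv, coeff_posEv, coeff_mk]
  rcases Nat.even_or_odd m with hm | hm
  · rw [hm.neg_one_pow, one_mul, hm.neg_pow]
  · rw [hm.neg_one_pow, hm.neg_pow, map_neg, neg_smul, neg_one_mul, smul_neg]

lemma posS_eq (i : ℕ) : posS c G i = posT N c (shiftP i) *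
    ((scalMat G).map C).map (algebraMap (Bi K) (Lau (DY N c))) *
      (posT N c (-shiftP i)).transpose := by
  have h1 : posS c G i = (Splus c G).map ((toLau (DY N c)).comp (posEv _ (shiftP i))) := rfl
  have h2 : (constMat (DY N c) G).map ((toLau (DY N c)).comp (posEv _ (shiftP i))) =
      ((scalMat G).map C).map (algebraMap (Bi K) (Lau (DY N c))) := by
    refine Matrix.ext fun a b => ?_
    rw [Matrix.map_apply, constMat, Matrix.map_apply, RingHom.comp_apply, posEv_C, Matrix.map_apply,
      Matrix.map_apply, scalMat, Matrix.map_apply, algebraMap_lau, scal, PowerSeries.map_C,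
      PowerSeries.map_C]
  have h3 : (((Tplus tGen).map fun f => PowerSeries.mk fun m =>
      (-1) ^ m * coeff m f).transpose).map ((toLau (DY N c)).comp (posEv _ (shiftP i))) =
      (posT N c (-shiftP i)).transpose := by
    refine Matrix.ext fun a b => ?_
    rw [Matrix.map_apply, Matrix.transpose_apply, Matrix.map_apply, RingHom.comp_apply, posEv_neg]
    rfl
  rw [h1, Splus, Matrix.map_mul, Matrix.map_mul, h2, h3]
  rfl

lemma summable_shiftTerm_entry (i : Fin N) (m : ℕ) (f : PowerSeries (DY N c)) :
    Summable fun l : ℕ => toDYc c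
      ((((m + l).choose l : ℂ) • (-(i : ℕ) : ℂ) ^ l • h ^ l : K) • coeff (m + l) f) := by
  have h1 := summable_smul (c := c) (N := N) (fun b => b) (fun n => Set.finite_lt_nat n) fun l =>
    toDYc c ((((m + l).choose l : ℂ) • (-(i : ℕ) : ℂ) ^ l • (1 : K)) • coeff (m + l) f)
  refine h1.congr fun l => ?_
  rw [← map_smul, smul_smul]
  congr 2
  rw [Algebra.smul_def, Algebra.smul_def, Algebra.smul_def, Algebra.smul_def]
  ring

theorem summable_shiftTerm (i : Fin N) (m : ℕ) : Summable (shiftTerm c G i m) :=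
  Pi.summable.2 fun a => Pi.summable.2 fun b => summable_shiftTerm_entry c i m (Splus c G a b)

lemma tsum_shiftTerm_apply (i : Fin N) (m : ℕ) (a b : Fin N) :
    (∑' l, shiftTerm c G i m l) a b = rho m (posS c G i a b) := by
  have h1 : HasSum (shiftTerm c G i m) (Matrix.of fun a b => rho m (posS c G i a b)) := by
    refine Pi.hasSum.2 fun a => Pi.hasSum.2 fun b => ?_
    rw [Matrix.of_apply, posS, Matrix.map_apply, rho_posEv_shiftP]
    exact (summable_shiftTerm_entry c i m (Splus c G a b)).hasSum
  rw [h1.tsum_eq, Matrix.of_apply]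

/-- Nonnegative coefficients agree by the binomial expansion; negative ones vanish because (u -
ih)^m is a polynomial in u. -/
lemma plusFactor_eq (i : Fin N) :
    plusFactor c G i = fun k => rhoMat k (siteOp i (posS c G i)) := by
  funext k
  refine Matrix.ext fun I J => ?_
  rw [rhoMat, Matrix.map_apply, siteOp, Matrix.of_apply]
  cases k with
  | ofNat m =>
    simp only [plusFactor, atSite, Matrix.of_apply, tsum_shiftTerm_apply]
    split_ifs
    · rfl
    · rw [map_zero]
  | negSucc m =>
    simp only [plusFactor, Matrix.zero_apply]
    split_ifs
    · rw [posS, Matrix.map_apply, rho_posEv_shiftP_neg _ _ (Int.negSucc_lt_zero m)]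
    · rw [map_zero]

/-- `R̄ᵗ_ij(-2u + (i+j)h)`. -/
def posR (i j : Fin N) : SiteOp (Fin N) N (Lau (DY N c)) :=
  reflR (fun i j : Fin N => C (gEval N (invLin (-2) ((i + j : ℕ) : K))))
    (fun i j : Fin N => C (invLin (-2) ((i + j : ℕ) : K))) i j

/-- R̄ᵗ(-2u + (i + j)h) depends on u and h only through h/u, so it is a rescaled series with no h in
its parameters. -/
lemma RbarT_eq {i j : Fin N} (hij : i ≠ j) :
    RbarT i j (((i : ℕ) + (j : ℕ) : ℂ) • h) = ((reflR (fun i j : Fin N =>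
      (gEval N (invLin (-2) ((i + j : ℕ) : K)))) (fun i j : Fin N => (invLin (-2) ((i + j : ℕ) : K)))
      i j : SiteOp (Fin N) N (PowerSeries K))).map (rescale h) := by
  have h1 := atSites_Rbar_map (R := PowerSeries K) (B := K) hij (invLin (-2) (((i : ℕ) + (j : ℕ) : ℂ) • h))
  have e : ((i : ℕ) + (j : ℕ) : K) = algebraMap ℂ K ((i : ℕ) + (j : ℕ)) := by simp
  rw [RbarT]
  refine Eq.trans ?_ (h1.trans ?_)
  · rfl
  · refine Matrix.ext fun I J => ?_
    have h2 : C h * invLin (-2) (((i : ℕ) + (j : ℕ) : ℂ) • h) = _ :=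
      h_mul_invLin (-2) (by norm_num) _
    have h3 : (C (algebraMap K K h) * invLin (-2) (((i : ℕ) + (j : ℕ) : ℂ) • h)) =
        rescale h (invLin (-2) ((i + j : ℕ) : K)) := by
      refine h2.trans ?_
      rw [Nat.cast_add, e]
    rw [h3, ← rescale_gEval (constantCoeff_invLin _ _), Matrix.map_apply, reflR]
    simp only [Matrix.smul_apply, Matrix.sub_apply, smul_eq_mul, map_mul, map_sub]
    congr 2
    · rw [Matrix.one_apply]; split_ifs <;> simp
    · congr 1
      simp only [capOp, Matrix.of_apply]; split_ifs <;> simp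

lemma reflFactor_eq {i j : Fin N} (hij : i ≠ j) :
    (fun k => (negCoeff (RbarT i j (((i : ℕ) + (j : ℕ) : ℂ) • h)) k).map
      (algebraMap K (DYc N c))) = fun k => rhoMat k (posR c i j) := by
  funext k
  refine Matrix.ext fun I J => ?_
  have h1 : posR c i j I J = algebraMap (Bi K) (Lau (DY N c)) (C ((reflR (fun i j : Fin N =>
      (gEval N (invLin (-2) ((i + j : ℕ) : K)))) (fun i j : Fin N => (invLin (-2) ((i + j : ℕ) : K)))
      i j : SiteOp (Fin N) N (PowerSeries K)) I J)) := by
    simp only [posR, reflR, Matrix.smul_apply, Matrix.sub_apply, smul_eq_mul, map_mul, map_sub]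
    simp only [Algebra.smul_def]
    congr 2
    · rw [Matrix.one_apply, Matrix.one_apply]; split_ifs <;> simp
    · congr 1
      simp only [capOp, Matrix.of_apply]; split_ifs <;> simp
  rw [rhoMat, Matrix.map_apply, Matrix.map_apply, h1, rho_scalar, RbarT_eq hij, negCoeff]
  split_ifs
  · rw [Matrix.map_apply, Matrix.map_apply, coeff_rescale]
  · rfl

/-- The factors of `S⁺_{[N]}(u_-)`. -/
def posList : List (SiteOp (Fin N) N (Lau (DY N c))) :=
  (List.finRange N).flatMap fun i => siteOp i (posS c G i) ::
    (((List.finRange N).filter fun j => i < j).map fun j => posR c i j)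

lemma prod_posList : (posList c G).prod = posBracket c G := by
  rw [posList, List.flatMap_def, List.prod_flatten, List.map_map, posBracket, ← rowProd_eq _ _ _ (List.pairwise_lt_finRange N)]
  simp only [Function.comp_def, List.prod_cons, posS_eq]
  rfl

/-- The coefficients of `S_{[N]}(u_- + hc/2)⁻¹`. -/
def invCoeff (k : ℤ) : Matrix (Idx N) (Idx N) (DYc N c) :=
  (negCoeff (Ring.inverse (Sbracket c G)) k).map (toDYc c)

lemma factors_eq : factors c G = (posList c G).map (fun Φ k => rhoMat k Φ) ++ [invCoeff c G] := by
  rw [factors, posList, List.map_flatMap]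
  congr 1
  refine List.flatMap_congr fun i _ => ?_
  rw [List.map_cons, List.map_map, plusFactor_eq]
  congr 1
  refine List.map_congr_left fun j hj => ?_
  exact reflFactor_eq c (of_decide_eq_true (List.mem_filter.1 hj).2).ne

variable {G}

lemma isNull_invCoeff_entry (hG : IsUnit G.det) (I J : Idx N) :
    IsNull (linTopDYc N c) fun k => invCoeff c G k I J := by
  intro n
  obtain ⟨q, hq⟩ := coeff_inverse_mem_nbhd (c := c) hG n
  refine ⟨-q, fun e he => ?_⟩
  simp only [invCoeff, negCoeff]
  rw [if_pos (by omega), Matrix.map_apply, Matrix.map_apply]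
  exact toDYc_mem_closedNbhd (hq _ (by omega) I J)

lemma isNull_invCoeff (hG : IsUnit G.det) :
    IsNull ((linTopDYc N c).matrix (Idx N)) (invCoeff c G) := by
  intro n
  choose q hq using fun I J => isNull_invCoeff_entry c hG I J n
  refine ⟨-∑ i, ∑ j, |q i j|, fun e he => (Ideal.mem_matrix _ _ _).2 fun I J => ?_⟩
  refine hq I J e (lt_of_lt_of_le he ?_)
  have h2 := (Finset.single_le_sum (f := fun j => |q I j|) (fun _ _ => abs_nonneg _)
    (Finset.mem_univ J)).trans (Finset.single_le_sum (f := fun i => ∑ j, |q i j|)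
    (fun _ _ => Finset.sum_nonneg fun _ _ => abs_nonneg _) (Finset.mem_univ I))
  have h3 := neg_abs_le (q I J)
  linarith

/-- All factors but the last decay h-adically and the last decays modulo the left ideals; hence the
sum over all exponent vectors converges to the iterated convolution. -/
lemma hasSum_productTerm (hG : IsUnit G.det) (k : ℤ) :
    HasSum (productTerm c G k) (conv (fun k => rhoMat k (posBracket c G)) (invCoeff c G) k) := by
  have h1 : IsFactorList ((linTopDYc N c).matrix (Idx N)) (factors c G)
      (conv (fun k => rhoMat k (posBracket c G)) (invCoeff c G)) := by
    rw [factors_eq, ← prod_posList, ← foldr_conv_rhoMat _ (isNull_invCoeff c hG)]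
    refine IsFactorList.of_append (fun F hF => ?_) (isNull_invCoeff c hG)
    obtain ⟨Φ, -, rfl⟩ := List.mem_map.1 hF
    exact isGood_rhoMat Φ
  exact h1.hasSum k

end Factors

/-! ### Commutation of the coefficients of 𝔸(u) with the double Yangian. -/

section Central

variable {N : ℕ} [NeZero N] {c : ℂ} {G : Matrix (Fin N) (Fin N) ℂ}

lemma commute_of_commute_C {A : Type*} [Ring A] {y : PowerSeries A} (hy : ∀ x, Commute y (C x))
    (f : PowerSeries A) : Commute y f := by
  have h1 : ∀ m x, coeff m y * x = x * coeff m y := by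
    intro m x
    have := congrArg (coeff m) (hy x).eq
    rwa [coeff_mul_C, coeff_C_mul] at this
  ext m
  rw [coeff_mul, coeff_mul, ← Finset.Nat.sum_antidiagonal_swap]
  exact Finset.sum_congr rfl fun p _ => h1 _ _

/-- Ω = Ω S Z = y Ω Z. Read at the identity multi-index, this gives a right inverse of y, which is
two-sided since y commutes with all series; the inverse of such an element again commutes with the
constants. -/
lemma inverse_eigenvalue {A : Type*} [Ring A] {S Z : SiteOp (Fin N) N (PowerSeries A)}
    {y : PowerSeries A} (hS : Matrix.vecMul (altVec N _) S = y • altVec N _) (hSZ : S * Z = 1)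
    (hy : ∀ x, Commute y (C x)) : ∃ y' : PowerSeries A,
      Matrix.vecMul (altVec N _) Z = y' • altVec N _ ∧ ∀ x, Commute y' (C x) := by
  have h1 : y • Matrix.vecMul (altVec N _) Z = altVec N (PowerSeries A) := by
    rw [← Matrix.smul_vecMul, ← hS, Matrix.vecMul_vecMul, hSZ, Matrix.vecMul_one]
  have h2 : ∀ J, y * Matrix.vecMul (altVec N _) Z J = altVec N (PowerSeries A) J := fun J =>
    congrFun h1 J
  have h3 : y * Matrix.vecMul (altVec N _) Z id = 1 := by
    rw [h2, altVec, altForm_id, Int.cast_one]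
  have h4 : Matrix.vecMul (altVec N _) Z id * y = 1 := by
    rw [← (commute_of_commute_C hy _).eq, h3]
  refine ⟨Matrix.vecMul (altVec N _) Z id, funext fun J => ?_, fun x => ?_⟩
  · rw [Pi.smul_apply, smul_eq_mul, ← h2 J, ← mul_assoc, h4, one_mul]
  · have := (commute_of_commute_C hy (C x)).eq
    calc Matrix.vecMul (altVec N _) Z id * C x
        = Matrix.vecMul (altVec N _) Z id * (C x * y) * Matrix.vecMul (altVec N _) Z id := by
          rw [mul_assoc, mul_assoc (C x), h3, mul_one]
      _ = C x * Matrix.vecMul (altVec N _) Z id := by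
          rw [← this, ← mul_assoc, h4, one_mul]

/-- Ω has integer coordinates, so the additive maps `rho` respect the eigenvector equation
coefficient by coefficient. -/
lemma vecMul_altVec_rhoMat {Φ : SiteOp (Fin N) N (Lau (DY N c))} {x : Lau (DY N c)}
    (hΦ : Matrix.vecMul (altVec N _) Φ = x • altVec N _) (e : ℤ) :
    Matrix.vecMul (altVec N _) (rhoMat e Φ) = rho e x • altVec N _ := by
  funext J
  have h1 := congrArg (rho e) (congrFun hΦ J)
  simp only [Matrix.vecMul, dotProduct, altVec, Pi.smul_apply, smul_eq_mul] at h1 ⊢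
  rw [map_sum, ← zsmul_eq_mul', map_zsmul] at h1
  rw [← zsmul_eq_mul', ← h1]
  refine Finset.sum_congr rfl fun I _ => ?_
  rw [← zsmul_eq_mul, ← zsmul_eq_mul, map_zsmul]
  rfl

lemma commute_rho {x : Lau (DY N c)} (hx : ∀ g, Commute x (constLau _ g)) (e : ℤ) (g : DY N c) :
    Commute (rho e x) (toDYc c g) := by
  have := congrArg (rho e) (hx g).eq
  rwa [rho_constLau_mul, rho_mul_constLau] at this

lemma vecMul_altVec_invCoeff {y : PowerSeries (DY N c)}
    (hy : Matrix.vecMul (altVec N _) (Ring.inverse (Sbracket c G)) = y • altVec N _)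
    (hy' : ∀ x, Commute y (C x)) (k : ℤ) : ∃ ζ : DYc N c,
      Matrix.vecMul (altVec N _) (invCoeff c G k) = ζ • altVec N _ ∧
      ∀ g, Commute ζ (toDYc c g) := by
  by_cases hk : k ≤ 0
  · refine ⟨toDYc c (coeff (-k).toNat y), funext fun J => ?_, fun g => ?_⟩
    · have h1 := congrArg (fun f => toDYc c (coeff (-k).toNat f)) (congrFun hy J)
      simp only [Matrix.vecMul, dotProduct, altVec, Pi.smul_apply, smul_eq_mul] at h1 ⊢
      rw [← zsmul_eq_mul', map_zsmul, map_zsmul, map_sum, map_sum] at h1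
      rw [← zsmul_eq_mul', ← h1]
      refine Finset.sum_congr rfl fun I _ => ?_
      rw [← zsmul_eq_mul, ← zsmul_eq_mul, map_zsmul, map_zsmul, invCoeff, negCoeff, if_pos hk,
        Matrix.map_apply, Matrix.map_apply]
    · have h1 := congrArg (coeff (-k).toNat) (hy' g).eq
      rw [coeff_mul_C, coeff_C_mul] at h1
      have h2 := congrArg (toDYc c) h1
      rwa [map_mul, map_mul] at h2
  · refine ⟨0, ?_, fun g => Commute.zero_left _⟩
    rw [invCoeff, negCoeff, if_neg hk, zero_smul]
    have : (0 : Matrix (Idx N) (Idx N) (DY N c)).map (toDYc c) = 0 := Matrix.map_zero _ (map_zero _)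
    rw [this, Matrix.vecMul_zero]

/-- Each row of the antisymmetrizer is alternating, hence a multiple of Ω; so the trace only sees Ω
times the product. -/
lemma antisymmetrizer_eq (I J : Idx N) :
    antisymmetrizer N I J = antisymmetrizer N I id * (altForm J : ℂ) := by
  refine IsAlt.eq_mul (φ := antisymmetrizer N I) ?_ (fun x hx => ?_) J
  · intro J i j hij
    have hne : i ≠ j := fun e => by subst e; omega
    simp only [antisymmetrizer, Matrix.of_apply]
    rw [← mul_neg, ← Finset.sum_neg_distrib, ← Equiv.sum_comp (Equiv.mulLeft (Equiv.swap i j))]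
    congr 1
    refine Finset.sum_congr rfl fun σ _ => ?_
    have e : (J ∘ Equiv.swap i j) ∘ (Equiv.swap i j * σ : Equiv.Perm (Fin N)) = J ∘ σ := by
      funext m; simp
    simp only [Equiv.coe_mulLeft, e, Equiv.Perm.sign_mul, Equiv.Perm.sign_swap hne]
    split_ifs <;> simp
  · simpa using hx

/-- The rows of the product commute with the double Yangian. -/
lemma commute_vecMul_product (hG : IsUnit G.det) (hsymm : G.transpose = G ∨ G.transpose = -G)
    (k : ℤ) (J : Idx N) (g : DY N c) :
    Commute (Matrix.vecMul (altVec N _) (∑' e, productTerm c G k e) J) (toDYc c g) := by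
  obtain ⟨x, hx, hx'⟩ := posBracket_eigenvalue (c := c) hsymm
  obtain ⟨y, hy, hy'⟩ := Sbracket_eigenvalue (c := c) hsymm
  obtain ⟨y', hy1, hy2⟩ := inverse_eigenvalue hy
    (Ring.mul_inverse_cancel _ (isUnit_Sbracket (c := c) hG)) hy'
  choose ζ hζ hζ' using vecMul_altVec_invCoeff hy1 hy2
  have hs := (summable_conv (isGood_rhoMat (posBracket c G)) (isNull_invCoeff c hG) k).hasSum
  -- Expanding the convolution, every term of Ω S⁺_{[N]} S_{[N]}⁻¹ is Ω times an eigenvalue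
  -- coefficient of S⁺_{[N]} times one of the inverse, and both commute with the double Yangian.
  have h1 : HasSum (fun e => rho e x * ζ (k - e) * altVec N (DYc N c) J)
      (Matrix.vecMul (altVec N _) (∑' e, productTerm c G k e) J) := by
    rw [(hasSum_productTerm c hG k).tsum_eq]
    have h2 := hasSum_sum (s := Finset.univ) fun I _ =>
      (Pi.hasSum.1 (Pi.hasSum.1 hs I) J).mul_left (altVec N (DYc N c) I)
    have h3 : ∀ e, ∑ I, altVec N (DYc N c) I * (rhoMat e (posBracket c G) * invCoeff c G (k - e)) I J
        = rho e x * ζ (k - e) * altVec N (DYc N c) J := by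
      intro e
      change Matrix.vecMul (altVec N _) (rhoMat e (posBracket c G) * invCoeff c G (k - e)) J = _
      rw [← Matrix.vecMul_vecMul, vecMul_altVec_rhoMat hx, Matrix.smul_vecMul, hζ, smul_smul]
      rfl
    simp only [h3] at h2
    exact h2
  have h2 := h1.mul_left (toDYc c g)
  have h3 := h1.mul_right (toDYc c g)
  refine h3.unique ?_
  convert h2 using 2 with e
  exact ((commute_rho hx' e g).mul_left (hζ' _ g)).mul_left (Int.cast_commute _ _) |>.eq

/-- The elements that commute with the coefficient form a closed set, which contains the dense image
of the double Yangian. So the coefficient is central even in the completed double Yangian. -/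
theorem commute_coeffA (hG : IsUnit G.det) (hsymm : G.transpose = G ∨ G.transpose = -G)
    (k : ℤ) (z : DYc N c) : Commute (coeffA c G k) z := by
  have h1 : ∀ g, Commute (coeffA c G k) (toDYc c g) := by
    intro g
    have e : coeffA c G k = ∑ I, algebraMap K (DYc N c) (algebraMap ℂ K (antisymmetrizer N I id)) *
        Matrix.vecMul (altVec N _) (∑' e, productTerm c G k e) I := by
      rw [coeffA, Matrix.trace]
      refine Finset.sum_congr rfl fun I _ => ?_
      rw [Matrix.diag_apply, Matrix.mul_apply, Matrix.vecMul, dotProduct, Finset.mul_sum]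
      refine Finset.sum_congr rfl fun J _ => ?_
      rw [Matrix.map_apply, antisymmetrizer_eq, map_mul, map_mul, map_intCast, map_intCast,
        mul_assoc, altVec]
    rw [e]
    exact Commute.sum_left _ _ _ fun I _ =>
      Commute.mul_left (Algebra.commutes _ _) (commute_vecMul_product hG hsymm k I g)
  have h2 : IsClosed {z | coeffA c G k * z = z * coeffA c G k} :=
    isClosed_eq (by fun_prop) (by fun_prop)
  have h3 := h2.closure_subset_iff.2 (Set.range_subset_iff.2 fun g => (h1 g).eq)
  exact h3 (denseRange_toDYc z)

end Central

/-! ### The coefficients of 𝔸(u) belong to Ã. -/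

section Membership

variable {N : ℕ} [NeZero N] {c : ℂ} {G : Matrix (Fin N) (Fin N) ℂ}

/-- T⁺ and its transpose are 1 minus a multiple of h, so S⁺ - G is divisible by h; this exhibits the
generators s^{(-r)}. -/
lemma coeff_Splus (i j : Fin N) (r : ℕ) : ∃ x : DY N c, coeff r (Splus c G i j) =
    algebraMap K _ (algebraMap ℂ K (if r = 0 then G i j else 0)) - h • x := by
  let τ : Matrix (Fin N) (Fin N) (PowerSeries (DY N c)) :=
    Matrix.of fun i j => PowerSeries.mk fun r => tGen (.neg i j r)
  let τ' : Matrix (Fin N) (Fin N) (PowerSeries (DY N c)) :=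
    Matrix.of fun i j => PowerSeries.mk fun r => (-1) ^ r * tGen (.neg j i r)
  let Γ : Matrix (Fin N) (Fin N) (PowerSeries (DY N c)) := constMat _ G
  have h1 : Tplus (tGen (N := N) (c := c)) = 1 - h • τ := by
    refine Matrix.ext fun i j => PowerSeries.ext fun r => ?_
    simp only [Tplus, Matrix.of_apply, coeff_mk, Matrix.sub_apply, Matrix.smul_apply, map_sub, τ]
    congr 1
    · rw [Matrix.one_apply]
      by_cases hij : i = j <;> simp [hij, coeff_one]
    · simp
  have h2 : ((Tplus (tGen (N := N) (c := c))).map fun f =>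
      PowerSeries.mk fun m => (-1) ^ m * coeff m f).transpose = 1 - h • τ' := by
    refine Matrix.ext fun i j => PowerSeries.ext fun r => ?_
    simp only [Tplus, Matrix.of_apply, coeff_mk, Matrix.sub_apply, Matrix.smul_apply, map_sub, τ',
      Matrix.transpose_apply, Matrix.map_apply, mul_sub]
    congr 1
    · rw [Matrix.one_apply]
      by_cases hij : i = j
      · cases r <;> simp [hij, coeff_one]
      · simp [hij, Ne.symm hij]
    · rw [mul_smul_comm]; simp
  have h3 : Splus c G = Γ - h • (τ * Γ + Γ * τ' - h • (τ * Γ * τ')) := by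
    rw [Splus, h2, h1]
    change (1 - h • τ) * Γ * (1 - h • τ') = _
    simp only [sub_mul, mul_sub, one_mul, mul_one, smul_mul_assoc, mul_smul_comm, smul_sub, smul_add]
    abel
  refine ⟨coeff r ((τ * Γ + Γ * τ' - h • (τ * Γ * τ')) i j), ?_⟩
  rw [h3, Matrix.sub_apply, map_sub, Matrix.smul_apply]
  congr 1
  simp only [Γ, constMat, Matrix.map_apply, coeff_C]
  split_ifs <;> simp

lemma coeff_Splus_mem (i j : Fin N) (r : ℕ) : coeff r (Splus c G i j) ∈ Ac c G := by
  obtain ⟨x, hx⟩ := coeff_Splus (c := c) (G := G) i j r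
  rw [hx]
  exact sub_mem (Subalgebra.algebraMap_mem _ _)
    (Subalgebra.smul_mem (Ac c G) (Algebra.subset_adjoin ⟨i, j, r, Or.inl hx⟩) _)

lemma Sminus_eq : Sminus c G = negT N c 1 (c • h) *
    (scalMat G).map (algebraMap (PowerSeries K) (PowerSeries (DY N c))) *
      (negT N c (-1) ((0 : ℂ) • h)).transpose := by
  have e : ∀ M : Matrix (Fin N) (Fin N) (PowerSeries (DY N c)), ∀ (α : ℂ) (s : K),
      substInv M (invLin α s) = M.map (evLin (DY N c) α s) := by
    intro M α s
    refine Matrix.ext fun i j => ?_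
    simp only [substInv, Matrix.map_apply]
    exact evalInv_eq_evLin (B := K) (A := DY N c) α s (M i j)
  have e2 : constMat (DY N c) G =
      (scalMat G).map (algebraMap (PowerSeries K) (PowerSeries (DY N c))) := by
    refine Matrix.ext fun i j => ?_
    rw [Matrix.map_apply, scalMat, Matrix.map_apply, algebraMap_powerSeries, PowerSeries.map_C]
    rfl
  rw [Sminus, e, e, e2, zero_smul]
  rfl

lemma Sminus_mem_decaySeries (i j : Fin N) : Sminus c G i j ∈ decaySeries N c := by
  have h1 : (-1 : ℂ) ≠ 0 := by norm_num
  rw [Sminus_eq]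
  refine matrix_mul_mem (decaySeries N c) (matrix_mul_mem (decaySeries N c) (fun a b => ?_)
    fun a b => ?_) (fun a b => ?_) i j
  · exact negT_mem_decaySeries (α := 1) one_ne_zero c a b
  · exact scalMat_mem_decaySeries G a b
  · rw [Matrix.transpose_apply]
    exact negT_mem_decaySeries h1 0 b a

lemma coeff_zero_Sminus (i j : Fin N) :
    coeff 0 (Sminus c G i j) = algebraMap K _ (algebraMap ℂ K (G i j)) := by
  have h1 : (Sminus c G).map (constantCoeff (R := DY N c)) = G.map (complexDY N c) := by
    rw [Sminus_eq, Matrix.map_mul, Matrix.map_mul, Matrix.transpose_map, constantCoeff_negT,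
      constantCoeff_negT, Matrix.transpose_one, Matrix.mul_one, Matrix.one_mul]
    refine Matrix.ext fun a b => ?_
    rw [Matrix.map_apply, Matrix.map_apply, scalMat, Matrix.map_apply, algebraMap_powerSeries,
      PowerSeries.map_C, constantCoeff_C]
    rfl
  rw [coeff_zero_eq_constantCoeff_apply]
  exact congrFun (congrFun h1 i) j

lemma coeff_Sminus_mem (i j : Fin N) (r : ℕ) : coeff r (Sminus c G i j) ∈ Ac c G := by
  cases r with
  | zero => rw [coeff_zero_Sminus]; exact Subalgebra.algebraMap_mem _ _
  | succ r =>
    obtain ⟨x, hx⟩ := (Sminus_mem_decaySeries (c := c) (G := G) i j).2.2 r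
    rw [hx]
    exact Subalgebra.smul_mem (Ac c G) (Algebra.subset_adjoin ⟨i, j, r, Or.inr hx⟩) _

/-- The power series with coefficients in a subalgebra. -/
def seriesIn {A : Type*} [Ring A] [Algebra K A] (S : Subalgebra K A) : Subring (PowerSeries A) where
  carrier := {f | ∀ m, coeff m f ∈ S}
  zero_mem' := fun m => by rw [map_zero]; exact zero_mem _
  one_mem' := fun m => by
    rw [coeff_one]; split_ifs
    exacts [one_mem _, zero_mem _]
  add_mem' := fun hf hg m => by rw [map_add]; exact add_mem (hf m) (hg m)
  neg_mem' := fun hf m => by rw [map_neg]; exact neg_mem (hf m)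
  mul_mem' := fun hf hg m => by rw [coeff_mul]; exact sum_mem fun p _ => mul_mem (hf _) (hg _)

lemma atSite_mem {B : Type*} [Ring B] (S : Subring B) {k : Fin N} {M : Matrix (Fin N) (Fin N) B}
    (hM : ∀ i j, M i j ∈ S) : atSite k M ∈ S.matrix (n := Idx N) := by
  intro I J
  simp only [atSite, Matrix.of_apply]
  split_ifs
  exacts [hM _ _, zero_mem _]

lemma coeff_Sbracket_mem (m : ℕ) (I J : Idx N) : coeff m (Sbracket c G I J) ∈ Ac c G := by
  have h1 : Sbracket c G ∈ (seriesIn (Ac c G)).matrix (n := Idx N) := by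
    rw [Sbracket]
    refine list_prod_mem fun x hx => ?_
    obtain ⟨i, -, rfl⟩ := List.mem_map.1 hx
    refine mul_mem (atSite_mem _ fun a b r => ?_) (list_prod_mem fun x hx => ?_)
    · rw [substInv, Matrix.map_apply, evalInv, coeff_mk]
      exact sum_mem fun q _ => Subalgebra.smul_mem _ (coeff_Sminus_mem a b q) _
    · obtain ⟨j, -, rfl⟩ := List.mem_map.1 hx
      intro I J r
      rw [Matrix.map_apply, coeff_map]
      exact Subalgebra.algebraMap_mem _ _
  exact h1 I J m

lemma toDYc_mem_Atilde {x : DY N c} (hx : x ∈ Ac c G) : toDYc c x ∈ Atilde c G :=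
  Subalgebra.le_topologicalClosure _ (Subalgebra.mem_map.2 ⟨x, hx, rfl⟩)

lemma hasSum_mem_Atilde {ι : Type*} {f : ι → DYc N c} {x : DYc N c} (hf : HasSum f x)
    (h1 : ∀ i, f i ∈ Atilde c G) : x ∈ Atilde c G :=
  (Subalgebra.isClosed_topologicalClosure _).mem_of_tendsto hf
    (Filter.Eventually.of_forall fun s => sum_mem fun i _ => h1 i)

lemma factors_mem (hG : IsUnit G.det) {F : ℤ → Matrix (Idx N) (Idx N) (DYc N c)}
    (hF : F ∈ factors c G) (k : ℤ) : F k ∈ (Atilde c G).toSubring.matrix (n := Idx N) := by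
  rw [factors, List.mem_append] at hF
  rcases hF with hF | hF
  · obtain ⟨i, -, hF⟩ := List.mem_flatMap.1 hF
    rcases List.mem_cons.1 hF with rfl | hF
    · cases k with
      | ofNat m =>
        refine atSite_mem (Atilde c G).toSubring fun a b => ?_
        refine hasSum_mem_Atilde (Pi.hasSum.1 (Pi.hasSum.1 (summable_shiftTerm c G i m).hasSum a) b)
          fun l => toDYc_mem_Atilde (Subalgebra.smul_mem _ (coeff_Splus_mem a b _) _)
      | negSucc m => exact zero_mem _
    · obtain ⟨j, -, rfl⟩ := List.mem_map.1 hF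
      exact fun I J => Subalgebra.algebraMap_mem _ _
  · rw [List.mem_singleton] at hF
    subst hF
    intro I J
    refine toDYc_mem_Atilde ?_
    rw [negCoeff]
    split_ifs
    · exact coeff_inverse_mem hG (Ac c G) coeff_Sbracket_mem _ I J
    · exact zero_mem _

/-- Every coefficient of every factor has entries in Ã: the constant term of S_{[N]} is inverted by
scalars, so the recursion for its inverse stays in A_c. Being closed, Ã contains the convergent
sums. -/
theorem coeffA_mem (hG : IsUnit G.det) (k : ℤ) : coeffA c G k ∈ Atilde c G := by
  have h1 : ∀ e, productTerm c G k e ∈ (Atilde c G).toSubring.matrix (n := Idx N) := by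
    intro e
    refine list_prod_mem fun x hx => ?_
    obtain ⟨j, rfl⟩ := (List.mem_ofFn' _ _).1 hx
    exact factors_mem hG (List.get_mem _ _) _
  have h2 : ∀ I J, (∑' e, productTerm c G k e) I J ∈ Atilde c G := fun I J =>
    hasSum_mem_Atilde (Pi.hasSum.1 (Pi.hasSum.1 (hasSum_productTerm c hG k).summable.hasSum I) J)
      fun e => h1 e I J
  rw [coeffA, Matrix.trace]
  refine sum_mem fun I _ => ?_
  rw [Matrix.diag_apply, Matrix.mul_apply]
  exact sum_mem fun J _ => mul_mem (Subalgebra.algebraMap_mem _ _) (h2 J I)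

end Membership

end TwistedYangian
end

theorem proposition4p3 (N : ℕ) [NeZero N] (hN : 2 ≤ N) (c : ℂ) (hc : c ≠ -(N : ℂ) / 2)
    (G : Matrix (Fin N) (Fin N) ℂ) (hG : IsUnit G.det)
    (hsymm : G.transpose = G ∨ G.transpose = -G) :
    -- the series `𝔸(u)` is well defined
    (IsUnit (TwistedYangian.Sbracket c G) ∧
      (∀ (i : Fin N) (m : ℕ), Summable (TwistedYangian.shiftTerm c G i m)) ∧
      ∀ k : ℤ, Summable (TwistedYangian.productTerm c G k)) ∧
    -- its coefficients belong to the center of `Ã_c(g_N)`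
    ∀ k : ℤ, ∃ hk : TwistedYangian.coeffA c G k ∈ TwistedYangian.Atilde c G,
      (⟨TwistedYangian.coeffA c G k, hk⟩ : TwistedYangian.Atilde c G) ∈
        Subalgebra.center TwistedYangian.K (TwistedYangian.Atilde c G) := by
  refine ⟨⟨TwistedYangian.isUnit_Sbracket hG, TwistedYangian.summable_shiftTerm c G,
    fun k => (TwistedYangian.hasSum_productTerm c hG k).summable⟩, fun k => ?_⟩
  refine ⟨TwistedYangian.coeffA_mem hG k, Subalgebra.mem_center_iff.2 fun b => Subtype.ext ?_⟩
  -- Commutation holds with every element of the completed double Yangian, in particular with those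
  -- of Ã.
  exact (TwistedYangian.commute_coeffA hG hsymm k b.1).eq.symm
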